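/- Let $g$ be a smooth Riemannian metric on an open set $U\subset\mathbb R^2$ with coordinates $(x,y)$ (all statements are local), let $p,q$ be the conjugate momenta, and let $H=\tfrac12|(p,q)|_g^2$ be the Hamiltonian of the geodesic flow. A fractional-linear integral on an open set $V$ is a function $I=\frac{A p+B q}{C p+E q}$ with smooth $A,B,C,E$ on $V$ and $AE-BC$ nowhere zero, such that $\{I,H\}=0$ wherever the denominator is nonzero; it is normalized if $AE-BC=1$. For $s_0\in U$ let $\mathcal I_{s_0}$ be the set of germs at $s_0$ of coefficient matrices $m=\begin{pmatrix}A&B\\ C&E\end{pmatrix}$ of normalized fractional-linear integrals. The group $SL_2(\mathbb R)$ acts on it by $h\cdot m=hm$, that is, $I\mapsto\frac{\alpha I+\beta}{\gamma I+\delta}$. We say that $\mathcal I_{s_0}$ has dimension $d$ if for some $k$ the germs in $\mathcal I_{s_0}$ are determined by their $k$-jets at $s_0$ and these $k$-jets form a nonempty embedded smooth $d$-dimensional submanifold of the space of $k$-jets. Theorem. Suppose that the geodesic flow of $g$ admits a fractional-linear integral on a neighbourhood of $s_0$. Then $\mathcal I_{s_0}$ has dimension $3$ if and only if the Gaussian curvature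 of $g$ is not constant on any neighbourhood of $s_0$. In that case $\mathcal I_{s_0}$ is a union of finitely many $SL_2(\mathbb R)$-orbits, and locally there is only one orbit: for some $k$, every $m\in\mathcal I_{s_0}$ has a neighbourhood, in the topology of $k$-jets at $s_0$, in which all elements of $\mathcal I_{s_0}$ lie in the orbit of $m$. -/

import Mathlib

open scoped ContDiff Topology Matrix

noncomputable section

/-- The partial derivative `∂f/∂xᵢ` of a function on the coordinate plane. -/
def pderiv (i : Fin 2) (f : (Fin 2 → ℝ) → ℝ) (s : Fin 2 → ℝ) : ℝ :=
  fderiv ℝ f s (Pi.single i 1)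

/-- `g` is the coefficient matrix of a smooth Riemannian metric on the coordinate domain `U`. -/
def IsRiemannianMetricOn (g : (Fin 2 → ℝ) → Matrix (Fin 2) (Fin 2) ℝ)
    (U : Set (Fin 2 → ℝ)) : Prop :=
  (∀ i j, ContDiffOn ℝ ∞ (fun s => g s i j) U) ∧ ∀ s ∈ U, (g s).PosDef

/-- Christoffel symbol `Γᵏᵢⱼ` of the Levi-Civita connection. -/
def christoffel (g : (Fin 2 → ℝ) → Matrix (Fin 2) (Fin 2) ℝ) (k i j : Fin 2)
    (s : Fin 2 → ℝ) : ℝ :=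
  (1 / 2) * ∑ l, (g s)⁻¹ k l *
    (pderiv i (fun t => g t j l) s + pderiv j (fun t => g t i l) s
      - pderiv l (fun t => g t i j) s)

/-- The component `Rˡₖᵢⱼ` of the curvature tensor, `R(∂ᵢ, ∂ⱼ) ∂ₖ = ∑ₗ Rˡₖᵢⱼ ∂ₗ`. -/
def curvatureTensor (g : (Fin 2 → ℝ) → Matrix (Fin 2) (Fin 2) ℝ) (l k i j : Fin 2)
    (s : Fin 2 → ℝ) : ℝ :=
  pderiv i (christoffel g l j k) s - pderiv j (christoffel g l i k) s
    + ∑ r, (christoffel g l i r s * christoffel g r j k s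
      - christoffel g l j r s * christoffel g r i k s)

/-- The Gaussian curvature `g(R(∂₀, ∂₁) ∂₁, ∂₀) / det g`. -/
def gaussianCurvature (g : (Fin 2 → ℝ) → Matrix (Fin 2) (Fin 2) ℝ) (s : Fin 2 → ℝ) : ℝ :=
  (∑ l, g s 0 l * curvatureTensor g l 1 0 1 s) / (g s).det

/-- The Hamiltonian of the geodesic flow on the cotangent bundle: half of the squared norm of the
momentum. -/
def geodesicHamiltonian (g : (Fin 2 → ℝ) → Matrix (Fin 2) (Fin 2) ℝ)
    (s p : Fin 2 → ℝ) : ℝ :=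
  (1 / 2) * (p ⬝ᵥ ((g s)⁻¹ *ᵥ p))

/-- The canonical Poisson bracket of two functions on the cotangent bundle, at position `s` and
momentum `p`. -/
def poissonBracket (I H : (Fin 2 → ℝ) → (Fin 2 → ℝ) → ℝ) (s p : Fin 2 → ℝ) : ℝ :=
  ∑ i, (pderiv i (fun t => I t p) s * pderiv i (fun r => H s r) p
    - pderiv i (fun r => I s r) p * pderiv i (fun t => H t p) s)

/-- The function `(A p₀ + B p₁) / (C p₀ + E p₁)` on the cotangent bundle, where
`m s = !![A s, B s; C s, E s]`. -/
def fractionalLinear (m : (Fin 2 → ℝ) → Matrix (Fin 2) (Fin 2) ℝ) (s p : Fin 2 → ℝ) : ℝ :=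
  (m s *ᵥ p) 0 / (m s *ᵥ p) 1

/-- The smooth coefficients `m = !![A, B; C, E]` with `A E - B C` nowhere zero on `V` define an
integral of the geodesic flow over `V`: wherever the denominator does not vanish, the
fractional-linear function Poisson commutes with the Hamiltonian. -/
def IsFractionalLinearIntegralOn (g : (Fin 2 → ℝ) → Matrix (Fin 2) (Fin 2) ℝ)
    (V : Set (Fin 2 → ℝ)) (m : (Fin 2 → ℝ) → Matrix (Fin 2) (Fin 2) ℝ) : Prop :=
  (∀ i j, ContDiffOn ℝ ∞ (fun s => m s i j) V) ∧
  (∀ s ∈ V, (m s).det ≠ 0) ∧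
  ∀ s ∈ V, ∀ p : Fin 2 → ℝ, (m s *ᵥ p) 1 ≠ 0 →
    poissonBracket (fractionalLinear m) (geodesicHamiltonian g) s p = 0

/-- The geodesic flow admits a fractional-linear integral near `s₀`. -/
def AdmitsFractionalLinearIntegralAt (g : (Fin 2 → ℝ) → Matrix (Fin 2) (Fin 2) ℝ)
    (s₀ : Fin 2 → ℝ) : Prop :=
  ∃ V, IsOpen V ∧ s₀ ∈ V ∧ ∃ m, IsFractionalLinearIntegralOn g V m

/-- The local space of integrals at `s₀`: maps `m` that near `s₀` are a fractional-linear integral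
normalized by `A E - B C = 1`. Two maps that agree near `s₀` (equality of germs) are the same
point of this space. -/
def localIntegrals (g : (Fin 2 → ℝ) → Matrix (Fin 2) (Fin 2) ℝ) (s₀ : Fin 2 → ℝ) :
    Set ((Fin 2 → ℝ) → Matrix (Fin 2) (Fin 2) ℝ) :=
  {m | ∃ V, IsOpen V ∧ s₀ ∈ V ∧ IsFractionalLinearIntegralOn g V m ∧ ∀ s ∈ V, (m s).det = 1}

/-- The germs at `s₀` of `m` and `m'` lie in one orbit of `SL₂(ℝ)`, which acts on
fractional-linear functions by `I ↦ (α I + β) / (γ I + δ)`, that is, by left multiplication on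
the coefficient matrix. -/
def MoebiusEquivalentAt (s₀ : Fin 2 → ℝ) (m m' : (Fin 2 → ℝ) → Matrix (Fin 2) (Fin 2) ℝ) :
    Prop :=
  ∃ h : Matrix.SpecialLinearGroup (Fin 2) ℝ,
    ∀ᶠ s in 𝓝 s₀, m' s = (h : Matrix (Fin 2) (Fin 2) ℝ) * m s

/-- The space of `k`-jets of matrix-valued functions of two variables: one real coordinate for
each iterated partial derivative of order at most `k` of each matrix entry. -/
abbrev JetSpace (k : ℕ) : Type :=
  (Σ n : Fin (k + 1), (Fin n → Fin 2)) → Fin 2 → Fin 2 → ℝ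

/-- The `k`-jet at `s₀` of a matrix-valued function: all partial derivatives of order at most `k`
of its entries. -/
def jet (k : ℕ) (s₀ : Fin 2 → ℝ) (m : (Fin 2 → ℝ) → Matrix (Fin 2) (Fin 2) ℝ) : JetSpace k :=
  fun a i j => iteratedFDeriv ℝ a.1 (fun s => m s i j) s₀ (fun r => Pi.single (a.2 r) 1)

/-- `J` is a smooth (embedded) submanifold of dimension `d` of `E`: near each of its points it is
diffeomorphic to an open subset of `ℝᵈ`, by a smooth parametrization `φ` whose inverse is the
restriction of a smooth map `ψ` on an open subset of `E`. -/
def IsSmoothSubmanifold {E : Type*} [NormedAddCommGroup E] [NormedSpace ℝ E] (d : ℕ)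
    (J : Set E) : Prop :=
  ∀ z ∈ J, ∃ (O : Set E) (W : Set (EuclideanSpace ℝ (Fin d)))
    (φ : EuclideanSpace ℝ (Fin d) → E) (ψ : E → EuclideanSpace ℝ (Fin d)),
    IsOpen O ∧ z ∈ O ∧ IsOpen W ∧ ContDiffOn ℝ ∞ φ W ∧ ContDiffOn ℝ ∞ ψ O ∧
    φ '' W = J ∩ O ∧ ∀ w ∈ W, ψ (φ w) = w

/-- The space of germs at `s₀` of the elements of `S` has dimension `d`: for some order `k` the
germs are determined by their `k`-jets at `s₀`, and these `k`-jets form a nonempty smooth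
`d`-dimensional submanifold of the jet space. -/
def HasLocalDimension (s₀ : Fin 2 → ℝ) (S : Set ((Fin 2 → ℝ) → Matrix (Fin 2) (Fin 2) ℝ))
    (d : ℕ) : Prop :=
  ∃ k : ℕ, (∀ m ∈ S, ∀ m' ∈ S, jet k s₀ m = jet k s₀ m' → m =ᶠ[𝓝 s₀] m') ∧
    (jet k s₀ '' S).Nonempty ∧ IsSmoothSubmanifold d (jet k s₀ '' S)

/-- `f` is constant on some neighbourhood of `s₀`. -/
def IsConstantNear (f : (Fin 2 → ℝ) → ℝ) (s₀ : Fin 2 → ℝ) : Prop :=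
  ∃ c : ℝ, ∀ᶠ s in 𝓝 s₀, f s = c

end

/-!
Lower the index of the rows of the coefficient matrix `m` of a normalized fractional-linear integral
to get a coframe `ξ₀, ξ₁`. That the integral Poisson commutes with the Hamiltonian says that a cubic
form in the velocity vanishes, and by `covariant_decomposition` this means that
`∇ᵢξⱼ = aᵢ ξⱼ + bⱼ ξᵢ` for both members of the coframe, with one pair of `1`-forms `a`, `b`; the
normalization expresses `a` through `b` (`exists_coframe_equation`). This is a linear system for `ξ`,
so the integrals with a given `b` form one `SL₂(ℝ)`-orbit (`exists_specialLinear_of_same_form`).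

Commuting partial derivatives on `ξ` gives `∇ᵢbⱼ = bᵢ bⱼ + K gᵢⱼ + w εᵢⱼ` with a new unknown `w`
(`exists_integralForm`), and commuting them on `b` gives the derivative of `w`
(`IsIntegralForm.deriv_w`). The system for `(b, w)` is thus closed: a solution is determined by its
value at a point (`IsIntegralForm.eq_of_eq_at`), and this value is determined by the `2`-jet of `m`.
Commuting derivatives on `w` gives an algebraic equation (`IsIntegralForm.constraint`). Together with
its derivatives, which are linear in `b`, it makes `w` at each point a root of a nonzero polynomial
of degree six that depends on the metric only (`exists_polynomial_isRoot`).

If the curvature is not constant, then near a point where it is not critical `w` determines `b`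
(`IsIntegralForm.eq_of_eqOn`). Hence among seven integrals two lie in one orbit
(`exists_equivalent_of_seven`), so there are finitely many orbits. On the set of `2`-jets of
integrals, `normalizedJet` is a continuous invariant of the orbits with finitely many values. It
separates the orbits, each of which is a copy of `SL₂(ℝ)`
(`isSmoothSubmanifold_of_finite_orbits`).

If the curvature is constant, the algebraic equation reads `w = 0`, so that `b` is closed and the
coframe becomes closed after rescaling by a positive function `φ` (`exists_coframe_potential`). With
`dP = φ ξ₁` and `dQ = -φ ξ₀`, every function `(1 + t P) I + t Q` is again an integral
(`affineFamily_mem_localIntegrals`). The parameter `t` can be read off the first derivatives and is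
independent of the three parameters of `SL₂(ℝ)`, so the jets contain an immersed piece of a space of
dimension four and cannot form a submanifold of dimension three (`not_hasLocalDimension_three`).
-/

/-! ### Curvature identities over a ring with two derivations -/

section DifferentialAlgebra

variable {A : Type*} [CommRing A] [Algebra ℝ A] {D : Fin 2 → Derivation ℝ A A}
  {Γ : Fin 2 → Fin 2 → Fin 2 → A} {g : Fin 2 → Fin 2 → A} {K : A}

/-- The component `Rˡₖ₀₁` of the curvature tensor of the connection with symbols `Γ`. -/
def riemann (D : Fin 2 → Derivation ℝ A A) (Γ : Fin 2 → Fin 2 → Fin 2 → A) (l k : Fin 2) : A :=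
  D 0 (Γ l 1 k) - D 1 (Γ l 0 k) +
    (Γ l 0 0 * Γ 0 1 k + Γ l 0 1 * Γ 1 1 k - Γ l 1 0 * Γ 0 0 k - Γ l 1 1 * Γ 1 0 k)

/-- The Riemann tensor of a metric connection, with its upper index lowered, is antisymmetric. -/
theorem riemann_antisymm (comm : ∀ f, D 0 (D 1 f) = D 1 (D 0 f))
    (compat : ∀ k i j, D k (g i j) =
      Γ 0 k i * g 0 j + Γ 1 k i * g 1 j + (Γ 0 k j * g i 0 + Γ 1 k j * g i 1))
    (i j : Fin 2) :
    riemann D Γ 0 i * g 0 j + riemann D Γ 1 i * g 1 j +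
      (riemann D Γ 0 j * g i 0 + riemann D Γ 1 j * g i 1) = 0 := by
  have h := comm (g i j)
  rw [compat, compat] at h
  simp only [map_add, Derivation.leibniz, smul_eq_mul, compat] at h
  simp only [riemann]
  linear_combination h

/-- `Γ` and `K` are the Christoffel symbols of the Levi-Civita connection and the Gaussian curvature
of the metric `g`, over a ring of functions with two commuting derivations. -/
structure IsLeviCivita (D : Fin 2 → Derivation ℝ A A) (Γ : Fin 2 → Fin 2 → Fin 2 → A)
    (g : Fin 2 → Fin 2 → A) (K : A) : Prop where
  comm : ∀ f, D 0 (D 1 f) = D 1 (D 0 f)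
  symmΓ : ∀ k, Γ k 1 0 = Γ k 0 1
  symmg : g 1 0 = g 0 1
  compat : ∀ k i j, D k (g i j) =
    Γ 0 k i * g 0 j + Γ 1 k i * g 1 j + (Γ 0 k j * g i 0 + Γ 1 k j * g i 1)
  riem₀ : ∀ k, riemann D Γ 0 k = K * g 1 k
  riem₁ : ∀ k, riemann D Γ 1 k = -(K * g 0 k)

theorem IsLeviCivita.curv₀ (h : IsLeviCivita D Γ g K) (k : Fin 2) :
    D 0 (Γ 0 1 k) - D 1 (Γ 0 0 k) + (Γ 0 0 0 * Γ 0 1 k + Γ 0 0 1 * Γ 1 1 k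
      - Γ 0 1 0 * Γ 0 0 k - Γ 0 1 1 * Γ 1 0 k) = K * g 1 k :=
  h.riem₀ k

theorem IsLeviCivita.curv₁ (h : IsLeviCivita D Γ g K) (k : Fin 2) :
    D 0 (Γ 1 1 k) - D 1 (Γ 1 0 k) + (Γ 1 0 0 * Γ 0 1 k + Γ 1 0 1 * Γ 1 1 k
      - Γ 1 1 0 * Γ 0 0 k - Γ 1 1 1 * Γ 1 0 k) = -(K * g 0 k) :=
  h.riem₁ k

/-- The contracted Christoffel symbol `Γᵏₖᵢ`, the logarithmic derivative of the area density. -/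
def christoffelTrace (Γ : Fin 2 → Fin 2 → Fin 2 → A) (i : Fin 2) : A := Γ 0 0 i + Γ 1 1 i

/-- The `1`-form `⋆dK`, up to the area density. -/
def coGrad (D : Fin 2 → Derivation ℝ A A) (g : Fin 2 → Fin 2 → A) (K : A) (j : Fin 2) : A :=
  D 0 K * g 1 j - D 1 K * g 0 j

/-- The Laplacian of the curvature, up to the area density. -/
def coLap (D : Fin 2 → Derivation ℝ A A) (Γ : Fin 2 → Fin 2 → Fin 2 → A)
    (g : Fin 2 → Fin 2 → A) (K : A) : A :=
  D 0 (coGrad D g K 1) - D 1 (coGrad D g K 0) +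
    (coGrad D g K 0 * christoffelTrace Γ 1 - coGrad D g K 1 * christoffelTrace Γ 0)

/-- The contracted Christoffel symbol is a closed `1`-form, because the curvature has no trace. -/
theorem IsLeviCivita.closed_trace (h : IsLeviCivita D Γ g K) :
    D 0 (christoffelTrace Γ 1) = D 1 (christoffelTrace Γ 0) := by
  have h0 := h.curv₀ 0
  have h1 := h.curv₁ 1
  simp only [christoffelTrace, map_add, h.symmΓ, h.symmg] at *
  linear_combination h0 + h1

/-- Commuting partial derivatives on a `1`-form with `∇ᵢξⱼ = aᵢ ξⱼ + bⱼ ξᵢ`. The relation of `a` to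
`b` is the one that holds for the coframe of a normalized integral, and it turns the curvature of
`a` into a multiple of `w`. -/
theorem IsLeviCivita.curvature_coframe (h : IsLeviCivita D Γ g K) {ξ a b : Fin 2 → A} {w : A}
    (ha : ∀ i, 2 * a i = christoffelTrace Γ i - b i)
    (hξ : ∀ i j, D i (ξ j) = Γ 0 i j * ξ 0 + Γ 1 i j * ξ 1 + a i * ξ j + b j * ξ i)
    (hw : 2 * w = D 0 (b 1) - D 1 (b 0)) (j : Fin 2) :
    ξ 0 * (D 1 (b j) - (Γ 0 1 j * b 0 + Γ 1 1 j * b 1 + b 1 * b j + K * g 1 j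
        - (if j = 0 then w else 0)))
      - ξ 1 * (D 0 (b j) - (Γ 0 0 j * b 0 + Γ 1 0 j * b 1 + b 0 * b j + K * g 0 j
        + (if j = 1 then w else 0))) = 0 := by
  have hda : D 0 (a 1) - D 1 (a 0) = -w := by
    have e : D 0 (2 * a 1) - D 1 (2 * a 0) = -(2 * w) := by
      rw [ha, ha, map_sub, map_sub, h.closed_trace, hw]; ring
    -- derivations vanish on scalars only after these are written through `algebraMap`
    have two : (2 : A) = algebraMap ℝ A 2 := (map_ofNat _ 2).symm
    have e2 : (2 : A) * (D 0 (a 1) - D 1 (a 0) + w) = 0 := by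
      simp only [two, Derivation.leibniz, Derivation.map_algebraMap, smul_eq_mul] at e ⊢
      linear_combination e
    have : algebraMap ℝ A (1 / 2) * (2 * (D 0 (a 1) - D 1 (a 0) + w)) = 0 := by rw [e2, mul_zero]
    rw [two, ← mul_assoc, ← map_mul] at this
    norm_num at this
    linear_combination this
  have hc := h.comm (ξ j)
  rw [hξ, hξ] at hc
  simp only [map_add, Derivation.leibniz, smul_eq_mul, hξ] at hc
  have c0 := h.curv₀ j
  have c1 := h.curv₁ j
  fin_cases j <;> simp [h.symmΓ, h.symmg] at *
  · linear_combination -hc + ξ 0 * c0 + ξ 1 * c1 + hda * ξ 0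
  · linear_combination -hc + ξ 0 * c0 + ξ 1 * c1 + hda * ξ 1

/-- The covariant derivative of the `1`-form `b` of an integral: its symmetric part is
`b ⊗ b + K g`, and `w` is its antisymmetric part. -/
structure IsIntegralForm (D : Fin 2 → Derivation ℝ A A) (Γ : Fin 2 → Fin 2 → Fin 2 → A)
    (g : Fin 2 → Fin 2 → A) (K : A) (b : Fin 2 → A) (w : A) : Prop where
  d00 : D 0 (b 0) = Γ 0 0 0 * b 0 + Γ 1 0 0 * b 1 + b 0 * b 0 + K * g 0 0
  d01 : D 0 (b 1) = Γ 0 0 1 * b 0 + Γ 1 0 1 * b 1 + b 0 * b 1 + K * g 0 1 + w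
  d10 : D 1 (b 0) = Γ 0 0 1 * b 0 + Γ 1 0 1 * b 1 + b 0 * b 1 + K * g 0 1 - w
  d11 : D 1 (b 1) = Γ 0 1 1 * b 0 + Γ 1 1 1 * b 1 + b 1 * b 1 + K * g 1 1

variable {b : Fin 2 → A} {w : A}

/-- The derivative of `w`, from commuting partial derivatives on `b`. -/
theorem IsIntegralForm.deriv_w (hb : IsIntegralForm D Γ g K b w) (h : IsLeviCivita D Γ g K)
    (j : Fin 2) :
    D j w = w * (christoffelTrace Γ j + 3 * b j) + coGrad D g K j := by
  have c00 := h.curv₀ 0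
  have c01 := h.curv₀ 1
  have c10 := h.curv₁ 0
  have c11 := h.curv₁ 1
  have e0 := h.comm (b 0)
  have e1 := h.comm (b 1)
  rw [hb.d00, hb.d10] at e0
  rw [hb.d01, hb.d11] at e1
  simp only [christoffelTrace, coGrad, map_add, map_sub, Derivation.leibniz, smul_eq_mul, hb.d00,
    hb.d01, hb.d10, hb.d11, h.compat, h.symmΓ, h.symmg] at *
  fin_cases j <;> simp [h.symmΓ, h.symmg]
  · linear_combination -e0 + c00 * b 0 + c10 * b 1
  · linear_combination -e1 + c01 * b 0 + c11 * b 1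

/-- Commuting partial derivatives on `w` gives an algebraic relation between `b` and `w`. -/
theorem IsIntegralForm.constraint (hb : IsIntegralForm D Γ g K b w) (h : IsLeviCivita D Γ g K) :
    6 * w ^ 2 + 3 * (coGrad D g K 0 * b 1 - coGrad D g K 1 * b 0) + coLap D Γ g K = 0 := by
  have e := h.comm w
  have ht := h.closed_trace
  rw [hb.deriv_w h, hb.deriv_w h] at e
  have three : (3 : A) = algebraMap ℝ A 3 := (map_ofNat _ 3).symm
  simp only [map_add, Derivation.leibniz, smul_eq_mul, hb.deriv_w h, three,
    Derivation.map_algebraMap, hb.d01, hb.d10] at e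
  rw [← three] at e
  rw [coLap]
  linear_combination e - w * ht

/-- The derivatives of the algebraic relation. The terms quadratic in `b` have been removed with the
relation itself, so that the result is linear in `b`. -/
theorem IsIntegralForm.deriv_constraint (hb : IsIntegralForm D Γ g K b w)
    (h : IsLeviCivita D Γ g K) (j : Fin 2) :
    30 * w ^ 2 * b j + 12 * christoffelTrace Γ j * w ^ 2 + 15 * coGrad D g K j * w
      + 3 * (D j (coGrad D g K 0) * b 1 - D j (coGrad D g K 1) * b 0
        + coGrad D g K 0 * (Γ 0 j 1 * b 0 + Γ 1 j 1 * b 1 + K * g j 1)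
        - coGrad D g K 1 * (Γ 0 j 0 * b 0 + Γ 1 j 0 * b 1 + K * g j 0))
      - coLap D Γ g K * b j + D j (coLap D Γ g K) = 0 := by
  have e := congrArg (D j) (hb.constraint h)
  have c := hb.constraint h
  have three : (3 : A) = algebraMap ℝ A 3 := (map_ofNat _ 3).symm
  have six : (6 : A) = algebraMap ℝ A 6 := (map_ofNat _ 6).symm
  simp only [map_add, map_sub, Derivation.leibniz, Derivation.leibniz_pow, smul_eq_mul,
    hb.deriv_w h, three, six, Derivation.map_algebraMap, map_zero] at e
  rw [← three, ← six] at e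
  fin_cases j <;> simp [hb.d00, hb.d01, hb.d10, hb.d11, h.symmΓ, h.symmg] at e ⊢
  · linear_combination e - b 0 * c
  · linear_combination e - b 1 * c

end DifferentialAlgebra

/-! ### Partial derivatives and the ring of smooth functions -/

section PartialDerivatives

variable {f h : (Fin 2 → ℝ) → ℝ} {s : Fin 2 → ℝ} {V : Set (Fin 2 → ℝ)}

theorem ContDiffOn.pderiv (hf : ContDiffOn ℝ ∞ f V) (hV : IsOpen V) (i : Fin 2) :
    ContDiffOn ℝ ∞ (pderiv i f) V :=
  (hf.fderiv_of_isOpen hV (m := ∞) (by simp)).clm_apply contDiffOn_const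

theorem ContDiffOn.differentiableAt_of_isOpen (hf : ContDiffOn ℝ ∞ f V) (hV : IsOpen V)
    (hs : s ∈ V) : DifferentiableAt ℝ f s :=
  (hf.contDiffAt (hV.mem_nhds hs)).differentiableAt (by simp)

theorem pderiv_congr (h1 : f =ᶠ[𝓝 s] h) (i : Fin 2) : pderiv i f s = pderiv i h s := by
  rw [pderiv, pderiv, h1.fderiv_eq]

theorem pderiv_congr_on (hV : IsOpen V) (hs : s ∈ V) (h1 : ∀ t ∈ V, f t = h t) (i : Fin 2) :
    pderiv i f s = pderiv i h s :=
  pderiv_congr (Filter.eventuallyEq_of_mem (hV.mem_nhds hs) h1) i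

theorem pderiv_pderiv (hf : ContDiffAt ℝ 2 f s) (i j : Fin 2) :
    pderiv i (pderiv j f) s = fderiv ℝ (fderiv ℝ f) s (Pi.single i 1) (Pi.single j 1) := by
  have hd : DifferentiableAt ℝ (fderiv ℝ f) s :=
    (hf.fderiv_right (m := 1) (by norm_num)).differentiableAt (by norm_num)
  have : fderiv ℝ (fun t => fderiv ℝ f t (Pi.single j 1)) s (Pi.single i 1) =
      fderiv ℝ (fderiv ℝ f) s (Pi.single i 1) (Pi.single j 1) := by
    rw [fderiv_clm_apply hd (differentiableAt_const _)]
    simp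
  exact this

theorem pderiv_comm (hf : ContDiffAt ℝ 2 f s) (i j : Fin 2) :
    pderiv i (pderiv j f) s = pderiv j (pderiv i f) s := by
  rw [pderiv_pderiv hf, pderiv_pderiv hf]
  exact hf.isSymmSndFDerivAt (by simp) _ _

theorem fderiv_eq_sum_pderiv (f : (Fin 2 → ℝ) → ℝ) (s v : Fin 2 → ℝ) :
    fderiv ℝ f s v = v 0 * pderiv 0 f s + v 1 * pderiv 1 f s := by
  have hv : v = v 0 • Pi.single 0 1 + v 1 • Pi.single 1 1 := by
    ext i; fin_cases i <;> simp
  conv_lhs => rw [hv]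
  simp [pderiv]

end PartialDerivatives

section SmoothFunctions

open TopologicalSpace

variable (V : Opens (Fin 2 → ℝ))

/-- The algebra of smooth real functions on the open set `V`. They are functions on the subtype;
smoothness is that of the extension by zero, tested on `V` only. -/
def smoothFunctions : Subalgebra ℝ (V → ℝ) where
  carrier := {f | ContDiffOn ℝ ∞ (Function.extend Subtype.val f 0) V}
  mul_mem' {a b} ha hb := (ContDiffOn.mul ha hb).congr fun s hs => by
    lift s to V using hs
    simp
  add_mem' {a b} ha hb := (ContDiffOn.add ha hb).congr fun s hs => by
    lift s to V using hs
    simp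
  algebraMap_mem' r := (contDiffOn_const (c := r)).congr fun s hs => by
    lift s to V using hs
    simp

/-- The ring of smooth real functions on the open set `V`, as a type with its own coercion to
functions. -/
def SmoothFun : Type := smoothFunctions V

variable {V}

noncomputable instance : CommRing (SmoothFun V) := inferInstanceAs (CommRing (smoothFunctions V))

noncomputable instance : Algebra ℝ (SmoothFun V) :=
  inferInstanceAs (Algebra ℝ (smoothFunctions V))

instance : FunLike (SmoothFun V) V ℝ where
  coe f := Subtype.val (p := (· ∈ smoothFunctions V)) f
  coe_injective := Subtype.val_injective

@[simp] theorem SmoothFun.add_apply (f h : SmoothFun V) (s : V) : (f + h) s = f s + h s := rfl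

@[simp] theorem SmoothFun.sub_apply (f h : SmoothFun V) (s : V) : (f - h) s = f s - h s := rfl

@[simp] theorem SmoothFun.neg_apply (f : SmoothFun V) (s : V) : (-f) s = -f s := rfl

@[simp] theorem SmoothFun.mul_apply (f h : SmoothFun V) (s : V) : (f * h) s = f s * h s := rfl

@[simp] theorem SmoothFun.pow_apply (f : SmoothFun V) (n : ℕ) (s : V) : (f ^ n) s = f s ^ n := rfl

@[simp] theorem SmoothFun.smul_apply (c : ℝ) (f : SmoothFun V) (s : V) : (c • f) s = c * f s := rfl

@[simp] theorem SmoothFun.zero_apply (s : V) : (0 : SmoothFun V) s = 0 := rfl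

@[simp] theorem SmoothFun.one_apply (s : V) : (1 : SmoothFun V) s = 1 := rfl

@[simp] theorem SmoothFun.ofNat_apply (n : ℕ) [n.AtLeastTwo] (s : V) :
    (ofNat(n) : SmoothFun V) s = ofNat(n) := rfl

/-- The smooth function on `V`, extended by zero to the plane. -/
noncomputable def zeroExt (f : SmoothFun V) : (Fin 2 → ℝ) → ℝ :=
  Function.extend Subtype.val f 0

theorem zeroExt_apply (f : SmoothFun V) (s : V) : zeroExt f s = f s :=
  Subtype.val_injective.extend_apply _ _ _

theorem contDiffOn_zeroExt (f : SmoothFun V) : ContDiffOn ℝ ∞ (zeroExt f) V :=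
  Subtype.property (p := (· ∈ smoothFunctions V)) f

/-- The restriction to `V` of a function that is smooth there. -/
def smoothRestrict (F : (Fin 2 → ℝ) → ℝ) (hF : ContDiffOn ℝ ∞ F V) : SmoothFun V :=
  ⟨fun s => F s, hF.congr fun s hs => by
    lift s to V using hs
    simp⟩

@[simp] theorem smoothRestrict_apply (F : (Fin 2 → ℝ) → ℝ) (hF : ContDiffOn ℝ ∞ F V) (s : V) :
    smoothRestrict F hF s = F s := rfl

theorem smoothRestrict_ext (f : SmoothFun V) :
    smoothRestrict (zeroExt f) (contDiffOn_zeroExt f) = f :=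
  DFunLike.ext _ _ fun s => zeroExt_apply f s

variable (V) in
/-- The partial derivative in direction `i`, as a derivation of the algebra of smooth functions. -/
noncomputable def smoothPartial (i : Fin 2) :
    Derivation ℝ (SmoothFun V) (SmoothFun V) where
  toFun f := smoothRestrict (pderiv i (zeroExt f)) ((contDiffOn_zeroExt f).pderiv V.isOpen i)
  map_add' a b := by
    refine DFunLike.ext _ _ fun s => ?_
    have ha := (contDiffOn_zeroExt a).differentiableAt_of_isOpen V.isOpen s.2
    have hb := (contDiffOn_zeroExt b).differentiableAt_of_isOpen V.isOpen s.2
    have : pderiv i (zeroExt (a + b)) s = pderiv i (fun t => zeroExt a t + zeroExt b t) s :=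
      pderiv_congr_on V.isOpen s.2 (fun t ht => by
        lift t to V using ht
        simp [zeroExt_apply]) i
    change pderiv i (zeroExt (a + b)) s = pderiv i (zeroExt a) s + pderiv i (zeroExt b) s
    rw [this, pderiv, fderiv_fun_add ha hb]; rfl
  map_smul' c a := by
    refine DFunLike.ext _ _ fun s => ?_
    have ha := (contDiffOn_zeroExt a).differentiableAt_of_isOpen V.isOpen s.2
    have : pderiv i (zeroExt (c • a)) s = pderiv i (fun t => c • zeroExt a t) s :=
      pderiv_congr_on V.isOpen s.2 (fun t ht => by
        lift t to V using ht
        simp [zeroExt_apply]) i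
    change pderiv i (zeroExt (c • a)) s = c • pderiv i (zeroExt a) s
    rw [this, pderiv, fderiv_fun_const_smul ha]; rfl
  map_one_eq_zero' := by
    refine DFunLike.ext _ _ fun s => ?_
    change pderiv i (zeroExt (1 : SmoothFun V)) s = 0
    have : pderiv i (zeroExt (1 : SmoothFun V)) s = pderiv i (fun _ => 1) s :=
      pderiv_congr_on V.isOpen s.2 (fun t ht => by
        lift t to V using ht
        simp [zeroExt_apply]) i
    rw [this, pderiv]; simp
  leibniz' a b := by
    refine DFunLike.ext _ _ fun s => ?_
    have ha := (contDiffOn_zeroExt a).differentiableAt_of_isOpen V.isOpen s.2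
    have hb := (contDiffOn_zeroExt b).differentiableAt_of_isOpen V.isOpen s.2
    have : pderiv i (zeroExt (a * b)) s = pderiv i (fun t => zeroExt a t * zeroExt b t) s :=
      pderiv_congr_on V.isOpen s.2 (fun t ht => by
        lift t to V using ht
        simp [zeroExt_apply]) i
    change pderiv i (zeroExt (a * b)) s = a s * pderiv i (zeroExt b) s + b s * pderiv i (zeroExt a) s
    rw [this, pderiv, fderiv_fun_mul ha hb]
    simp [zeroExt_apply, pderiv]

theorem smoothPartial_restrict (F : (Fin 2 → ℝ) → ℝ) (hF : ContDiffOn ℝ ∞ F V) (i : Fin 2) :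
    smoothPartial V i (smoothRestrict F hF) =
      smoothRestrict (pderiv i F) (hF.pderiv V.isOpen i) := by
  refine DFunLike.ext _ _ fun s => ?_
  exact pderiv_congr_on V.isOpen s.2 (fun t ht => by
    lift t to V using ht
    simp [zeroExt_apply]) i

theorem smoothPartial_comm (f : SmoothFun V) :
    smoothPartial V 0 (smoothPartial V 1 f) = smoothPartial V 1 (smoothPartial V 0 f) := by
  rw [← smoothRestrict_ext f]
  simp only [smoothPartial_restrict]
  refine DFunLike.ext _ _ fun s => ?_
  exact pderiv_comm (((contDiffOn_zeroExt f).contDiffAt (V.isOpen.mem_nhds s.2)).of_le (by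
    exact WithTop.coe_le_coe.2 le_top)) 0 1

end SmoothFunctions

/-! ### The Levi-Civita connection of a metric on a plane domain -/

section LeviCivita

open TopologicalSpace

variable {g : (Fin 2 → ℝ) → Matrix (Fin 2) (Fin 2) ℝ} {s : Fin 2 → ℝ}

theorem IsRiemannianMetricOn.mono {U V : Set (Fin 2 → ℝ)} (hg : IsRiemannianMetricOn g U)
    (h : V ⊆ U) : IsRiemannianMetricOn g V :=
  ⟨fun i j => (hg.1 i j).mono h, fun s hs => hg.2 s (h hs)⟩

variable {V : Set (Fin 2 → ℝ)}

theorem IsRiemannianMetricOn.symm (hg : IsRiemannianMetricOn g V) (hs : s ∈ V) (i j : Fin 2) :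
    g s i j = g s j i := by
  simpa using (hg.2 s hs).isHermitian.apply j i

theorem IsRiemannianMetricOn.det_pos (hg : IsRiemannianMetricOn g V) (hs : s ∈ V) :
    0 < (g s).det := (hg.2 s hs).det_pos

theorem IsRiemannianMetricOn.contDiffOn_det (hg : IsRiemannianMetricOn g V) :
    ContDiffOn ℝ ∞ (fun s => (g s).det) V := by
  simp only [Matrix.det_fin_two]
  exact ((hg.1 0 0).mul (hg.1 1 1)).sub ((hg.1 0 1).mul (hg.1 1 0))

theorem IsRiemannianMetricOn.contDiffOn_inv (hg : IsRiemannianMetricOn g V) (i j : Fin 2) :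
    ContDiffOn ℝ ∞ (fun s => (g s)⁻¹ i j) V := by
  have h : ∀ s, (g s)⁻¹ i j = ((g s).det)⁻¹ * (g s).adjugate i j := fun s => by
    simp [Matrix.inv_def]
  simp only [h]
  refine (hg.contDiffOn_det.inv fun s hs => (hg.det_pos hs).ne').mul ?_
  simp only [Matrix.adjugate_fin_two]
  fin_cases i <;> fin_cases j <;> simp
  exacts [hg.1 1 1, (hg.1 0 1).neg, (hg.1 1 0).neg, hg.1 0 0]

theorem IsRiemannianMetricOn.pderiv_symm (hg : IsRiemannianMetricOn g V) (hV : IsOpen V)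
    (hs : s ∈ V) (k i j : Fin 2) :
    pderiv k (fun t => g t i j) s = pderiv k (fun t => g t j i) s :=
  pderiv_congr_on hV hs (fun _ ht => hg.symm ht i j) k

theorem IsRiemannianMetricOn.contDiffOn_christoffel (hg : IsRiemannianMetricOn g V)
    (hV : IsOpen V) (k i j : Fin 2) : ContDiffOn ℝ ∞ (christoffel g k i j) V := by
  refine contDiffOn_const.mul (ContDiffOn.sum fun l _ => (hg.contDiffOn_inv k l).mul ?_)
  exact (((hg.1 j l).pderiv hV i).add ((hg.1 i l).pderiv hV j)).sub ((hg.1 i j).pderiv hV l)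

theorem IsRiemannianMetricOn.contDiffOn_gaussianCurvature (hg : IsRiemannianMetricOn g V)
    (hV : IsOpen V) : ContDiffOn ℝ ∞ (gaussianCurvature g) V := by
  refine ContDiffOn.div (ContDiffOn.sum fun l _ => (hg.1 0 l).mul ?_) hg.contDiffOn_det
    fun s hs => (hg.det_pos hs).ne'
  have h := hg.contDiffOn_christoffel hV
  exact (((h _ _ _).pderiv hV _).sub ((h _ _ _).pderiv hV _)).add
    (ContDiffOn.sum fun r _ => ((h _ _ _).mul (h _ _ _)).sub ((h _ _ _).mul (h _ _ _)))

/-- The Christoffel symbols with the upper index lowered. -/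
theorem IsRiemannianMetricOn.lower_christoffel (hg : IsRiemannianMetricOn g V) (hs : s ∈ V)
    (m i j : Fin 2) :
    g s m 0 * christoffel g 0 i j s + g s m 1 * christoffel g 1 i j s =
      (1 / 2) * (pderiv i (fun t => g t j m) s + pderiv j (fun t => g t i m) s
        - pderiv m (fun t => g t i j) s) := by
  have e : ∀ c : Fin 2 → ℝ, (1 : Matrix (Fin 2) (Fin 2) ℝ) m 0 * c 0 +
      (1 : Matrix (Fin 2) (Fin 2) ℝ) m 1 * c 1 = c m := by
    intro c; fin_cases m <;> simp [Matrix.one_apply]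
  have h := Matrix.mul_nonsing_inv (g s) (hg.det_pos hs).ne'.isUnit
  have h0 := congrFun (congrFun h m) 0
  have h1 := congrFun (congrFun h m) 1
  simp only [Matrix.mul_apply, Fin.sum_univ_two] at h0 h1
  simp only [christoffel, Fin.sum_univ_two]
  rw [← e fun m => (1 / 2) * (pderiv i (fun t => g t j m) s + pderiv j (fun t => g t i m) s
        - pderiv m (fun t => g t i j) s), ← h0, ← h1]
  ring

theorem IsRiemannianMetricOn.christoffel_symm (hg : IsRiemannianMetricOn g V) (hV : IsOpen V)
    (hs : s ∈ V) (k i j : Fin 2) : christoffel g k i j s = christoffel g k j i s := by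
  simp only [christoffel, Fin.sum_univ_two]
  rw [hg.pderiv_symm hV hs 0 i j, hg.pderiv_symm hV hs 1 i j]
  ring

theorem IsRiemannianMetricOn.compat (hg : IsRiemannianMetricOn g V) (hV : IsOpen V)
    (hs : s ∈ V) (k i j : Fin 2) : pderiv k (fun t => g t i j) s =
      christoffel g 0 k i s * g s 0 j + christoffel g 1 k i s * g s 1 j +
      (christoffel g 0 k j s * g s i 0 + christoffel g 1 k j s * g s i 1) := by
  have h1 := hg.lower_christoffel hs j k i
  have h2 := hg.lower_christoffel hs i k j
  rw [hg.pderiv_symm hV hs i k j, hg.pderiv_symm hV hs j k i] at *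
  rw [hg.symm hs j 0, hg.symm hs j 1] at h1
  rw [hg.pderiv_symm hV hs k j i, hg.pderiv_symm hV hs i j k] at h2
  rw [hg.pderiv_symm hV hs i j k] at h1
  linear_combination -h1 - h2

variable {W : Opens (Fin 2 → ℝ)}

/-- The Christoffel symbols of `g` as elements of the algebra of smooth functions. -/
noncomputable def smoothChristoffel (hg : IsRiemannianMetricOn g W) (k i j : Fin 2) : SmoothFun W :=
  smoothRestrict (christoffel g k i j) (hg.contDiffOn_christoffel W.isOpen k i j)

/-- The coefficients of `g` as elements of the algebra of smooth functions. -/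
noncomputable def smoothMetric (hg : IsRiemannianMetricOn g W) (i j : Fin 2) : SmoothFun W :=
  smoothRestrict (fun s => g s i j) (hg.1 i j)

/-- The Gaussian curvature of `g` as an element of the algebra of smooth functions. -/
noncomputable def smoothCurvature (hg : IsRiemannianMetricOn g W) : SmoothFun W :=
  smoothRestrict (gaussianCurvature g) (hg.contDiffOn_gaussianCurvature W.isOpen)

theorem isLeviCivita_smooth (hg : IsRiemannianMetricOn g W) :
    IsLeviCivita (smoothPartial W) (smoothChristoffel hg) (smoothMetric hg)
      (smoothCurvature hg) := by
  have compat : ∀ k i j, smoothPartial W k (smoothMetric hg i j) =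
      smoothChristoffel hg 0 k i * smoothMetric hg 0 j +
      smoothChristoffel hg 1 k i * smoothMetric hg 1 j +
      (smoothChristoffel hg 0 k j * smoothMetric hg i 0 +
      smoothChristoffel hg 1 k j * smoothMetric hg i 1) := fun k i j => by
    refine DFunLike.ext _ _ fun s => ?_
    rw [smoothMetric, smoothPartial_restrict]
    exact hg.compat W.isOpen s.2 k i j
  -- the antisymmetry of the Riemann tensor leaves one component, the Gaussian curvature
  have hK : ∀ s : W, gaussianCurvature g s * (g s).det = g s 0 0 * curvatureTensor g 0 1 0 1 s
      + g s 0 1 * curvatureTensor g 1 1 0 1 s := fun s => by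
    rw [gaussianCurvature, div_mul_cancel₀ _ (hg.det_pos s.2).ne', Fin.sum_univ_two]
  have hr : ∀ l k (s : W), (riemann (smoothPartial W) (smoothChristoffel hg) l k) s =
      curvatureTensor g l k 0 1 s := fun l k s => by
    simp only [riemann, smoothChristoffel, smoothPartial_restrict, SmoothFun.add_apply,
      SmoothFun.sub_apply, SmoothFun.mul_apply, smoothRestrict_apply, curvatureTensor,
      Fin.sum_univ_two]
    ring
  have riem' : ∀ i j (s : W), curvatureTensor g 0 i 0 1 s * g s 0 j +
      curvatureTensor g 1 i 0 1 s * g s 1 j + (curvatureTensor g 0 j 0 1 s * g s i 0 +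
      curvatureTensor g 1 j 0 1 s * g s i 1) = 0 := fun i j s => by
    have := DFunLike.congr_fun (riemann_antisymm smoothPartial_comm compat i j) s
    simpa only [SmoothFun.add_apply, SmoothFun.mul_apply,
      SmoothFun.zero_apply, hr, smoothMetric, smoothRestrict_apply] using this
  refine ⟨smoothPartial_comm, fun k => ?_, ?_, compat, fun k => ?_, fun k => ?_⟩
  · exact DFunLike.ext _ _ fun s => hg.christoffel_symm W.isOpen s.2 k 1 0
  · exact DFunLike.ext _ _ fun s => hg.symm s.2 1 0
  · refine DFunLike.ext _ _ fun s => ?_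
    rw [hr]
    change curvatureTensor g 0 k 0 1 s = gaussianCurvature g s * g s 1 k
    have hd := (hg.det_pos s.2).ne'
    have r00 := riem' 0 0 s
    have r01 := riem' 0 1 s
    have r11 := riem' 1 1 s
    have hKs := hK s
    have sy := hg.symm s.2 1 0
    apply mul_right_cancel₀ hd
    rw [Matrix.det_fin_two] at hKs ⊢
    simp only [sy] at r00 r01 r11 hKs ⊢
    fin_cases k <;> simp only [Fin.zero_eta, Fin.mk_one, sy]
    · linear_combination g s 1 1 * r00 / 2 - g s 0 1 * r01 - g s 0 1 * hKs
    · linear_combination -g s 1 1 * hKs - g s 0 1 * r11 / 2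
  · refine DFunLike.ext _ _ fun s => ?_
    rw [hr]
    change curvatureTensor g 1 k 0 1 s = -(gaussianCurvature g s * g s 0 k)
    have hd := (hg.det_pos s.2).ne'
    have r00 := riem' 0 0 s
    have r01 := riem' 0 1 s
    have r11 := riem' 1 1 s
    have hKs := hK s
    have sy := hg.symm s.2 1 0
    apply mul_right_cancel₀ hd
    rw [Matrix.det_fin_two] at hKs ⊢
    simp only [sy] at r00 r01 r11 hKs ⊢
    fin_cases k <;> simp only [Fin.zero_eta, Fin.mk_one]
    · linear_combination g s 0 0 * r01 - g s 0 1 * r00 / 2 + g s 0 0 * hKs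
    · linear_combination g s 0 0 * r11 / 2 + g s 0 1 * hKs

end LeviCivita

/-! ### Poisson brackets of fractional-linear functions -/

section PoissonBracket

variable {f h : (Fin 2 → ℝ) → ℝ} {s : Fin 2 → ℝ} {V : Set (Fin 2 → ℝ)}

theorem pderiv_add (hf : DifferentiableAt ℝ f s) (hh : DifferentiableAt ℝ h s) (i : Fin 2) :
    pderiv i (fun t => f t + h t) s = pderiv i f s + pderiv i h s := by
  rw [pderiv, fderiv_fun_add hf hh]; rfl

theorem pderiv_mul (hf : DifferentiableAt ℝ f s) (hh : DifferentiableAt ℝ h s) (i : Fin 2) :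
    pderiv i (fun t => f t * h t) s = f s * pderiv i h s + h s * pderiv i f s := by
  rw [pderiv, fderiv_fun_mul hf hh]; rfl

theorem pderiv_mul_const (hf : DifferentiableAt ℝ f s) (c : ℝ) (i : Fin 2) :
    pderiv i (fun t => f t * c) s = pderiv i f s * c := by
  rw [pderiv, fderiv_mul_const hf]; simp [pderiv, mul_comm]

theorem pderiv_const_mul (hf : DifferentiableAt ℝ f s) (c : ℝ) (i : Fin 2) :
    pderiv i (fun t => c * f t) s = c * pderiv i f s := by
  rw [pderiv, fderiv_const_mul hf]; simp [pderiv]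

theorem pderiv_const (c : ℝ) (i : Fin 2) : pderiv i (fun _ => c) s = 0 := by
  simp [pderiv]

theorem pderiv_coord (i j : Fin 2) :
    pderiv i (fun t => t j) s = (Pi.single i 1 : Fin 2 → ℝ) j := by
  have : (fun t : Fin 2 → ℝ => t j) = ContinuousLinearMap.proj (R := ℝ) (φ := fun _ => ℝ) j := rfl
  rw [pderiv, this, ContinuousLinearMap.fderiv]; rfl

theorem pderiv_div (hf : DifferentiableAt ℝ f s) (hh : DifferentiableAt ℝ h s) (h0 : h s ≠ 0)
    (i : Fin 2) :
    pderiv i (fun t => f t / h t) s = (h s * pderiv i f s - f s * pderiv i h s) / h s ^ 2 := by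
  have hi : HasFDerivAt (fun t => (h t)⁻¹) (-(h s ^ 2)⁻¹ • fderiv ℝ h s) s :=
    (hasDerivAt_inv h0).comp_hasFDerivAt s hh.hasFDerivAt
  have hm := (hf.hasFDerivAt.fun_mul hi).fderiv
  simp only [div_eq_mul_inv]
  rw [pderiv, hm]
  simp only [add_apply, smul_apply, smul_eq_mul, pderiv]
  field_simp
  ring

theorem pderiv_quadraticForm {a : Fin 2 → Fin 2 → (Fin 2 → ℝ) → ℝ}
    (ha : ∀ j k, DifferentiableAt ℝ (a j k) s) (p : Fin 2 → ℝ) (i : Fin 2) :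
    pderiv i (fun t => (1 / 2) * (p 0 * (a 0 0 t * p 0 + a 0 1 t * p 1)
      + p 1 * (a 1 0 t * p 0 + a 1 1 t * p 1))) s =
    (1 / 2) * (p 0 * (pderiv i (a 0 0) s * p 0 + pderiv i (a 0 1) s * p 1)
      + p 1 * (pderiv i (a 1 0) s * p 0 + pderiv i (a 1 1) s * p 1)) := by
  rw [pderiv_const_mul (by fun_prop), pderiv_add (by fun_prop) (by fun_prop),
    pderiv_const_mul (by fun_prop), pderiv_const_mul (by fun_prop),
    pderiv_add (by fun_prop) (by fun_prop), pderiv_add (by fun_prop) (by fun_prop),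
    pderiv_mul_const (ha _ _), pderiv_mul_const (ha _ _), pderiv_mul_const (ha _ _),
    pderiv_mul_const (ha _ _)]

/-- The coframe of `1`-forms obtained by lowering the index of the rows of `m`. -/
def coframe (g m : (Fin 2 → ℝ) → Matrix (Fin 2) (Fin 2) ℝ) (c j : Fin 2) (s : Fin 2 → ℝ) : ℝ :=
  m s c 0 * g s 0 j + m s c 1 * g s 1 j

variable {g m : (Fin 2 → ℝ) → Matrix (Fin 2) (Fin 2) ℝ}

theorem contDiffOn_coframe (hg : IsRiemannianMetricOn g V)
    (hm : ∀ i j, ContDiffOn ℝ ∞ (fun s => m s i j) V) (c j : Fin 2) :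
    ContDiffOn ℝ ∞ (coframe g m c j) V :=
  ((hm c 0).mul (hg.1 0 j)).add ((hm c 1).mul (hg.1 1 j))

/-- The covariant derivative `∇ᵢξⱼ` of a member of the coframe. -/
noncomputable def covCoframe (g m : (Fin 2 → ℝ) → Matrix (Fin 2) (Fin 2) ℝ) (c i j : Fin 2)
    (s : Fin 2 → ℝ) : ℝ :=
  pderiv i (coframe g m c j) s
    - (christoffel g 0 i j s * coframe g m c 0 s + christoffel g 1 i j s * coframe g m c 1 s)

theorem pderiv_coframe (hg : IsRiemannianMetricOn g V) (hV : IsOpen V)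
    (hm : ∀ i j, ContDiffOn ℝ ∞ (fun s => m s i j) V) (hs : s ∈ V) (c i j : Fin 2) :
    pderiv i (coframe g m c j) s =
      m s c 0 * pderiv i (fun t => g t 0 j) s + g s 0 j * pderiv i (fun t => m t c 0) s
      + (m s c 1 * pderiv i (fun t => g t 1 j) s + g s 1 j * pderiv i (fun t => m t c 1) s) := by
  have dg := fun i j => (hg.1 i j).differentiableAt_of_isOpen hV hs
  have dm := fun i j => (hm i j).differentiableAt_of_isOpen hV hs
  unfold coframe
  rw [pderiv_add ((dm _ _).fun_mul (dg _ _)) ((dm _ _).fun_mul (dg _ _)), pderiv_mul (dm _ _) (dg _ _),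
    pderiv_mul (dm _ _) (dg _ _)]

theorem pderiv_geodesicHamiltonian_momentum (hg : IsRiemannianMetricOn g V) (hs : s ∈ V)
    (p : Fin 2 → ℝ) (i : Fin 2) :
    pderiv i (fun r => geodesicHamiltonian g s r) p = ((g s)⁻¹ *ᵥ p) i := by
  have sy : (g s)⁻¹ 1 0 = (g s)⁻¹ 0 1 := by
    simpa using (hg.2 s hs).isHermitian.inv.apply 0 1
  have d : ∀ j, DifferentiableAt ℝ (fun r : Fin 2 → ℝ => r j) p := fun j => by fun_prop
  simp only [geodesicHamiltonian, Matrix.mulVec, dotProduct, Fin.sum_univ_two]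
  rw [pderiv_const_mul (by fun_prop), pderiv_add (by fun_prop) (by fun_prop),
    pderiv_mul (by fun_prop) (by fun_prop), pderiv_mul (by fun_prop) (by fun_prop),
    pderiv_add (by fun_prop) (by fun_prop), pderiv_add (by fun_prop) (by fun_prop),
    pderiv_const_mul (d _), pderiv_const_mul (d _), pderiv_const_mul (d _), pderiv_const_mul (d _),
    pderiv_coord, pderiv_coord]
  fin_cases i <;> simp [sy] <;> ring

/-- The derivative of the Hamiltonian in the position, at the momentum of the velocity `v`; it
involves only derivatives of `g`, not of its inverse. -/
theorem pderiv_geodesicHamiltonian_position (hg : IsRiemannianMetricOn g V) (hV : IsOpen V)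
    (hs : s ∈ V) (v : Fin 2 → ℝ) (i : Fin 2) :
    pderiv i (fun t => geodesicHamiltonian g t (g s *ᵥ v)) s =
      -(1 / 2) * (v 0 * (pderiv i (fun t => g t 0 0) s * v 0 + pderiv i (fun t => g t 0 1) s * v 1)
        + v 1 * (pderiv i (fun t => g t 1 0) s * v 0 + pderiv i (fun t => g t 1 1) s * v 1)) := by
  have dg := fun i j => (hg.1 i j).differentiableAt_of_isOpen hV hs
  have dG := fun i j => (hg.contDiffOn_inv i j).differentiableAt_of_isOpen hV hs
  have sy := hg.symm hs 1 0
  have hi := Matrix.nonsing_inv_mul (g s) (hg.det_pos hs).ne'.isUnit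
  -- differentiate `g⁻¹ g = 1`
  have key : ∀ j k, (g s)⁻¹ j 0 * pderiv i (fun t => g t 0 k) s
      + g s 0 k * pderiv i (fun t => (g t)⁻¹ j 0) s
      + ((g s)⁻¹ j 1 * pderiv i (fun t => g t 1 k) s
      + g s 1 k * pderiv i (fun t => (g t)⁻¹ j 1) s) = 0 := fun j k => by
    rw [← pderiv_mul (dG _ _) (dg _ _), ← pderiv_mul (dG _ _) (dg _ _),
      ← pderiv_add ((dG _ _).fun_mul (dg _ _)) ((dG _ _).fun_mul (dg _ _)),
      ← pderiv_const (s := s) ((1 : Matrix (Fin 2) (Fin 2) ℝ) j k) i]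
    refine pderiv_congr_on hV hs (fun t ht => ?_) i
    have := congrFun (congrFun (Matrix.nonsing_inv_mul (g t) (hg.det_pos ht).ne'.isUnit) j) k
    simpa only [Matrix.mul_apply, Fin.sum_univ_two] using this
  have inv : ∀ k, g s k 0 * (g s)⁻¹ 0 0 + g s k 1 * (g s)⁻¹ 1 0 = (1 : Matrix (Fin 2) (Fin 2) ℝ) k 0 ∧
      g s k 0 * (g s)⁻¹ 0 1 + g s k 1 * (g s)⁻¹ 1 1 = (1 : Matrix (Fin 2) (Fin 2) ℝ) k 1 := fun k => by
    have := Matrix.mul_nonsing_inv (g s) (hg.det_pos hs).ne'.isUnit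
    have h0 := congrFun (congrFun this k) 0
    have h1 := congrFun (congrFun this k) 1
    simp only [Matrix.mul_apply, Fin.sum_univ_two] at h0 h1
    exact ⟨h0, h1⟩
  obtain ⟨i00, i01⟩ := inv 0
  obtain ⟨i10, i11⟩ := inv 1
  simp only [Matrix.one_apply, Fin.isValue, if_true, zero_ne_one, one_ne_zero, if_false]
    at i00 i01 i10 i11
  have p0 : (g s *ᵥ v) 0 = g s 0 0 * v 0 + g s 0 1 * v 1 := by simp
  have p1 : (g s *ᵥ v) 1 = g s 1 0 * v 0 + g s 1 1 * v 1 := by simp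
  have e0 : (g s *ᵥ v) 0 * (g s)⁻¹ 0 0 + (g s *ᵥ v) 1 * (g s)⁻¹ 1 0 = v 0 := by
    rw [p0, p1]; linear_combination v 0 * i00 + v 1 * i10 + (v 0 * (g s)⁻¹ 1 0 - v 1 * (g s)⁻¹ 0 0) * sy
  have e1 : (g s *ᵥ v) 0 * (g s)⁻¹ 0 1 + (g s *ᵥ v) 1 * (g s)⁻¹ 1 1 = v 1 := by
    rw [p0, p1]; linear_combination v 0 * i01 + v 1 * i11 + (v 0 * (g s)⁻¹ 1 1 - v 1 * (g s)⁻¹ 0 1) * sy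
  generalize g s *ᵥ v = p at *
  simp only [geodesicHamiltonian, Matrix.mulVec, dotProduct, Fin.sum_univ_two]
  rw [pderiv_quadraticForm (a := fun j k t => (g t)⁻¹ j k) dG]
  have k00 := key 0 0
  have k01 := key 0 1
  have k10 := key 1 0
  have k11 := key 1 1
  linear_combination (1 / 2) * (p 0 * v 0 * k00 + p 0 * v 1 * k01 + p 1 * v 0 * k10
    + p 1 * v 1 * k11) - (1 / 2) * (e0 * (pderiv i (fun t => g t 0 0) s * v 0
    + pderiv i (fun t => g t 0 1) s * v 1) + e1 * (pderiv i (fun t => g t 1 0) s * v 0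
    + pderiv i (fun t => g t 1 1) s * v 1))
    + (1 / 2) * (p 0 * pderiv i (fun t => (g t)⁻¹ 0 0) s + p 1 * pderiv i (fun t => (g t)⁻¹ 1 0) s) * p0
    + (1 / 2) * (p 0 * pderiv i (fun t => (g t)⁻¹ 0 1) s + p 1 * pderiv i (fun t => (g t)⁻¹ 1 1) s) * p1

/-- At the momentum of the velocity `v`, the Poisson bracket with the Hamiltonian is a cubic form in
`v` over the square of the denominator. The cubic form is `ξ₁(v) ∇ξ₀(v, v) - ξ₀(v) ∇ξ₁(v, v)`. -/
theorem poissonBracket_fractionalLinear (hg : IsRiemannianMetricOn g V) (hV : IsOpen V)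
    (hm : ∀ i j, ContDiffOn ℝ ∞ (fun s => m s i j) V) (hs : s ∈ V) (v : Fin 2 → ℝ)
    (hD : (m s *ᵥ (g s *ᵥ v)) 1 ≠ 0) :
    poissonBracket (fractionalLinear m) (geodesicHamiltonian g) s (g s *ᵥ v) *
        (coframe g m 1 0 s * v 0 + coframe g m 1 1 s * v 1) ^ 2 =
      (coframe g m 1 0 s * v 0 + coframe g m 1 1 s * v 1) *
        (covCoframe g m 0 0 0 s * v 0 ^ 2 + (covCoframe g m 0 0 1 s + covCoframe g m 0 1 0 s)
          * (v 0 * v 1) + covCoframe g m 0 1 1 s * v 1 ^ 2)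
      - (coframe g m 0 0 s * v 0 + coframe g m 0 1 s * v 1) *
        (covCoframe g m 1 0 0 s * v 0 ^ 2 + (covCoframe g m 1 0 1 s + covCoframe g m 1 1 0 s)
          * (v 0 * v 1) + covCoframe g m 1 1 1 s * v 1 ^ 2) := by
  have dm := fun i j => (hm i j).differentiableAt_of_isOpen hV hs
  have hp : (g s)⁻¹ *ᵥ (g s *ᵥ v) = v := by
    rw [Matrix.mulVec_mulVec, Matrix.nonsing_inv_mul _ (hg.det_pos hs).ne'.isUnit,
      Matrix.one_mulVec]
  set p := g s *ᵥ v with hpdef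
  have hp0 : p 0 = g s 0 0 * v 0 + g s 0 1 * v 1 := by
    simp [hpdef]
  have hp1 : p 1 = g s 1 0 * v 0 + g s 1 1 * v 1 := by
    simp [hpdef]
  have hc : ∀ c, coframe g m c 0 s * v 0 + coframe g m c 1 s * v 1
      = m s c 0 * p 0 + m s c 1 * p 1 := fun c => by
    rw [hp0, hp1, coframe, coframe]; ring
  have hD' : m s 1 0 * p 0 + m s 1 1 * p 1 ≠ 0 := by
    simpa [Matrix.mulVec, dotProduct, Fin.sum_univ_two] using hD
  -- the covariant derivative in terms of the derivatives of `g`, without its inverse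
  have hlow : ∀ c i j, covCoframe g m c i j s = pderiv i (coframe g m c j) s
      - (m s c 0 * ((1 / 2) * (pderiv i (fun t => g t j 0) s + pderiv j (fun t => g t i 0) s
        - pderiv 0 (fun t => g t i j) s))
       + m s c 1 * ((1 / 2) * (pderiv i (fun t => g t j 1) s + pderiv j (fun t => g t i 1) s
        - pderiv 1 (fun t => g t i j) s))) := fun c i j => by
    rw [← hg.lower_christoffel hs, ← hg.lower_christoffel hs, covCoframe, coframe, coframe]; ring
  have dI : ∀ i, pderiv i (fun t => fractionalLinear m t p) s =
      ((m s 1 0 * p 0 + m s 1 1 * p 1) *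
        (pderiv i (fun t => m t 0 0) s * p 0 + pderiv i (fun t => m t 0 1) s * p 1)
      - (m s 0 0 * p 0 + m s 0 1 * p 1) *
        (pderiv i (fun t => m t 1 0) s * p 0 + pderiv i (fun t => m t 1 1) s * p 1))
      / (m s 1 0 * p 0 + m s 1 1 * p 1) ^ 2 := fun i => by
    simp only [fractionalLinear, Matrix.mulVec, dotProduct, Fin.sum_univ_two]
    rw [pderiv_div (by fun_prop) (by fun_prop) hD', pderiv_add (by fun_prop) (by fun_prop),
      pderiv_add (by fun_prop) (by fun_prop), pderiv_mul_const (dm _ _), pderiv_mul_const (dm _ _),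
      pderiv_mul_const (dm _ _), pderiv_mul_const (dm _ _)]
  have dIp : ∀ i, pderiv i (fun r => fractionalLinear m s r) p =
      ((m s 1 0 * p 0 + m s 1 1 * p 1) * m s 0 i - (m s 0 0 * p 0 + m s 0 1 * p 1) * m s 1 i)
      / (m s 1 0 * p 0 + m s 1 1 * p 1) ^ 2 := fun i => by
    have d : ∀ j, DifferentiableAt ℝ (fun r : Fin 2 → ℝ => r j) p := fun j => by fun_prop
    simp only [fractionalLinear, Matrix.mulVec, dotProduct, Fin.sum_univ_two]
    rw [pderiv_div (by fun_prop) (by fun_prop) hD', pderiv_add (by fun_prop) (by fun_prop),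
      pderiv_add (by fun_prop) (by fun_prop), pderiv_const_mul (d _), pderiv_const_mul (d _),
      pderiv_const_mul (d _), pderiv_const_mul (d _), pderiv_coord, pderiv_coord]
    fin_cases i <;> simp
  simp only [poissonBracket, Fin.sum_univ_two, dI, dIp, pderiv_geodesicHamiltonian_momentum hg hs,
    hp]
  rw [hpdef, pderiv_geodesicHamiltonian_position hg hV hs, ← hpdef,
    pderiv_geodesicHamiltonian_position hg hV hs, hc, hc]
  field_simp
  simp only [hlow, pderiv_coframe hg hV hm hs]
  have sd := fun k => hg.pderiv_symm hV hs k 1 0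
  simp only [sd, hp0, hp1]
  ring

end PoissonBracket

/-! ### The coframe of an integral -/

section IntegralForm

open TopologicalSpace

/-- The numerator of the `1`-form `b` of an integral, in terms of the coframe `ξ` and its covariant
derivative `T`. -/
def integralFormNum {R : Type*} [CommRing R] (ξ : Fin 2 → Fin 2 → R) (T : Fin 2 → Fin 2 → Fin 2 → R)
    (j : Fin 2) : R :=
  (T 1 0 0 * (-ξ 0 1 * ξ 1 1) + T 1 0 1 * (ξ 0 1 * ξ 1 0) + T 1 1 0 * (ξ 0 0 * ξ 1 1)
      + T 1 1 1 * (-ξ 0 0 * ξ 1 0)) * ξ 0 j +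
    (T 0 0 0 * (-ξ 0 1 * ξ 1 1) + T 0 0 1 * (ξ 0 0 * ξ 1 1) + T 0 1 0 * (ξ 0 1 * ξ 1 0)
      + T 0 1 1 * (-ξ 0 0 * ξ 1 0)) * ξ 1 j

/-- Let `ξ` be a basis of linear forms and `T 0`, `T 1` bilinear forms. If the cubic form
`ξ₁(v) T₀(v, v) - ξ₀(v) T₁(v, v)` vanishes wherever `ξ₁(v)` does not, then
`T c i k = a i * ξ c k + b k * ξ c i` for two `1`-forms `a` and `b`. -/
theorem covariant_decomposition {ξ : Fin 2 → Fin 2 → ℝ} {T : Fin 2 → Fin 2 → Fin 2 → ℝ}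
    (hξ : ξ 0 0 * ξ 1 1 - ξ 0 1 * ξ 1 0 ≠ 0)
    (h : ∀ v : Fin 2 → ℝ, ξ 1 0 * v 0 + ξ 1 1 * v 1 ≠ 0 →
      (ξ 1 0 * v 0 + ξ 1 1 * v 1) * (T 0 0 0 * v 0 ^ 2 + (T 0 0 1 + T 0 1 0) * (v 0 * v 1)
        + T 0 1 1 * v 1 ^ 2) - (ξ 0 0 * v 0 + ξ 0 1 * v 1) * (T 1 0 0 * v 0 ^ 2
        + (T 1 0 1 + T 1 1 0) * (v 0 * v 1) + T 1 1 1 * v 1 ^ 2) = 0) :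
    ∃ a : Fin 2 → ℝ, ∀ c i k, T c i k = a i * ξ c k
      + integralFormNum ξ T k / (ξ 0 0 * ξ 1 1 - ξ 0 1 * ξ 1 0) ^ 2 * ξ c i := by
  -- evaluate the cubic form along the line on which the denominator is constant
  have key : ∀ x : ℝ,
      (T 0 0 0 * ξ 0 1 ^ 2 - (T 0 0 1 + T 0 1 0) * (ξ 0 0 * ξ 0 1) + T 0 1 1 * ξ 0 0 ^ 2)
      + x * (T 0 0 0 * (-2 * ξ 0 1 * ξ 1 1) + (T 0 0 1 + T 0 1 0) * (ξ 0 0 * ξ 1 1 + ξ 0 1 * ξ 1 0)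
        + T 0 1 1 * (-2 * ξ 0 0 * ξ 1 0)
        - (T 1 0 0 * ξ 0 1 ^ 2 - (T 1 0 1 + T 1 1 0) * (ξ 0 0 * ξ 0 1) + T 1 1 1 * ξ 0 0 ^ 2))
      + x ^ 2 * (T 0 0 0 * ξ 1 1 ^ 2 - (T 0 0 1 + T 0 1 0) * (ξ 1 0 * ξ 1 1) + T 0 1 1 * ξ 1 0 ^ 2
        - (T 1 0 0 * (-2 * ξ 0 1 * ξ 1 1) + (T 1 0 1 + T 1 1 0) * (ξ 0 0 * ξ 1 1 + ξ 0 1 * ξ 1 0)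
        + T 1 1 1 * (-2 * ξ 0 0 * ξ 1 0)))
      - x ^ 3 * (T 1 0 0 * ξ 1 1 ^ 2 - (T 1 0 1 + T 1 1 0) * (ξ 1 0 * ξ 1 1)
        + T 1 1 1 * ξ 1 0 ^ 2) = 0 := fun x => by
    have := h ![x * ξ 1 1 - ξ 0 1, ξ 0 0 - x * ξ 1 0] (by
      simp only [Matrix.cons_val_zero, Matrix.cons_val_one]
      convert hξ using 1; ring)
    simp only [Matrix.cons_val_zero, Matrix.cons_val_one] at this
    apply mul_left_cancel₀ hξ
    linear_combination this
  -- four values of `x` show that the coefficients of this cubic polynomial vanish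
  have k0 := key 0
  have k1 := key 1
  have k2 := key (-1)
  have k3 := key 2
  set Δ := ξ 0 0 * ξ 1 1 - ξ 0 1 * ξ 1 0 with hΔ
  have c0 : T 0 0 0 * ξ 0 1 ^ 2 - (T 0 0 1 + T 0 1 0) * (ξ 0 0 * ξ 0 1) + T 0 1 1 * ξ 0 0 ^ 2 = 0 := by
    linear_combination k0
  have c3 : T 1 0 0 * ξ 1 1 ^ 2 - (T 1 0 1 + T 1 1 0) * (ξ 1 0 * ξ 1 1) + T 1 1 1 * ξ 1 0 ^ 2 = 0 := by
    linear_combination -(k3 - k0) / 6 + (k1 - k2) / 6 + (k1 + k2 - 2 * k0) / 3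
  have c2 : T 0 0 0 * ξ 1 1 ^ 2 - (T 0 0 1 + T 0 1 0) * (ξ 1 0 * ξ 1 1) + T 0 1 1 * ξ 1 0 ^ 2
        = T 1 0 0 * (-2 * ξ 0 1 * ξ 1 1) + (T 1 0 1 + T 1 1 0) * (ξ 0 0 * ξ 1 1 + ξ 0 1 * ξ 1 0)
        + T 1 1 1 * (-2 * ξ 0 0 * ξ 1 0) := by
    linear_combination (k1 + k2) / 2 - k0
  have c1 : T 0 0 0 * (-2 * ξ 0 1 * ξ 1 1) + (T 0 0 1 + T 0 1 0) * (ξ 0 0 * ξ 1 1 + ξ 0 1 * ξ 1 0)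
        + T 0 1 1 * (-2 * ξ 0 0 * ξ 1 0)
        = T 1 0 0 * ξ 0 1 ^ 2 - (T 1 0 1 + T 1 1 0) * (ξ 0 0 * ξ 0 1) + T 1 1 1 * ξ 0 0 ^ 2 := by
    linear_combination (k1 - k2) / 2 + c3
  refine ⟨fun i => ((T 1 0 0 * (-ξ 0 1 * ξ 1 1) + T 1 0 1 * (ξ 0 0 * ξ 1 1)
      + T 1 1 0 * (ξ 0 1 * ξ 1 0) + T 1 1 1 * (-ξ 0 0 * ξ 1 0)) * ξ 0 i +
    (T 0 0 0 * (-ξ 0 1 * ξ 1 1) + T 0 0 1 * (ξ 0 1 * ξ 1 0) + T 0 1 0 * (ξ 0 0 * ξ 1 1)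
      + T 0 1 1 * (-ξ 0 0 * ξ 1 0)) * ξ 1 i) / Δ ^ 2, fun c i k => ?_⟩
  have hΔ2 : Δ ^ 2 ≠ 0 := pow_ne_zero 2 hξ
  rw [div_mul_eq_mul_div, div_mul_eq_mul_div, ← add_div, eq_div_iff hΔ2, integralFormNum, hΔ]
  -- the expansion of `T c` in the basis of products of members of `ξ`
  have e0 : ∀ i k, T 0 i k * (ξ 0 0 * ξ 1 1 - ξ 0 1 * ξ 1 0) ^ 2 = (T 0 0 0 * ξ 1 1 ^ 2
      - (T 0 0 1 + T 0 1 0) * (ξ 1 0 * ξ 1 1) + T 0 1 1 * ξ 1 0 ^ 2) * ξ 0 i * ξ 0 k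
      + (T 0 0 0 * (-ξ 0 1 * ξ 1 1) + T 0 0 1 * (ξ 0 0 * ξ 1 1) + T 0 1 0 * (ξ 0 1 * ξ 1 0)
      + T 0 1 1 * (-ξ 0 0 * ξ 1 0)) * ξ 0 i * ξ 1 k
      + (T 0 0 0 * (-ξ 0 1 * ξ 1 1) + T 0 0 1 * (ξ 0 1 * ξ 1 0) + T 0 1 0 * (ξ 0 0 * ξ 1 1)
      + T 0 1 1 * (-ξ 0 0 * ξ 1 0)) * ξ 1 i * ξ 0 k
      + (T 0 0 0 * ξ 0 1 ^ 2 - (T 0 0 1 + T 0 1 0) * (ξ 0 0 * ξ 0 1) + T 0 1 1 * ξ 0 0 ^ 2)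
      * ξ 1 i * ξ 1 k := fun i k => by
    fin_cases i <;> fin_cases k <;> simp only [Fin.zero_eta, Fin.mk_one] <;> ring
  have e1 : ∀ i k, T 1 i k * (ξ 0 0 * ξ 1 1 - ξ 0 1 * ξ 1 0) ^ 2 = (T 1 0 0 * ξ 1 1 ^ 2
      - (T 1 0 1 + T 1 1 0) * (ξ 1 0 * ξ 1 1) + T 1 1 1 * ξ 1 0 ^ 2) * ξ 0 i * ξ 0 k
      + (T 1 0 0 * (-ξ 0 1 * ξ 1 1) + T 1 0 1 * (ξ 0 0 * ξ 1 1) + T 1 1 0 * (ξ 0 1 * ξ 1 0)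
      + T 1 1 1 * (-ξ 0 0 * ξ 1 0)) * ξ 0 i * ξ 1 k
      + (T 1 0 0 * (-ξ 0 1 * ξ 1 1) + T 1 0 1 * (ξ 0 1 * ξ 1 0) + T 1 1 0 * (ξ 0 0 * ξ 1 1)
      + T 1 1 1 * (-ξ 0 0 * ξ 1 0)) * ξ 1 i * ξ 0 k
      + (T 1 0 0 * ξ 0 1 ^ 2 - (T 1 0 1 + T 1 1 0) * (ξ 0 0 * ξ 0 1) + T 1 1 1 * ξ 0 0 ^ 2)
      * ξ 1 i * ξ 1 k := fun i k => by
    fin_cases i <;> fin_cases k <;> simp only [Fin.zero_eta, Fin.mk_one] <;> ring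
  fin_cases c <;> simp only [Fin.zero_eta, Fin.mk_one]
  · rw [e0, c0, c2]; ring
  · rw [e1, c3, ← c1]; ring

variable {g m : (Fin 2 → ℝ) → Matrix (Fin 2) (Fin 2) ℝ} {W : Opens (Fin 2 → ℝ)}

/-- The coframe of an integral as elements of the ring of smooth functions. -/
noncomputable def smoothCoframe (hg : IsRiemannianMetricOn g W)
    (hm : IsFractionalLinearIntegralOn g W m) (c j : Fin 2) : SmoothFun W :=
  smoothRestrict (coframe g m c j) (contDiffOn_coframe hg hm.1 c j)

theorem coframe_det (s : Fin 2 → ℝ) : coframe g m 0 0 s * coframe g m 1 1 s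
    - coframe g m 0 1 s * coframe g m 1 0 s = (m s).det * (g s).det := by
  simp only [coframe, Matrix.det_fin_two]; ring

theorem contDiffOn_covCoframe {V : Set (Fin 2 → ℝ)} (hV : IsOpen V) (hg : IsRiemannianMetricOn g V)
    (hm : ∀ i j, ContDiffOn ℝ ∞ (fun s => m s i j) V) (c i j : Fin 2) :
    ContDiffOn ℝ ∞ (covCoframe g m c i j) V :=
  ((contDiffOn_coframe hg hm c j).pderiv hV i).sub
    (((hg.contDiffOn_christoffel hV 0 i j).mul (contDiffOn_coframe hg hm c 0)).add
      ((hg.contDiffOn_christoffel hV 1 i j).mul (contDiffOn_coframe hg hm c 1)))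

/-- The logarithmic derivative of the area density is the contracted Christoffel symbol. -/
theorem IsRiemannianMetricOn.pderiv_det {V : Set (Fin 2 → ℝ)} {s : Fin 2 → ℝ}
    (hg : IsRiemannianMetricOn g V) (hV : IsOpen V) (hs : s ∈ V) (i : Fin 2) :
    pderiv i (fun t => (g t).det) s =
      2 * (christoffel g 0 0 i s + christoffel g 1 1 i s) * (g s).det := by
  have dg := fun i j => (hg.1 i j).differentiableAt_of_isOpen hV hs
  have e : pderiv i (fun t => (g t).det) s =
      pderiv i (fun t => g t 0 0 * g t 1 1 + g t 0 1 * (-1 * g t 0 1)) s :=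
    pderiv_congr_on hV hs (fun t ht => by rw [Matrix.det_fin_two, hg.symm ht 1 0]; ring) i
  rw [e, pderiv_add ((dg _ _).fun_mul (dg _ _)) ((dg _ _).fun_mul ((dg _ _).const_mul _)),
    pderiv_mul (dg _ _) (dg _ _), pderiv_mul (dg _ _) ((dg _ _).const_mul _),
    pderiv_const_mul (dg _ _), hg.compat hV hs, hg.compat hV hs, hg.compat hV hs,
    hg.christoffel_symm hV hs 0 0 i, hg.christoffel_symm hV hs 1 1 i, Matrix.det_fin_two,
    hg.symm hs 1 0]
  ring

/-- The coframe `ξ` of a normalized integral satisfies `∇ᵢξⱼ = aᵢ ξⱼ + bⱼ ξᵢ`, where the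
normalization makes `2 a` the difference of the contracted Christoffel symbol and `b`. -/
theorem exists_coframe_equation (hg : IsRiemannianMetricOn g W)
    (hm : IsFractionalLinearIntegralOn g W m) (hdet : ∀ s ∈ W, (m s).det = 1) :
    ∃ b : Fin 2 → SmoothFun W, ∀ c i j, smoothPartial W i (smoothCoframe hg hm c j) =
      smoothChristoffel hg 0 i j * smoothCoframe hg hm c 0
      + smoothChristoffel hg 1 i j * smoothCoframe hg hm c 1
      + ((1 / 2 : ℝ) • (christoffelTrace (smoothChristoffel hg) i - b i)) * smoothCoframe hg hm c j
      + b j * smoothCoframe hg hm c i := by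
  have hξ : ∀ s ∈ W, coframe g m 0 0 s * coframe g m 1 1 s
      - coframe g m 0 1 s * coframe g m 1 0 s = (g s).det := fun s hs => by
    rw [coframe_det, hdet s hs, one_mul]
  have hpos : ∀ s ∈ W, coframe g m 0 0 s * coframe g m 1 1 s
      - coframe g m 0 1 s * coframe g m 1 0 s ≠ 0 := fun s hs => by
    rw [hξ s hs]; exact (hg.det_pos hs).ne'
  have cξ := contDiffOn_coframe hg hm.1
  have cT := contDiffOn_covCoframe W.isOpen hg hm.1
  have hb : ∀ j, ContDiffOn ℝ ∞ (fun s =>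
      integralFormNum (fun c j => coframe g m c j s) (fun c i j => covCoframe g m c i j s) j
        / (coframe g m 0 0 s * coframe g m 1 1 s - coframe g m 0 1 s * coframe g m 1 0 s) ^ 2) W :=
    fun j => by
      unfold integralFormNum
      refine ContDiffOn.div (by fun_prop) (by fun_prop) fun s hs => pow_ne_zero 2 (hpos s hs)
  refine ⟨fun j => smoothRestrict _ (hb j), fun c i j => DFunLike.ext _ _ fun s => ?_⟩
  have hcub := fun v hv => by
    have h1 := poissonBracket_fractionalLinear hg W.isOpen hm.1 s.2 v hv
    rw [hm.2.2 s s.2 _ hv, zero_mul] at h1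
    exact h1.symm
  obtain ⟨a, ha⟩ := covariant_decomposition (ξ := fun c j => coframe g m c j s)
    (T := fun c i j => covCoframe g m c i j s) (hpos s s.2) (fun v hv => hcub v (by
      convert hv using 1
      simp only [coframe, Matrix.mulVec, dotProduct, Fin.sum_univ_two]
      ring))
  have dξ := fun c j => (cξ c j).differentiableAt_of_isOpen W.isOpen s.2
  -- unit area of the coframe determines the `1`-form `a`
  have htr : ∀ i, 2 * a i + integralFormNum (fun c j => coframe g m c j s)
      (fun c i j => covCoframe g m c i j s) i / (coframe g m 0 0 s * coframe g m 1 1 s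
        - coframe g m 0 1 s * coframe g m 1 0 s) ^ 2
      = christoffel g 0 0 i s + christoffel g 1 1 i s := fun i => by
    have h1 := hg.pderiv_det W.isOpen s.2 i
    have e : pderiv i (fun t => (g t).det) s = pderiv i (fun t => coframe g m 0 0 t *
        coframe g m 1 1 t + coframe g m 0 1 t * (-1 * coframe g m 1 0 t)) s :=
      pderiv_congr_on W.isOpen s.2 (fun t ht => by rw [← hξ t ht]; ring) i
    rw [e, pderiv_add ((dξ _ _).fun_mul (dξ _ _)) ((dξ _ _).fun_mul ((dξ _ _).const_mul _)),
      pderiv_mul (dξ _ _) (dξ _ _), pderiv_mul (dξ _ _) ((dξ _ _).const_mul _),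
      pderiv_const_mul (dξ _ _), ← hξ s s.2] at h1
    have hcov : ∀ c i j, pderiv i (coframe g m c j) s - (christoffel g 0 i j s * coframe g m c 0 s
      + christoffel g 1 i j s * coframe g m c 1 s) = covCoframe g m c i j s := fun _ _ _ => rfl
    have t00 := (hcov 0 i 0).trans (ha 0 i 0)
    have t01 := (hcov 0 i 1).trans (ha 0 i 1)
    have t10 := (hcov 1 i 0).trans (ha 1 i 0)
    have t11 := (hcov 1 i 1).trans (ha 1 i 1)
    apply mul_right_cancel₀ (hpos s s.2)
    rw [hg.christoffel_symm W.isOpen s.2 0 0 i, hg.christoffel_symm W.isOpen s.2 1 1 i] at *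
    generalize hB : (fun k => integralFormNum (fun c j => coframe g m c j s)
      (fun c i j => covCoframe g m c i j s) k / (coframe g m 0 0 s * coframe g m 1 1 s
        - coframe g m 0 1 s * coframe g m 1 0 s) ^ 2) = B
    simp only [congrFun hB] at *
    -- Cramer's rule for the coefficients of `B` in the coframe
    have hBi : coframe g m 0 0 s * B 1 * coframe g m 1 i s
        + coframe g m 1 1 s * B 0 * coframe g m 0 i s - coframe g m 0 1 s * B 0 * coframe g m 1 i s
        - coframe g m 1 0 s * B 1 * coframe g m 0 i s = B i * (coframe g m 0 0 s *
          coframe g m 1 1 s - coframe g m 0 1 s * coframe g m 1 0 s) := by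
      fin_cases i <;> simp only [Fin.zero_eta, Fin.mk_one] <;> ring
    linear_combination h1 - hBi - coframe g m 0 0 s * t11 - coframe g m 1 1 s * t00
      + coframe g m 0 1 s * t10 + coframe g m 1 0 s * t01
  have h2 := ha c i j
  have h3 := htr i
  rw [smoothCoframe, smoothPartial_restrict]
  simp only [smoothRestrict_apply, SmoothFun.add_apply, SmoothFun.mul_apply, SmoothFun.smul_apply,
    SmoothFun.sub_apply, christoffelTrace, smoothChristoffel, smoothCoframe]
  conv_lhs at h2 => rw [covCoframe]
  linear_combination h2 + (1 / 2) * coframe g m c j s * h3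

end IntegralForm

/-! ### The integrability conditions of the coframe equation -/

section Constraints

open TopologicalSpace Polynomial

variable {g m : (Fin 2 → ℝ) → Matrix (Fin 2) (Fin 2) ℝ} {W : Opens (Fin 2 → ℝ)}

/-- The `1`-form `b` of a normalized integral, together with the equation for its covariant
derivative that makes the equation of the coframe integrable. -/
theorem exists_integralForm (hg : IsRiemannianMetricOn g W)
    (hm : IsFractionalLinearIntegralOn g W m) (hdet : ∀ s ∈ W, (m s).det = 1) :
    ∃ (b : Fin 2 → SmoothFun W) (w : SmoothFun W),
      (∀ c i j, smoothPartial W i (smoothCoframe hg hm c j) =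
        smoothChristoffel hg 0 i j * smoothCoframe hg hm c 0
        + smoothChristoffel hg 1 i j * smoothCoframe hg hm c 1
        + ((1 / 2 : ℝ) • (christoffelTrace (smoothChristoffel hg) i - b i))
          * smoothCoframe hg hm c j
        + b j * smoothCoframe hg hm c i) ∧
      IsIntegralForm (smoothPartial W) (smoothChristoffel hg) (smoothMetric hg)
        (smoothCurvature hg) b w := by
  obtain ⟨b, hb⟩ := exists_coframe_equation hg hm hdet
  have two : ∀ f : SmoothFun W, 2 * ((1 / 2 : ℝ) • f) = f := fun f =>
    DFunLike.ext _ _ fun s => by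
      simp only [SmoothFun.mul_apply, SmoothFun.smul_apply, SmoothFun.ofNat_apply]; ring
  have h := isLeviCivita_smooth hg
  obtain ⟨w, hw⟩ : ∃ w : SmoothFun W, 2 * w = smoothPartial W 0 (b 1) - smoothPartial W 1 (b 0) :=
    ⟨_, two _⟩
  refine ⟨b, w, hb, ?_⟩
  have key := fun c j => h.curvature_coframe (fun i => two _) (hb c) hw j
  -- the coframe is a basis, so both coefficients vanish
  have zero : ∀ x y : SmoothFun W, (∀ c, smoothCoframe hg hm c 0 * x - smoothCoframe hg hm c 1 * y
      = 0) → x = 0 ∧ y = 0 := fun x y hxy => by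
    have hne : ∀ s : W, coframe g m 0 0 s * coframe g m 1 1 s
        - coframe g m 0 1 s * coframe g m 1 0 s ≠ 0 := fun s => by
      rw [coframe_det, hdet s s.2, one_mul]; exact (hg.det_pos s.2).ne'
    have h0 := fun s => DFunLike.congr_fun (hxy 0) s
    have h1 := fun s => DFunLike.congr_fun (hxy 1) s
    simp only [SmoothFun.sub_apply, SmoothFun.mul_apply, SmoothFun.zero_apply, smoothCoframe,
      smoothRestrict_apply] at h0 h1
    constructor <;> refine DFunLike.ext _ _ fun s => mul_left_cancel₀ (hne s) ?_
    · simp only [SmoothFun.zero_apply]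
      linear_combination coframe g m 1 1 s * h0 s - coframe g m 0 1 s * h1 s
    · simp only [SmoothFun.zero_apply]
      linear_combination coframe g m 1 0 s * h0 s - coframe g m 0 0 s * h1 s
  obtain ⟨e10, e00⟩ := zero _ _ fun c => key c 0
  obtain ⟨e11, e01⟩ := zero _ _ fun c => key c 1
  simp only [h.symmΓ, h.symmg, if_true, one_ne_zero, zero_ne_one, if_false] at e10 e00 e11 e01
  constructor
  · linear_combination e00
  · linear_combination e01
  · linear_combination e10
  · linear_combination e11

/-- Three polynomial equations in `(b, w)`, linear in `b`, that leave at most six values of `w`. -/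
theorem exists_polynomial_of_constraints (Y Z : ℝ) (Y' : ℝ) (p q r : Fin 2 → ℝ)
    (l : Fin 2 → Fin 2 → ℝ) : ∃ P : ℝ[X], P ≠ 0 ∧ P.natDegree ≤ 6 ∧ ∀ (b : Fin 2 → ℝ) (w : ℝ),
      6 * w ^ 2 + 3 * (Y * b 1 - Y' * b 0) + Z = 0 →
      (∀ j, 30 * w ^ 2 * b j + p j * w ^ 2 + q j * w + l j 0 * b 0 + l j 1 * b 1 + r j = 0) →
      P.IsRoot w := by
  -- Cramer's rule for `b`, substituted into the first equation
  let c : Fin 2 → ℝ[X] := fun j => C (p j) * X ^ 2 + C (q j) * X + C (r j)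
  let F : ℝ[X] := (C 6 * X ^ 2 + C Z) * ((C 30 * X ^ 2 + C (l 0 0)) * (C 30 * X ^ 2 + C (l 1 1))
    - C (l 0 1 * l 1 0))
  let G : ℝ[X] := C (-3 * Y) * ((C 30 * X ^ 2 + C (l 0 0)) * c 1 - C (l 1 0) * c 0)
    + C (3 * Y') * ((C 30 * X ^ 2 + C (l 1 1)) * c 0 - C (l 0 1) * c 1)
  have hF : F.natDegree = 6 := by
    simp only [F]
    compute_degree!
  have hG : G.natDegree ≤ 4 := by
    simp only [G, c]
    compute_degree!
  have hFG : (F + G).natDegree = 6 := by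
    rw [natDegree_add_eq_left_of_natDegree_lt (by omega), hF]
  refine ⟨F + G, fun h0 => by simp [h0] at hFG, hFG.le, fun b w h1 h2 => ?_⟩
  have e0 := h2 0
  have e1 := h2 1
  simp only [IsRoot.def, F, G, c, eval_add, eval_mul, eval_sub, eval_C, eval_pow, eval_X]
  have hd0 : ((30 * w ^ 2 + l 0 0) * (30 * w ^ 2 + l 1 1) - l 0 1 * l 1 0) * b 0
      = -((30 * w ^ 2 + l 1 1) * (p 0 * w ^ 2 + q 0 * w + r 0)
        - l 0 1 * (p 1 * w ^ 2 + q 1 * w + r 1)) := by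
    linear_combination (30 * w ^ 2 + l 1 1) * e0 - l 0 1 * e1
  have hd1 : ((30 * w ^ 2 + l 0 0) * (30 * w ^ 2 + l 1 1) - l 0 1 * l 1 0) * b 1
      = -((30 * w ^ 2 + l 0 0) * (p 1 * w ^ 2 + q 1 * w + r 1)
        - l 1 0 * (p 0 * w ^ 2 + q 0 * w + r 0)) := by
    linear_combination (30 * w ^ 2 + l 0 0) * e1 - l 1 0 * e0
  linear_combination ((30 * w ^ 2 + l 0 0) * (30 * w ^ 2 + l 1 1) - l 0 1 * l 1 0) * h1
    - 3 * Y * hd1 + 3 * Y' * hd0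

/-- At each point the antisymmetric part `w` takes at most six values. -/
theorem exists_polynomial_isRoot (hg : IsRiemannianMetricOn g W) (s : W) :
    ∃ P : ℝ[X], P ≠ 0 ∧ P.natDegree ≤ 6 ∧ ∀ (b : Fin 2 → SmoothFun W) (w : SmoothFun W),
      IsIntegralForm (smoothPartial W) (smoothChristoffel hg) (smoothMetric hg)
        (smoothCurvature hg) b w → P.IsRoot (w s) := by
  have h := isLeviCivita_smooth hg
  set Γ := smoothChristoffel hg
  set γ := smoothMetric hg
  set K := smoothCurvature hg
  set D := smoothPartial W
  obtain ⟨P, hP, hdeg, hroot⟩ := exists_polynomial_of_constraints (coGrad D γ K 0 s)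
    (coLap D Γ γ K s) (coGrad D γ K 1 s) (fun j => 12 * christoffelTrace Γ j s)
    (fun j => 15 * coGrad D γ K j s)
    (fun j => 3 * (coGrad D γ K 0 s * (K s * γ j 1 s) - coGrad D γ K 1 s * (K s * γ j 0 s))
      + D j (coLap D Γ γ K) s)
    (fun j => ![3 * (-D j (coGrad D γ K 1) s + coGrad D γ K 0 s * Γ 0 j 1 s
        - coGrad D γ K 1 s * Γ 0 j 0 s) - (if j = 0 then coLap D Γ γ K s else 0),
      3 * (D j (coGrad D γ K 0) s + coGrad D γ K 0 s * Γ 1 j 1 s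
        - coGrad D γ K 1 s * Γ 1 j 0 s) - (if j = 1 then coLap D Γ γ K s else 0)])
  refine ⟨P, hP, hdeg, fun b w hb => hroot (fun j => b j s) (w s) ?_ fun j => ?_⟩
  · simpa using DFunLike.congr_fun (hb.constraint h) s
  · have := DFunLike.congr_fun (hb.deriv_constraint h j) s
    simp only [SmoothFun.add_apply, SmoothFun.sub_apply, SmoothFun.mul_apply, SmoothFun.pow_apply,
      SmoothFun.ofNat_apply, SmoothFun.zero_apply] at this
    fin_cases j <;> simp at this ⊢ <;> linear_combination this

end Constraints

section Uniqueness

open TopologicalSpace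

variable {W : Opens (Fin 2 → ℝ)}

theorem smoothPartial_apply (f : SmoothFun W) (i : Fin 2) (s : W) :
    smoothPartial W i f s = pderiv i (zeroExt f) s := rfl

/-- A solution of a homogeneous linear first-order system on a convex domain vanishes if it
vanishes at one point, by Grönwall's inequality on segments. -/
theorem SmoothFun.eq_zero_of_linear_system {n : ℕ} (hW : Convex ℝ (W : Set (Fin 2 → ℝ)))
    {u : Fin n → SmoothFun W} {a : Fin 2 → Fin n → Fin n → SmoothFun W}
    (hu : ∀ i α, smoothPartial W i (u α) = ∑ β, a i α β * u β) {s₀ : W} (h0 : ∀ α, u α s₀ = 0)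
    (α : Fin n) : u α = 0 := by
  refine DFunLike.ext _ _ fun s => ?_
  set v : Fin 2 → ℝ := s.1 - s₀.1 with hv
  let γ : ℝ → Fin 2 → ℝ := fun t => s₀.1 + t • v
  have hγ : ∀ t ∈ Set.Icc (0 : ℝ) 1, γ t ∈ W := fun t ht =>
    hW.add_smul_sub_mem s₀.2 s.2 ht
  have dγ : ∀ t, HasDerivAt γ v t := fun t => by
    have := ((hasDerivAt_id t).smul_const v).const_add s₀.1
    rw [one_smul] at this
    exact this
  let f : ℝ → Fin n → ℝ := fun t α => zeroExt (u α) (γ t)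
  let A : ℝ → Fin n → Fin n → ℝ := fun t α β =>
    v 0 * zeroExt (a 0 α β) (γ t) + v 1 * zeroExt (a 1 α β) (γ t)
  have hf : ∀ t ∈ Set.Icc (0 : ℝ) 1, HasDerivAt f (fun α => ∑ β, A t α β * f t β) t := by
    intro t ht
    rw [hasDerivAt_pi]
    intro α
    have h1 := ((contDiffOn_zeroExt (u α)).differentiableAt_of_isOpen W.isOpen
      (hγ t ht)).hasFDerivAt.comp_hasDerivAt t (dγ t)
    rw [fderiv_eq_sum_pderiv] at h1
    refine h1.congr_deriv ?_
    symm
    have e := fun i => DFunLike.congr_fun (hu i α) ⟨γ t, hγ t ht⟩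
    simp only [smoothPartial_apply] at e
    rw [e 0, e 1]
    have hs : ∀ i, (∑ β, a i α β * u β) ⟨γ t, hγ t ht⟩ =
        ∑ β, zeroExt (a i α β) (γ t) * zeroExt (u β) (γ t) := fun i => by
      have : ∀ S : Finset (Fin n), (∑ β ∈ S, a i α β * u β) ⟨γ t, hγ t ht⟩ =
          ∑ β ∈ S, zeroExt (a i α β) (γ t) * zeroExt (u β) (γ t) := fun S => by
        induction S using Finset.induction_on with
        | empty => simp
        | insert x S hx ih =>
          rw [Finset.sum_insert hx, Finset.sum_insert hx, SmoothFun.add_apply, ih,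
            SmoothFun.mul_apply]
          exact congrArg₂ (· + ·) (congrArg₂ (· * ·) (zeroExt_apply _ ⟨γ t, hγ t ht⟩).symm
            (zeroExt_apply _ ⟨γ t, hγ t ht⟩).symm) rfl
      exact this _
    rw [hs, hs, Finset.mul_sum, Finset.mul_sum, ← Finset.sum_add_distrib]
    exact Finset.sum_congr rfl fun β _ => by simp only [A, f]; ring
  have cA : ContinuousOn (fun t => ∑ α, ∑ β, |A t α β|) (Set.Icc 0 1) := by
    have c : ∀ i α β, ContinuousOn (fun t => zeroExt (a i α β) (γ t)) (Set.Icc 0 1) :=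
      fun i α β => (contDiffOn_zeroExt (a i α β)).continuousOn.comp
        (fun t _ => (dγ t).continuousAt.continuousWithinAt) hγ
    refine continuousOn_finsetSum _ fun α _ => continuousOn_finsetSum _ fun β _ => ?_
    exact ((continuousOn_const.mul (c 0 α β)).add (continuousOn_const.mul (c 1 α β))).abs
  obtain ⟨C, hC⟩ := isCompact_Icc.bddAbove_image cA
  have hz := eq_zero_of_abs_deriv_le_mul_abs_self_of_eq_zero_right (f := f) (K := C)
    (f' := fun t α => ∑ β, A t α β * f t β) (a := 0) (b := 1)
    (fun t ht => (hf t ht).continuousAt.continuousWithinAt)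
    (fun t ht => (hf t (Set.Ico_subset_Icc_self ht)).hasDerivWithinAt)
    (by ext α; simpa [f, γ, zeroExt_apply] using h0 α)
    (fun t ht => by
      have hCt : ∑ α, ∑ β, |A t α β| ≤ C :=
        hC (Set.mem_image_of_mem _ (Set.Ico_subset_Icc_self ht))
      refine le_trans ?_ (mul_le_mul_of_nonneg_right hCt (norm_nonneg _))
      rw [pi_norm_le_iff_of_nonneg (by positivity)]
      intro α
      calc ‖∑ β, A t α β * f t β‖ ≤ ∑ β, ‖A t α β * f t β‖ := norm_sum_le _ _
        _ ≤ ∑ β, |A t α β| * ‖f t‖ := Finset.sum_le_sum fun β _ => by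
            rw [norm_mul, Real.norm_eq_abs]
            exact mul_le_mul_of_nonneg_left (norm_le_pi_norm _ _) (abs_nonneg _)
        _ = (∑ β, |A t α β|) * ‖f t‖ := by rw [Finset.sum_mul]
        _ ≤ (∑ α, ∑ β, |A t α β|) * ‖f t‖ := mul_le_mul_of_nonneg_right
            (Finset.single_le_sum (f := fun α => ∑ β, |A t α β|)
              (fun _ _ => by positivity) (Finset.mem_univ α)) (norm_nonneg _))
    1 (by simp)
  have := congrFun hz α
  simpa [f, γ, hv, zeroExt_apply] using this

end Uniqueness

/-! ### Finiteness of the orbits when the curvature varies -/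

section Orbits

open TopologicalSpace Polynomial

variable {g : (Fin 2 → ℝ) → Matrix (Fin 2) (Fin 2) ℝ} {W : Opens (Fin 2 → ℝ)}

theorem SmoothFun.continuous (f : SmoothFun W) : Continuous f := by
  have := (contDiffOn_zeroExt f).continuousOn.domRestrict
  refine this.congr fun s => ?_
  exact zeroExt_apply f s

theorem smoothPartial_congr {f h : SmoothFun W} {O : Set W} (hO : IsOpen O)
    (hfh : ∀ s ∈ O, f s = h s) (i : Fin 2) {s : W} (hs : s ∈ O) :
    smoothPartial W i f s = smoothPartial W i h s := by
  refine pderiv_congr_on (V := Subtype.val '' O) (W.isOpen.isOpenMap_subtype_val O hO)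
    (Set.mem_image_of_mem _ hs) ?_ i
  rintro _ ⟨t, ht, rfl⟩
  rw [zeroExt_apply, zeroExt_apply, hfh t ht]

/-- The prolonged system for `(b, w)` has at most one solution with given values at a point. -/
theorem IsIntegralForm.eq_of_eq_at (hW : Convex ℝ (W : Set (Fin 2 → ℝ)))
    (hg : IsRiemannianMetricOn g W) {b b' : Fin 2 → SmoothFun W} {w w' : SmoothFun W}
    (hb : IsIntegralForm (smoothPartial W) (smoothChristoffel hg) (smoothMetric hg)
      (smoothCurvature hg) b w)
    (hb' : IsIntegralForm (smoothPartial W) (smoothChristoffel hg) (smoothMetric hg)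
      (smoothCurvature hg) b' w') {s : W} (h0 : ∀ i, b i s = b' i s) (h1 : w s = w' s) :
    b = b' ∧ w = w' := by
  have h := isLeviCivita_smooth hg
  set Γ := smoothChristoffel hg
  have key := SmoothFun.eq_zero_of_linear_system hW (n := 3) (s₀ := s)
    (u := ![b 0 - b' 0, b 1 - b' 1, w - w'])
    (a := ![
      ![![Γ 0 0 0 + b 0 + b' 0, Γ 1 0 0, 0], ![Γ 0 0 1 + b' 1, Γ 1 0 1 + b 0, 1],
        ![3 * w, 0, christoffelTrace Γ 0 + 3 * b' 0]],
      ![![Γ 0 0 1 + b 1, Γ 1 0 1 + b' 0, -1], ![Γ 0 1 1, Γ 1 1 1 + b 1 + b' 1, 0],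
        ![0, 3 * w, christoffelTrace Γ 1 + 3 * b' 1]]])
    (by
      intro i α
      fin_cases i <;> fin_cases α <;>
        simp [Fin.sum_univ_three, hb.d00, hb.d01, hb.d10, hb.d11, hb'.d00, hb'.d01, hb'.d10,
          hb'.d11, hb.deriv_w h, hb'.deriv_w h] <;> ring)
    (by intro α; fin_cases α <;> simp [h0, h1])
  have k0 := key 0
  have k1 := key 1
  have k2 := key 2
  simp only [Matrix.cons_val_zero, Matrix.cons_val_one, Matrix.cons_val] at k0 k1 k2
  refine ⟨funext fun i => ?_, sub_eq_zero.1 k2⟩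
  fin_cases i
  exacts [sub_eq_zero.1 k0, sub_eq_zero.1 k1]

/-- Where the curvature has no critical points, `w` determines `b`: there `w` cannot vanish
identically, and where it does not vanish its derivative gives `b`. -/
theorem IsIntegralForm.eq_of_eqOn (hW : Convex ℝ (W : Set (Fin 2 → ℝ)))
    (hg : IsRiemannianMetricOn g W) {b b' : Fin 2 → SmoothFun W} {w w' : SmoothFun W}
    (hb : IsIntegralForm (smoothPartial W) (smoothChristoffel hg) (smoothMetric hg)
      (smoothCurvature hg) b w)
    (hb' : IsIntegralForm (smoothPartial W) (smoothChristoffel hg) (smoothMetric hg)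
      (smoothCurvature hg) b' w') {O : Set W} (hO : IsOpen O) (hne : O.Nonempty)
    (hK : ∀ s ∈ O, ∃ j, coGrad (smoothPartial W) (smoothMetric hg) (smoothCurvature hg) j s ≠ 0)
    (hw : ∀ s ∈ O, w s = w' s) : b = b' := by
  have h := isLeviCivita_smooth hg
  obtain ⟨s, hs, hws⟩ : ∃ s ∈ O, w s ≠ 0 := by
    by_contra! hcon
    obtain ⟨s, hs⟩ := hne
    obtain ⟨j, hj⟩ := hK s hs
    have h1 := smoothPartial_congr (h := 0) hO (fun t ht => by simpa using hcon t ht) j hs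
    rw [hb.deriv_w h] at h1
    simp [hcon s hs] at h1
    exact hj h1
  refine (hb.eq_of_eq_at hW hg hb' (s := s) (fun j => ?_) (hw s hs)).1
  have h1 := smoothPartial_congr hO hw j hs
  rw [hb.deriv_w h, hb'.deriv_w h] at h1
  simp only [SmoothFun.add_apply, SmoothFun.mul_apply, SmoothFun.ofNat_apply, ← hw s hs] at h1
  apply mul_left_cancel₀ hws
  linear_combination h1 / 3

/-- The coframes with the same `1`-form `b` form one orbit of `SL₂(ℝ)`. -/
theorem exists_specialLinear_of_same_form (hW : Convex ℝ (W : Set (Fin 2 → ℝ)))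
    (hg : IsRiemannianMetricOn g W) {m m' : (Fin 2 → ℝ) → Matrix (Fin 2) (Fin 2) ℝ}
    (hm : IsFractionalLinearIntegralOn g W m) (hdet : ∀ s ∈ W, (m s).det = 1)
    (hm' : IsFractionalLinearIntegralOn g W m') (hdet' : ∀ s ∈ W, (m' s).det = 1)
    {a b : Fin 2 → SmoothFun W} {Γ : Fin 2 → Fin 2 → Fin 2 → SmoothFun W}
    (hb : ∀ c i j, smoothPartial W i (smoothCoframe hg hm c j) =
        Γ 0 i j * smoothCoframe hg hm c 0 + Γ 1 i j * smoothCoframe hg hm c 1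
        + a i * smoothCoframe hg hm c j + b j * smoothCoframe hg hm c i)
    (hb' : ∀ c i j, smoothPartial W i (smoothCoframe hg hm' c j) =
        Γ 0 i j * smoothCoframe hg hm' c 0 + Γ 1 i j * smoothCoframe hg hm' c 1
        + a i * smoothCoframe hg hm' c j + b j * smoothCoframe hg hm' c i) (s₀ : W) :
    ∃ h : Matrix.SpecialLinearGroup (Fin 2) ℝ,
      ∀ s ∈ W, m' s = (h : Matrix (Fin 2) (Fin 2) ℝ) * m s := by
  let h : Matrix.SpecialLinearGroup (Fin 2) ℝ :=
    ⟨m' s₀ * (m s₀).adjugate, by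
      rw [Matrix.det_mul, Matrix.det_adjugate, hdet s₀ s₀.2, hdet' s₀ s₀.2]; simp⟩
  have hh : m' s₀ = (h : Matrix (Fin 2) (Fin 2) ℝ) * m s₀ := by
    change _ = m' s₀ * (m s₀).adjugate * m s₀
    rw [Matrix.mul_assoc, Matrix.adjugate_mul, hdet s₀ s₀.2]; simp
  refine ⟨h, fun s hs => ?_⟩
  have hc : ∀ (t : Fin 2 → ℝ) c j, coframe g m' c j t - ((h : Matrix (Fin 2) (Fin 2) ℝ) c 0 *
      coframe g m 0 j t + (h : Matrix (Fin 2) (Fin 2) ℝ) c 1 * coframe g m 1 j t) =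
      ((m' t - (h : Matrix (Fin 2) (Fin 2) ℝ) * m t) * g t) c j := fun t c j => by
    simp only [coframe, Matrix.mul_apply, Matrix.sub_apply, Fin.sum_univ_two]; ring
  have key := fun c => SmoothFun.eq_zero_of_linear_system hW (n := 2) (s₀ := s₀)
    (u := fun j => smoothCoframe hg hm' c j - ((h : Matrix (Fin 2) (Fin 2) ℝ) c 0 •
      smoothCoframe hg hm 0 j + (h : Matrix (Fin 2) (Fin 2) ℝ) c 1 • smoothCoframe hg hm 1 j))
    (a := fun i j k => Γ k i j + (if k = j then a i else 0) + (if k = i then b j else 0))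
    (by
      intro i j
      simp only [map_sub, map_add, Derivation.map_smul, hb, hb', Fin.sum_univ_two]
      fin_cases i <;> fin_cases j <;> simp [Algebra.smul_def] <;> ring)
    (fun j => by
      have := hc s₀ c j
      rw [← hh, sub_self, Matrix.zero_mul] at this
      exact this)
  have hz : (m' s - (h : Matrix (Fin 2) (Fin 2) ℝ) * m s) * g s = 0 := by
    ext c j
    rw [← hc]
    exact DFunLike.congr_fun (key c j) ⟨s, hs⟩
  have hu := (hg.det_pos hs).ne'.isUnit
  have := congrArg (· * (g s)⁻¹) hz
  simp only [Matrix.mul_assoc, Matrix.mul_nonsing_inv _ hu, Matrix.mul_one, Matrix.zero_mul] at this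
  exact sub_eq_zero.1 this

/-- Finitely many continuous functions that vanish identically on no nonempty open subset of `O`
are all nowhere zero on some nonempty open subset. -/
theorem exists_open_forall_ne_zero {X ι : Type*} [TopologicalSpace X] (S : Finset ι)
    {δ : ι → X → ℝ} (hδ : ∀ p, Continuous (δ p)) {O : Set X} (hO : IsOpen O) (hne : O.Nonempty)
    (hd : ∀ p ∈ S, ∀ O' ⊆ O, IsOpen O' → O'.Nonempty → ∃ x ∈ O', δ p x ≠ 0) :
    ∃ O' ⊆ O, IsOpen O' ∧ O'.Nonempty ∧ ∀ p ∈ S, ∀ x ∈ O', δ p x ≠ 0 := by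
  classical
  induction S using Finset.induction_on with
  | empty => exact ⟨O, subset_rfl, hO, hne, by simp⟩
  | insert q S hq ih =>
    obtain ⟨O', hO', ho, hn, h'⟩ := ih fun p hp => hd p (Finset.mem_insert_of_mem hp)
    obtain ⟨x, hx, hqx⟩ := hd q (Finset.mem_insert_self _ _) O' hO' ho hn
    refine ⟨O' ∩ {x | δ q x ≠ 0}, Set.inter_subset_left.trans hO',
      ho.inter (isOpen_ne_fun (hδ q) continuous_const), ⟨x, hx, hqx⟩, fun p hp y hy => ?_⟩
    rcases Finset.mem_insert.1 hp with rfl | hp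
    exacts [hy.2, h' p hp y hy.1]

/-- Among seven normalized integrals near a point where the curvature is not critical, two lie in
one orbit of `SL₂(ℝ)`. -/
theorem exists_equivalent_of_seven (hW : Convex ℝ (W : Set (Fin 2 → ℝ)))
    (hg : IsRiemannianMetricOn g W) {s₁ : W}
    (hK : ∃ j, coGrad (smoothPartial W) (smoothMetric hg) (smoothCurvature hg) j s₁ ≠ 0)
    {m : Fin 7 → (Fin 2 → ℝ) → Matrix (Fin 2) (Fin 2) ℝ}
    (hm : ∀ i, IsFractionalLinearIntegralOn g W (m i)) (hdet : ∀ i, ∀ s ∈ W, (m i s).det = 1) :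
    ∃ i j, i ≠ j ∧ ∃ h : Matrix.SpecialLinearGroup (Fin 2) ℝ,
      ∀ s ∈ W, m j s = (h : Matrix (Fin 2) (Fin 2) ℝ) * m i s := by
  choose b w hb hbw using fun i => exists_integralForm hg (hm i) (hdet i)
  by_contra! hcon
  have hbne : ∀ i j, i ≠ j → b i ≠ b j := fun i j hij he => by
    obtain ⟨h, hh⟩ := exists_specialLinear_of_same_form hW hg (hm i) (hdet i) (hm j) (hdet j)
      (hb i) (by rw [he]; exact hb j) s₁
    obtain ⟨s, hs, hne⟩ := hcon i j hij h
    exact hne (hh s hs)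
  obtain ⟨j, hj⟩ := hK
  -- the seven functions `w` take distinct values at some point `s`
  obtain ⟨O, -, -, ⟨s, hs⟩, hO⟩ := exists_open_forall_ne_zero
    (Finset.univ.filter fun p : Fin 7 × Fin 7 => p.1 ≠ p.2)
    (δ := fun p s => w p.1 s - w p.2 s)
    (fun p => (w p.1).continuous.sub (w p.2).continuous)
    (isOpen_ne_fun (coGrad (smoothPartial W) (smoothMetric hg) (smoothCurvature hg) j).continuous
      continuous_const) ⟨s₁, hj⟩ (by
    rintro p hp O' hO' ho hn
    by_contra! hz
    exact hbne p.1 p.2 (by simpa using hp) ((hbw p.1).eq_of_eqOn hW hg (hbw p.2) ho hn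
      (fun s hs => ⟨j, hO' hs⟩) fun s hs => sub_eq_zero.1 (hz s hs)))
  obtain ⟨P, hP, hdeg, hroot⟩ := exists_polynomial_isRoot hg s
  have hinj : Function.Injective fun i => w i s := fun i k hik => by
    by_contra hne
    exact hO (i, k) (by simpa using hne) s hs (sub_eq_zero.2 hik)
  have hcard : (Finset.univ.image fun i => w i s).card ≤ P.natDegree :=
    P.card_le_degree_of_subset_roots fun x hx => by
      rw [Finset.mem_val] at hx
      obtain ⟨i, -, rfl⟩ := Finset.mem_image.1 hx
      exact (mem_roots hP).2 (hroot _ _ (hbw i))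
  rw [Finset.card_image_of_injective _ hinj] at hcard
  simp at hcard
  omega

end Orbits

/-! ### Operations on integrals -/

section Affine

variable {m m' : (Fin 2 → ℝ) → Matrix (Fin 2) (Fin 2) ℝ} {V : Set (Fin 2 → ℝ)} {s p : Fin 2 → ℝ}

/-- The Poisson bracket of `α I + β`, where `α` and `β` do not depend on the momentum. -/
theorem poissonBracket_affine (hV : IsOpen V) (hm : ∀ i j, ContDiffOn ℝ ∞ (fun s => m s i j) V)
    {α β : (Fin 2 → ℝ) → ℝ} (hα : ContDiffOn ℝ ∞ α V) (hβ : ContDiffOn ℝ ∞ β V)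
    (hm' : ∀ t ∈ V, ∀ r, (m t *ᵥ r) 1 ≠ 0 →
      fractionalLinear m' t r = α t * fractionalLinear m t r + β t)
    (H : (Fin 2 → ℝ) → (Fin 2 → ℝ) → ℝ) (hs : s ∈ V) (hp : (m s *ᵥ p) 1 ≠ 0) :
    poissonBracket (fractionalLinear m') H s p =
      α s * poissonBracket (fractionalLinear m) H s p +
      ((pderiv 0 α s * fractionalLinear m s p + pderiv 0 β s) * pderiv 0 (fun r => H s r) p +
      (pderiv 1 α s * fractionalLinear m s p + pderiv 1 β s) * pderiv 1 (fun r => H s r) p) := by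
  have dm := fun i j => (hm i j).differentiableAt_of_isOpen hV hs
  have dα := hα.differentiableAt_of_isOpen hV hs
  have dβ := hβ.differentiableAt_of_isOpen hV hs
  have e : ∀ t r c, (m t *ᵥ r) c = m t c 0 * r 0 + m t c 1 * r 1 := fun t r c => by
    simp [Matrix.mulVec, dotProduct, Fin.sum_univ_two]
  have dNt : ∀ c, DifferentiableAt ℝ (fun t => (m t *ᵥ p) c) s := fun c => by
    simp only [e]; fun_prop
  have dNr : ∀ c, DifferentiableAt ℝ (fun r => (m s *ᵥ r) c) p := fun c => by
    simp only [e]; fun_prop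
  have dt : DifferentiableAt ℝ (fun t => fractionalLinear m t p) s := by
    simp only [fractionalLinear, div_eq_mul_inv]
    exact (dNt 0).fun_mul ((dNt 1).fun_inv hp)
  have dr : DifferentiableAt ℝ (fun r => fractionalLinear m s r) p := by
    simp only [fractionalLinear, div_eq_mul_inv]
    exact (dNr 0).fun_mul ((dNr 1).fun_inv hp)
  have h1 : ∀ i, pderiv i (fun t => fractionalLinear m' t p) s =
      α s * pderiv i (fun t => fractionalLinear m t p) s + fractionalLinear m s p * pderiv i α s
      + pderiv i β s := fun i => by
    rw [← pderiv_mul dα dt, ← pderiv_add (dα.fun_mul dt) dβ]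
    refine pderiv_congr ?_ i
    filter_upwards [(dNt 1).continuousAt.eventually_ne hp, hV.mem_nhds hs] with t h1 h2
    exact hm' t h2 p h1
  have h2 : ∀ i, pderiv i (fun r => fractionalLinear m' s r) p =
      α s * pderiv i (fun r => fractionalLinear m s r) p := fun i => by
    rw [← add_zero (α s * _), ← pderiv_const (s := p) (β s) i, ← pderiv_const_mul dr,
      ← pderiv_add (dr.const_mul _) (differentiableAt_const _)]
    refine pderiv_congr ?_ i
    filter_upwards [(dNr 1).continuousAt.eventually_ne hp] with r h1
    exact hm' s hs r h1
  simp only [poissonBracket, Fin.sum_univ_two, h1, h2]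
  ring

variable {g : (Fin 2 → ℝ) → Matrix (Fin 2) (Fin 2) ℝ} {s₀ : Fin 2 → ℝ}

/-- A constant multiple of an integral is an integral, and a common factor of the coefficients does
not matter. -/
theorem IsFractionalLinearIntegralOn.rescale (hV : IsOpen V)
    (hm : IsFractionalLinearIntegralOn g V m) {σ : ℝ} (hσ : σ ≠ 0) {f : (Fin 2 → ℝ) → ℝ}
    (hf : ContDiffOn ℝ ∞ f V) (hf0 : ∀ s ∈ V, f s ≠ 0) :
    IsFractionalLinearIntegralOn g V
      (fun s => !![f s * σ * m s 0 0, f s * σ * m s 0 1; f s * m s 1 0, f s * m s 1 1]) := by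
  have e : ∀ t r c, (m t *ᵥ r) c = m t c 0 * r 0 + m t c 1 * r 1 := fun t r c => by
    simp [Matrix.mulVec, dotProduct, Fin.sum_univ_two]
  refine ⟨fun i j => ?_, fun s hs => ?_, fun s hs p hp => ?_⟩
  · fin_cases i <;> fin_cases j <;> simp
    exacts [(hf.mul contDiffOn_const).mul (hm.1 0 0), (hf.mul contDiffOn_const).mul (hm.1 0 1),
      hf.mul (hm.1 1 0), hf.mul (hm.1 1 1)]
  · have := hm.2.1 s hs
    rw [Matrix.det_fin_two] at this
    rw [Matrix.det_fin_two_of]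
    have h2 : f s * f s * σ * (m s 0 0 * m s 1 1 - m s 0 1 * m s 1 0) ≠ 0 :=
      mul_ne_zero (mul_ne_zero (mul_ne_zero (hf0 s hs) (hf0 s hs)) hσ) this
    convert h2 using 1; ring
  · have hp' : (m s *ᵥ p) 1 ≠ 0 := fun h0 => hp (by
      rw [e] at h0
      simp [Matrix.mulVec, dotProduct, Fin.sum_univ_two]
      linear_combination f s * h0)
    rw [poissonBracket_affine (α := fun _ => σ) (β := fun _ => 0) hV hm.1 contDiffOn_const
      contDiffOn_const (fun t ht r hr => ?_) _ hs hp', hm.2.2 s hs p hp']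
    · simp [pderiv_const]
    · have h0 := hf0 t ht
      rw [e] at hr
      simp only [fractionalLinear, e]
      simp [Matrix.mulVec, dotProduct, Fin.sum_univ_two]
      rw [show f t * m t 1 0 * r 0 + f t * m t 1 1 * r 1 = f t * (m t 1 0 * r 0 + m t 1 1 * r 1) by
        ring]
      field_simp

/-- An integral can be normalized near each point. -/
theorem localIntegrals_nonempty (h : AdmitsFractionalLinearIntegralAt g s₀) :
    (localIntegrals g s₀).Nonempty := by
  obtain ⟨V, hV, hs₀, m, hm⟩ := h
  have cdet : ContDiffOn ℝ ∞ (fun s => (m s).det) V := by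
    simp only [Matrix.det_fin_two]
    exact ((hm.1 0 0).mul (hm.1 1 1)).sub ((hm.1 0 1).mul (hm.1 1 0))
  obtain ⟨σ, hσ, hσ0⟩ : ∃ σ : ℝ, σ ^ 2 = 1 ∧ 0 < σ * (m s₀).det := by
    rcases lt_or_gt_of_ne (hm.2.1 s₀ hs₀) with h | h
    · exact ⟨-1, by norm_num, by linarith⟩
    · exact ⟨1, by norm_num, by linarith⟩
  have hV' : IsOpen (V ∩ {s | 0 < σ * (m s).det}) := by
    have := (continuousOn_const (c := σ).mul cdet.continuousOn).isOpen_inter_preimage hV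
      isOpen_Ioi (t := Set.Ioi 0)
    exact this
  set V' := V ∩ {s | 0 < σ * (m s).det}
  have hm' : IsFractionalLinearIntegralOn g V' m :=
    ⟨fun i j => (hm.1 i j).mono Set.inter_subset_left, fun s hs => hm.2.1 s hs.1,
      fun s hs => hm.2.2 s hs.1⟩
  have hσn : σ ≠ 0 := fun h0 => by simp [h0] at hσ
  refine ⟨_, V', hV', ⟨hs₀, hσ0⟩, hm'.rescale (f := fun s => (√(σ * (m s).det))⁻¹) hV' hσn ?_ ?_,
    fun s hs => ?_⟩
  · exact ((contDiffOn_const.mul (cdet.mono Set.inter_subset_left)).sqrt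
      fun s hs => hs.2.ne').inv fun s hs => (Real.sqrt_pos.2 hs.2).ne'
  · exact fun s hs => inv_ne_zero (Real.sqrt_pos.2 hs.2).ne'
  · have h2 := Real.sq_sqrt hs.2.le
    have h3 := (Real.sqrt_pos.2 hs.2).ne'
    rw [Matrix.det_fin_two_of]
    field_simp
    rw [h2, Matrix.det_fin_two]

/-- The cubic form in the velocity `v` whose vanishing expresses that `m` is an integral. -/
noncomputable def integralCubic (g m : (Fin 2 → ℝ) → Matrix (Fin 2) (Fin 2) ℝ)
    (s v : Fin 2 → ℝ) : ℝ :=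
  (coframe g m 1 0 s * v 0 + coframe g m 1 1 s * v 1) *
    (covCoframe g m 0 0 0 s * v 0 ^ 2 + (covCoframe g m 0 0 1 s + covCoframe g m 0 1 0 s)
      * (v 0 * v 1) + covCoframe g m 0 1 1 s * v 1 ^ 2)
  - (coframe g m 0 0 s * v 0 + coframe g m 0 1 s * v 1) *
    (covCoframe g m 1 0 0 s * v 0 ^ 2 + (covCoframe g m 1 0 1 s + covCoframe g m 1 1 0 s)
      * (v 0 * v 1) + covCoframe g m 1 1 1 s * v 1 ^ 2)

theorem IsFractionalLinearIntegralOn.mono {W : Set (Fin 2 → ℝ)}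
    (hm : IsFractionalLinearIntegralOn g V m) (h : W ⊆ V) : IsFractionalLinearIntegralOn g W m :=
  ⟨fun i j => (hm.1 i j).mono h, fun s hs => hm.2.1 s (h hs), fun s hs => hm.2.2 s (h hs)⟩

/-- The cubic form of an integral also vanishes where the denominator does. -/
theorem IsFractionalLinearIntegralOn.cubic_eq_zero (hV : IsOpen V) (hg : IsRiemannianMetricOn g V)
    (hm : IsFractionalLinearIntegralOn g V m) (hs : s ∈ V) (v : Fin 2 → ℝ) :
    integralCubic g m s v = 0 := by
  obtain ⟨a, ha⟩ := covariant_decomposition (ξ := fun c j => coframe g m c j s)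
    (T := fun c i j => covCoframe g m c i j s)
    (by rw [coframe_det]; exact mul_ne_zero (hm.2.1 s hs) (hg.det_pos hs).ne') (fun v hv => by
      have hv' : (m s *ᵥ (g s *ᵥ v)) 1 ≠ 0 := by
        convert hv using 1
        simp only [coframe, Matrix.mulVec, dotProduct, Fin.sum_univ_two]
        ring
      have h1 := poissonBracket_fractionalLinear hg hV hm.1 hs v hv'
      rw [hm.2.2 s hs _ hv', zero_mul] at h1
      exact h1.symm)
  obtain ⟨b, hab⟩ : ∃ b : Fin 2 → ℝ, ∀ c i k, covCoframe g m c i k s =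
      a i * coframe g m c k s + b k * coframe g m c i s := ⟨_, ha⟩
  simp only [integralCubic, hab]
  ring

theorem isFractionalLinearIntegralOn_of_cubic (hV : IsOpen V) (hg : IsRiemannianMetricOn g V)
    (hm : ∀ i j, ContDiffOn ℝ ∞ (fun s => m s i j) V) (hdet : ∀ s ∈ V, (m s).det ≠ 0)
    (h : ∀ s ∈ V, ∀ v, integralCubic g m s v = 0) : IsFractionalLinearIntegralOn g V m := by
  refine ⟨hm, hdet, fun s hs p hp => ?_⟩
  have hpv : g s *ᵥ ((g s)⁻¹ *ᵥ p) = p := by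
    rw [Matrix.mulVec_mulVec, Matrix.mul_nonsing_inv _ (hg.det_pos hs).ne'.isUnit,
      Matrix.one_mulVec]
  generalize (g s)⁻¹ *ᵥ p = v at hpv
  subst hpv
  have h1 := poissonBracket_fractionalLinear hg hV hm hs v hp
  rw [show _ - _ = (0 : ℝ) from h s hs v, mul_eq_zero] at h1
  refine h1.resolve_right (pow_ne_zero 2 ?_)
  convert hp using 1
  simp only [coframe, Matrix.mulVec, dotProduct, Fin.sum_univ_two]
  ring

/-- `SL₂(ℝ)` acts on the local integrals. -/
theorem localIntegrals_mul {U : Set (Fin 2 → ℝ)} (hU : IsOpen U) (hg : IsRiemannianMetricOn g U)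
    (hs₀ : s₀ ∈ U) (h : Matrix.SpecialLinearGroup (Fin 2) ℝ) (hm : m ∈ localIntegrals g s₀) :
    (fun s => (h : Matrix (Fin 2) (Fin 2) ℝ) * m s) ∈ localIntegrals g s₀ := by
  obtain ⟨V, hV, hsV, hI, hdet⟩ := hm
  have hVU := hV.inter hU
  have hg' := hg.mono (Set.inter_subset_right : V ∩ U ⊆ U)
  have hI' := hI.mono (Set.inter_subset_left : V ∩ U ⊆ V)
  have hdet' : ∀ s ∈ V ∩ U, ((h : Matrix (Fin 2) (Fin 2) ℝ) * m s).det = 1 := fun s hs => by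
    rw [Matrix.det_mul, hdet s hs.1, h.det_coe, one_mul]
  have hsm : ∀ i j, ContDiffOn ℝ ∞ (fun s => ((h : Matrix (Fin 2) (Fin 2) ℝ) * m s) i j)
      (V ∩ U) := fun i j => by
    simp only [Matrix.mul_apply, Fin.sum_univ_two]
    exact (contDiffOn_const.mul (hI'.1 0 j)).add (contDiffOn_const.mul (hI'.1 1 j))
  refine ⟨V ∩ U, hVU, ⟨hsV, hs₀⟩, isFractionalLinearIntegralOn_of_cubic hVU hg' hsm
    (fun s hs => by rw [hdet' s hs]; exact one_ne_zero) fun s hs v => ?_, hdet'⟩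
  have hdh : (h : Matrix (Fin 2) (Fin 2) ℝ) 0 0 * (h : Matrix (Fin 2) (Fin 2) ℝ) 1 1 -
      (h : Matrix (Fin 2) (Fin 2) ℝ) 0 1 * (h : Matrix (Fin 2) (Fin 2) ℝ) 1 0 = 1 := by
    rw [← Matrix.det_fin_two]; exact h.det_coe
  generalize (h : Matrix (Fin 2) (Fin 2) ℝ) = k at hdh
  have hc : ∀ c j, coframe g (fun s => k * m s) c j =
      fun s => k c 0 * coframe g m 0 j s + k c 1 * coframe g m 1 j s := fun c j => by
    funext s
    simp only [coframe, Matrix.mul_apply, Fin.sum_univ_two]; ring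
  have dc := fun c j => (contDiffOn_coframe hg' hI'.1 c j).differentiableAt_of_isOpen hVU hs
  have hT : ∀ c i j, covCoframe g (fun s => k * m s) c i j s =
      k c 0 * covCoframe g m 0 i j s + k c 1 * covCoframe g m 1 i j s := fun c i j => by
    simp only [covCoframe, hc]
    rw [pderiv_add ((dc _ _).const_mul _) ((dc _ _).const_mul _), pderiv_const_mul (dc _ _),
      pderiv_const_mul (dc _ _)]
    ring
  have h0 := hI'.cubic_eq_zero hVU hg' hs v
  rw [integralCubic] at h0
  simp only [integralCubic, hT, hc]
  linear_combination (k 0 0 * k 1 1 - k 0 1 * k 1 0) * h0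

end Affine

/-! ### Jets of integrals -/

section Jets

variable {k : ℕ} {s₀ : Fin 2 → ℝ} {m m' : (Fin 2 → ℝ) → Matrix (Fin 2) (Fin 2) ℝ}

/-- The index of the derivative of order zero among the coordinates of a jet. -/
def jetBase (k : ℕ) : Σ n : Fin (k + 1), (Fin n → Fin 2) := ⟨0, fun _ => 0⟩

/-- The value of a jet. -/
def jetValue (z : JetSpace k) : Matrix (Fin 2) (Fin 2) ℝ := Matrix.of (z (jetBase k))

/-- Left multiplication of a jet by a constant matrix. -/
def jetMul (h : Matrix (Fin 2) (Fin 2) ℝ) (z : JetSpace k) : JetSpace k :=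
  fun a i j => h i 0 * z a 0 j + h i 1 * z a 1 j

/-- The representative with value `1` of the `SL₂(ℝ)`-orbit of a jet with value in `SL₂(ℝ)`. -/
def normalizedJet (z : JetSpace k) : JetSpace k := jetMul (jetValue z).adjugate z

theorem jetMul_jetMul (h h' : Matrix (Fin 2) (Fin 2) ℝ) (z : JetSpace k) :
    jetMul h (jetMul h' z) = jetMul (h * h') z := by
  funext a i j
  simp only [jetMul, Matrix.mul_apply, Fin.sum_univ_two]; ring

theorem jetMul_one (z : JetSpace k) : jetMul 1 z = z := by
  funext a i j
  fin_cases i <;> simp [jetMul, Matrix.one_apply]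

theorem jetValue_jetMul (h : Matrix (Fin 2) (Fin 2) ℝ) (z : JetSpace k) :
    jetValue (jetMul h z) = h * jetValue z := by
  ext i j
  simp [jetValue, jetMul, Matrix.mul_apply, Fin.sum_univ_two]

theorem jetValue_jet : jetValue (jet k s₀ m) = m s₀ := by
  ext i j
  exact iteratedFDeriv_zero_apply (𝕜 := ℝ) (f := fun s => m s i j) (x := s₀)
    (fun _ : Fin 0 => Pi.single 0 1)

theorem jetMul_normalizedJet {z : JetSpace k} (hz : (jetValue z).det = 1) :
    jetMul (jetValue z) (normalizedJet z) = z := by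
  rw [normalizedJet, jetMul_jetMul, Matrix.mul_adjugate, hz, one_smul, jetMul_one]

theorem normalizedJet_jetMul {h : Matrix (Fin 2) (Fin 2) ℝ} (hh : h.det = 1) (z : JetSpace k) :
    normalizedJet (jetMul h z) = normalizedJet z := by
  rw [normalizedJet, jetMul_jetMul, jetValue_jetMul, Matrix.adjugate_mul_distrib, Matrix.mul_assoc,
    Matrix.adjugate_mul, hh, one_smul, Matrix.mul_one, normalizedJet]

/-- Iterated derivatives are linear in the function. -/
theorem iteratedFDeriv_linear_combination {n : ℕ} {p q : (Fin 2 → ℝ) → ℝ}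
    (hp : ContDiffAt ℝ n p s₀) (hq : ContDiffAt ℝ n q s₀) (α β : ℝ) (v : Fin n → Fin 2 → ℝ) :
    iteratedFDeriv ℝ n (fun s => α * p s + β * q s) s₀ v =
      α * iteratedFDeriv ℝ n p s₀ v + β * iteratedFDeriv ℝ n q s₀ v := by
  have e : iteratedFDeriv ℝ n (α • p + β • q) s₀ = _ :=
    iteratedFDeriv_add_apply (hp.const_smul α) (hq.const_smul β)
  rw [iteratedFDeriv_const_smul_apply hp, iteratedFDeriv_const_smul_apply hq] at e
  exact DFunLike.congr_fun e v

theorem jet_mul (hm : ∀ i j, ContDiffAt ℝ ∞ (fun s => m s i j) s₀)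
    (h : Matrix (Fin 2) (Fin 2) ℝ) : jet k s₀ (fun s => h * m s) = jetMul h (jet k s₀ m) := by
  funext a i j
  have hm' : ∀ i j, ContDiffAt ℝ (a.1 : ℕ) (fun s => m s i j) s₀ := fun i j =>
    (hm i j).of_le (WithTop.coe_le_coe.2 le_top)
  simp only [jet, jetMul, Matrix.mul_apply, Fin.sum_univ_two]
  exact iteratedFDeriv_linear_combination (hm' 0 j) (hm' 1 j) _ _ _

theorem jet_congr (h : m =ᶠ[𝓝 s₀] m') : jet k s₀ m = jet k s₀ m' := by
  funext a i j
  have : (fun s => m s i j) =ᶠ[𝓝 s₀] fun s => m' s i j := h.mono fun s hs => by simp [hs]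
  simp only [jet]
  rw [(this.iteratedFDeriv ℝ a.1).eq_of_nhds]

variable {g : (Fin 2 → ℝ) → Matrix (Fin 2) (Fin 2) ℝ}

theorem contDiffAt_of_mem_localIntegrals (hm : m ∈ localIntegrals g s₀) (i j : Fin 2) :
    ContDiffAt ℝ ∞ (fun s => m s i j) s₀ := by
  obtain ⟨V, hV, hs, hI, -⟩ := hm
  exact (hI.1 i j).contDiffAt (hV.mem_nhds hs)

theorem det_of_mem_localIntegrals (hm : m ∈ localIntegrals g s₀) : (m s₀).det = 1 := by
  obtain ⟨V, hV, hs, -, hdet⟩ := hm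
  exact hdet s₀ hs

/-- Finitely many local integrals live on a common ball in the domain of the metric. -/
theorem exists_common_ball {ι : Type*} [Finite ι] {U : Set (Fin 2 → ℝ)} (hU : IsOpen U)
    (hs₀ : s₀ ∈ U)
    {m : ι → (Fin 2 → ℝ) → Matrix (Fin 2) (Fin 2) ℝ} (hm : ∀ i, m i ∈ localIntegrals g s₀) :
    ∃ W : TopologicalSpace.Opens (Fin 2 → ℝ), s₀ ∈ W ∧ Convex ℝ (W : Set (Fin 2 → ℝ)) ∧
      (W : Set (Fin 2 → ℝ)) ⊆ U ∧ (∀ i, IsFractionalLinearIntegralOn g W (m i)) ∧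
      ∀ i, ∀ s ∈ W, (m i s).det = 1 := by
  choose V hV hsV hI hdet using hm
  have hn : (⋂ i, V i) ∩ U ∈ 𝓝 s₀ :=
    Filter.inter_mem (Filter.iInter_mem.2 fun i => (hV i).mem_nhds (hsV i)) (hU.mem_nhds hs₀)
  obtain ⟨ε, hε, hball⟩ := Metric.mem_nhds_iff.1 hn
  have hsub : ∀ i, Metric.ball s₀ ε ⊆ V i := fun i =>
    (hball.trans Set.inter_subset_left).trans (Set.iInter_subset V i)
  exact ⟨⟨Metric.ball s₀ ε, Metric.isOpen_ball⟩, Metric.mem_ball_self hε, convex_ball _ _,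
    hball.trans Set.inter_subset_right, fun i => (hI i).mono (hsub i),
    fun i s hs => hdet i s (hsub i hs)⟩

theorem pderiv_eq_of_jet_eq (h : jet 2 s₀ m = jet 2 s₀ m') (i c j : Fin 2) :
    pderiv i (fun s => m s c j) s₀ = pderiv i (fun s => m' s c j) s₀ := by
  have := congrFun (congrFun (congrFun h ⟨1, fun _ => i⟩) c) j
  simp only [jet] at this
  simpa [pderiv] using this

theorem pderiv_pderiv_eq_of_jet_eq (h : jet 2 s₀ m = jet 2 s₀ m')
    (hm : ∀ i j, ContDiffAt ℝ ∞ (fun s => m s i j) s₀)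
    (hm' : ∀ i j, ContDiffAt ℝ ∞ (fun s => m' s i j) s₀) (l i c j : Fin 2) :
    pderiv l (pderiv i (fun s => m s c j)) s₀ = pderiv l (pderiv i (fun s => m' s c j)) s₀ := by
  have := congrFun (congrFun (congrFun h ⟨2, ![l, i]⟩) c) j
  rw [pderiv_pderiv ((hm c j).of_le (WithTop.coe_le_coe.2 le_top)),
    pderiv_pderiv ((hm' c j).of_le (WithTop.coe_le_coe.2 le_top))]
  simpa [jet, iteratedFDeriv_two_apply] using this

open TopologicalSpace in
/-- The value at a point of the pair `(b, w)` of an integral depends only on its `2`-jet. -/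
theorem integralForm_eq_at {W : Opens (Fin 2 → ℝ)} (hg : IsRiemannianMetricOn g W)
    (hI : IsFractionalLinearIntegralOn g W m) (hI' : IsFractionalLinearIntegralOn g W m')
    (hdet : ∀ s ∈ W, (m s).det = 1) {b b' : Fin 2 → SmoothFun W} {w w' : SmoothFun W}
    (hb : ∀ c i j, smoothPartial W i (smoothCoframe hg hI c j) =
      smoothChristoffel hg 0 i j * smoothCoframe hg hI c 0
      + smoothChristoffel hg 1 i j * smoothCoframe hg hI c 1
      + ((1 / 2 : ℝ) • (christoffelTrace (smoothChristoffel hg) i - b i))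
        * smoothCoframe hg hI c j + b j * smoothCoframe hg hI c i)
    (hb' : ∀ c i j, smoothPartial W i (smoothCoframe hg hI' c j) =
      smoothChristoffel hg 0 i j * smoothCoframe hg hI' c 0
      + smoothChristoffel hg 1 i j * smoothCoframe hg hI' c 1
      + ((1 / 2 : ℝ) • (christoffelTrace (smoothChristoffel hg) i - b' i))
        * smoothCoframe hg hI' c j + b' j * smoothCoframe hg hI' c i)
    (hbw : IsIntegralForm (smoothPartial W) (smoothChristoffel hg) (smoothMetric hg)
      (smoothCurvature hg) b w)
    (hbw' : IsIntegralForm (smoothPartial W) (smoothChristoffel hg) (smoothMetric hg)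
      (smoothCurvature hg) b' w') {S : W} {d : Fin 2 → Fin 2 → SmoothFun W}
    (hd : ∀ c j, d c j = smoothRestrict _ (hI.1 c j) - smoothRestrict _ (hI'.1 c j))
    (d0 : ∀ c j, d c j S = 0) (d1 : ∀ i c j, smoothPartial W i (d c j) S = 0)
    (d2 : ∀ l i c j, smoothPartial W l (smoothPartial W i (d c j)) S = 0) :
    (∀ i, b i S = b' i S) ∧ w S = w' S := by
  -- the difference of the coframes vanishes to second order
  obtain ⟨x, hxdef⟩ : ∃ x : Fin 2 → Fin 2 → SmoothFun W, ∀ c j, x c j = smoothCoframe hg hI c j -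
    smoothCoframe hg hI' c j := ⟨_, fun _ _ => rfl⟩
  have hx : ∀ c j, x c j = d c 0 * smoothMetric hg 0 j + d c 1 * smoothMetric hg 1 j :=
    fun c j => DFunLike.ext _ _ fun s => by
      simp only [hxdef, hd, smoothCoframe, smoothMetric, coframe, SmoothFun.add_apply,
        SmoothFun.sub_apply, SmoothFun.mul_apply, smoothRestrict_apply]
      ring
  have x0 : ∀ c j, x c j S = 0 := fun c j => by simp [hx, d0]
  have x1 : ∀ i c j, smoothPartial W i (x c j) S = 0 := fun i c j => by simp [hx, d0, d1]
  have x2 : ∀ l i c j, smoothPartial W l (smoothPartial W i (x c j)) S = 0 := fun l i c j => by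
    simp [hx, d0, d1, d2]
  -- the diagonal equations express `b - b'` through `x` and its first derivatives
  have hy : ∀ i c, (b i - b' i) * smoothCoframe hg hI c i =
      2 * (smoothPartial W i (x c i) - smoothChristoffel hg 0 i i * x c 0
        - smoothChristoffel hg 1 i i * x c 1)
      - christoffelTrace (smoothChristoffel hg) i * x c i - b' i * x c i := fun i c => by
    simp only [hxdef, map_sub, hb, hb']
    refine DFunLike.ext _ _ fun s => ?_
    simp only [SmoothFun.add_apply, SmoothFun.sub_apply, SmoothFun.mul_apply,
      SmoothFun.smul_apply, SmoothFun.ofNat_apply]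
    ring
  have hne : ∀ i, ∃ c, smoothCoframe hg hI c i S ≠ 0 := fun i => by
    by_contra! hcon
    have h0 : coframe g m 0 i S = 0 := hcon 0
    have h1 : coframe g m 1 i S = 0 := hcon 1
    have hd := coframe_det (g := g) (m := m) S
    rw [hdet S S.2, one_mul] at hd
    refine (hg.det_pos S.2).ne' ?_
    rw [← hd]
    fin_cases i <;> simp only [Fin.zero_eta, Fin.mk_one] at h0 h1 <;> rw [h0, h1] <;> ring
  have hbS : ∀ i, b i S = b' i S := fun i => by
    obtain ⟨c, hc⟩ := hne i
    have := DFunLike.congr_fun (hy i c) S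
    simp only [SmoothFun.sub_apply, SmoothFun.mul_apply, x0, x1] at this
    simp only [mul_zero, sub_zero, mul_eq_zero, hc, or_false] at this
    exact sub_eq_zero.1 this
  have hbD : ∀ l i, smoothPartial W l (b i) S = smoothPartial W l (b' i) S := fun l i => by
    obtain ⟨c, hc⟩ := hne i
    have := DFunLike.congr_fun (congrArg (smoothPartial W l) (hy i c)) S
    simp only [map_sub, Derivation.leibniz, smul_eq_mul, SmoothFun.sub_apply, SmoothFun.add_apply,
      SmoothFun.mul_apply, x0, x1, x2, hbS] at this
    simp only [mul_zero, zero_mul, sub_self, add_zero, zero_add, mul_eq_zero, hc,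
      false_or] at this
    exact sub_eq_zero.1 this
  refine ⟨hbS, ?_⟩
  have := hbD 0 1
  rw [hbw.d01, hbw'.d01] at this
  simp only [SmoothFun.add_apply, SmoothFun.mul_apply, hbS] at this
  linarith

/-- The germ of a local integral is determined by its `2`-jet. -/
theorem eventuallyEq_of_jet_eq {U : Set (Fin 2 → ℝ)} (hU : IsOpen U)
    (hg : IsRiemannianMetricOn g U) (hs₀ : s₀ ∈ U) (hm : m ∈ localIntegrals g s₀)
    (hm' : m' ∈ localIntegrals g s₀) (h : jet 2 s₀ m = jet 2 s₀ m') : m =ᶠ[𝓝 s₀] m' := by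
  obtain ⟨W, hsW, hW, hWU, hI, hdet⟩ := exists_common_ball (m := ![m, m']) hU hs₀ (by
    intro i; fin_cases i; exacts [hm, hm'])
  have hgW := hg.mono hWU
  have hIm : IsFractionalLinearIntegralOn g W m := hI 0
  have hIm' : IsFractionalLinearIntegralOn g W m' := hI 1
  have hdm : ∀ s ∈ W, (m s).det = 1 := hdet 0
  have hdm' : ∀ s ∈ W, (m' s).det = 1 := hdet 1
  obtain ⟨b, w, hb, hbw⟩ := exists_integralForm hgW hIm hdm
  obtain ⟨b', w', hb', hbw'⟩ := exists_integralForm hgW hIm' hdm'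
  have hval : m s₀ = m' s₀ := by
    have := congrArg jetValue h
    rwa [jetValue_jet, jetValue_jet] at this
  obtain ⟨hbS, hwS⟩ := integralForm_eq_at hgW hIm hIm' hdm hb hb' hbw hbw' (S := ⟨s₀, hsW⟩)
    (fun _ _ => rfl) (fun c j => sub_eq_zero.2 (congrFun (congrFun hval c) j))
    (fun i c j => by
      simp only [map_sub, smoothPartial_restrict]
      exact sub_eq_zero.2 (pderiv_eq_of_jet_eq h i c j))
    (fun l i c j => by
      simp only [map_sub, smoothPartial_restrict]
      exact sub_eq_zero.2 (pderiv_pderiv_eq_of_jet_eq h (contDiffAt_of_mem_localIntegrals hm)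
        (contDiffAt_of_mem_localIntegrals hm') l i c j))
  obtain ⟨k, hk⟩ := exists_specialLinear_of_same_form hW hgW hIm hdm hIm' hdm' hb
    (by rw [(hbw.eq_of_eq_at hW hgW hbw' hbS hwS).1]; exact hb') ⟨s₀, hsW⟩
  have hk1 : (k : Matrix (Fin 2) (Fin 2) ℝ) = 1 := by
    have h1 := hk s₀ hsW
    have hu : IsUnit (m s₀).det := by rw [hdm s₀ hsW]; exact isUnit_one
    rw [← hval] at h1
    have := congrArg (· * (m s₀)⁻¹) h1
    simp only [Matrix.mul_assoc, Matrix.mul_nonsing_inv _ hu, Matrix.mul_one] at this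
    exact this.symm
  filter_upwards [W.isOpen.mem_nhds hsW] with s hs
  rw [hk s hs, hk1, one_mul]

end Jets

/-! ### Local integrals in nonconstant curvature -/

section NonconstantCurvature

variable {k : ℕ} {s₀ : Fin 2 → ℝ} {m m' : (Fin 2 → ℝ) → Matrix (Fin 2) (Fin 2) ℝ}
  {g : (Fin 2 → ℝ) → Matrix (Fin 2) (Fin 2) ℝ} {U : Set (Fin 2 → ℝ)}

/-- If the curvature is not constant near `s₀`, then it has noncritical points in every
convex neighbourhood. -/
theorem exists_coGrad_ne_zero {W : TopologicalSpace.Opens (Fin 2 → ℝ)} (hs₀ : s₀ ∈ W)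
    (hW : Convex ℝ (W : Set (Fin 2 → ℝ))) (hg : IsRiemannianMetricOn g W)
    (hK : ¬ IsConstantNear (gaussianCurvature g) s₀) :
    ∃ s : W, ∃ j, coGrad (smoothPartial W) (smoothMetric hg) (smoothCurvature hg) j s ≠ 0 := by
  by_contra! hcon
  have cK := hg.contDiffOn_gaussianCurvature W.isOpen
  have h0 : ∀ s ∈ W, ∀ i, pderiv i (gaussianCurvature g) s = 0 := fun s hs => by
    have e0 := hcon ⟨s, hs⟩ 0
    have e1 := hcon ⟨s, hs⟩ 1
    have hd := (hg.det_pos hs).ne'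
    rw [Matrix.det_fin_two] at hd
    simp only [coGrad, smoothCurvature, smoothMetric, smoothPartial_restrict,
      SmoothFun.sub_apply, SmoothFun.mul_apply, smoothRestrict_apply] at e0 e1
    intro i
    refine (mul_eq_zero.1 ?_).resolve_right hd
    fin_cases i <;> simp only [Fin.zero_eta, Fin.mk_one]
    · linear_combination g s 0 0 * e1 - g s 0 1 * e0
    · linear_combination g s 1 0 * e1 - g s 1 1 * e0
  refine hK ⟨gaussianCurvature g s₀, ?_⟩
  filter_upwards [W.isOpen.mem_nhds hs₀] with s hs
  refine W.isOpen.is_const_of_fderiv_eq_zero (𝕜 := ℝ) hW.isPreconnected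
    (cK.differentiableOn (by simp)) (fun t ht => ?_) hs hs₀
  ext v
  rw [fderiv_eq_sum_pderiv]
  simp [h0 t ht]

/-- Two local integrals lie in one orbit if and only if their `2`-jets have the same
normalization. -/
theorem normalizedJet_eq_iff (hU : IsOpen U) (hg : IsRiemannianMetricOn g U) (hs₀ : s₀ ∈ U)
    (hm : m ∈ localIntegrals g s₀) (hm' : m' ∈ localIntegrals g s₀) :
    normalizedJet (jet 2 s₀ m) = normalizedJet (jet 2 s₀ m') ↔ MoebiusEquivalentAt s₀ m m' := by
  constructor
  · intro h
    have d : (m' s₀ * (m s₀).adjugate).det = 1 := by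
      rw [Matrix.det_mul, Matrix.det_adjugate, det_of_mem_localIntegrals hm,
        det_of_mem_localIntegrals hm']
      simp
    refine ⟨⟨_, d⟩, eventuallyEq_of_jet_eq hU hg hs₀ hm' (localIntegrals_mul hU hg hs₀ ⟨_, d⟩ hm) ?_⟩
    rw [jet_mul (contDiffAt_of_mem_localIntegrals hm)]
    simp only [← jetMul_jetMul]
    have e := jetMul_normalizedJet (z := jet 2 s₀ m')
      (by rw [jetValue_jet, det_of_mem_localIntegrals hm'])
    rw [← h, normalizedJet, jetValue_jet, jetValue_jet] at e
    exact e.symm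
  · rintro ⟨h, hh⟩
    rw [jet_congr hh, jet_mul (contDiffAt_of_mem_localIntegrals hm), normalizedJet_jetMul h.det_coe]

/-- There are at most six orbits, since two of any seven local integrals are equivalent. -/
theorem finite_normalizedJet (hU : IsOpen U) (hg : IsRiemannianMetricOn g U) (hs₀ : s₀ ∈ U)
    (hK : ¬ IsConstantNear (gaussianCurvature g) s₀) :
    (normalizedJet '' (jet 2 s₀ '' localIntegrals g s₀)).Finite := by
  by_contra hinf
  let f := (Set.Infinite.natEmbedding _ hinf)
  have hf : ∀ i : Fin 7, ∃ m ∈ localIntegrals g s₀, normalizedJet (jet 2 s₀ m) = f i := fun i => by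
    obtain ⟨_, ⟨m, hm, rfl⟩, h⟩ := (f i).2
    exact ⟨m, hm, h⟩
  choose m hm hmf using hf
  obtain ⟨W, hsW, hW, hWU, hI, hdet⟩ := exists_common_ball hU hs₀ hm
  have hgW := hg.mono hWU
  obtain ⟨s₁, hs₁⟩ := exists_coGrad_ne_zero hsW hW hgW hK
  obtain ⟨i, j, hij, h, hh⟩ := exists_equivalent_of_seven hW hgW hs₁ hI hdet
  have := (normalizedJet_eq_iff hU hg hs₀ (hm i) (hm j)).2 ⟨h, by
    filter_upwards [W.isOpen.mem_nhds hsW] with s hs using hh s hs⟩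
  rw [hmf, hmf] at this
  exact hij (Fin.ext (f.injective (Subtype.ext this)))

theorem finite_orbits (hU : IsOpen U) (hg : IsRiemannianMetricOn g U) (hs₀ : s₀ ∈ U)
    (hK : ¬ IsConstantNear (gaussianCurvature g) s₀) :
    ∃ T : Set ((Fin 2 → ℝ) → Matrix (Fin 2) (Fin 2) ℝ), T.Finite ∧ T ⊆ localIntegrals g s₀ ∧
      ∀ m ∈ localIntegrals g s₀, ∃ t ∈ T, MoebiusEquivalentAt s₀ t m := by
  have hfin := finite_normalizedJet hU hg hs₀ hK
  rw [Set.image_image] at hfin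
  obtain ⟨T, hT, hTb⟩ := (Set.surjOn_image _ _).exists_bijOn_subset
  refine ⟨T, hTb.finite_iff_finite.2 hfin, hT, fun m hm => ?_⟩
  obtain ⟨t, ht, he⟩ := hTb.surjOn ⟨m, hm, rfl⟩
  exact ⟨t, ht, (normalizedJet_eq_iff hU hg hs₀ (hT ht) hm).1 he⟩

theorem continuous_normalizedJet : Continuous (normalizedJet (k := k)) := by
  unfold normalizedJet jetMul jetValue
  simp only [Matrix.adjugate_fin_two, Matrix.of_apply, Matrix.cons_val', Matrix.cons_val_zero,
    Matrix.cons_val_one]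
  refine continuous_pi fun a => continuous_pi fun i => continuous_pi fun j => ?_
  fin_cases i <;> simp <;> fun_prop

/-- The jets whose normalization is that of `z`, or is not one of the finitely many in `ν`, form an
open set. -/
theorem isOpen_normalizedJet {ν : Set (JetSpace k)} (hν : ν.Finite) (z : JetSpace k) :
    IsOpen {z' | normalizedJet z' ∉ ν \ {normalizedJet z}} :=
  (hν.subset Set.sdiff_subset).isClosed.isOpen_compl.preimage continuous_normalizedJet

theorem locally_one_orbit (hU : IsOpen U) (hg : IsRiemannianMetricOn g U) (hs₀ : s₀ ∈ U)
    (hK : ¬ IsConstantNear (gaussianCurvature g) s₀) (hm : m ∈ localIntegrals g s₀) :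
    ∃ O : Set (JetSpace 2), IsOpen O ∧ jet 2 s₀ m ∈ O ∧
      ∀ m' ∈ localIntegrals g s₀, jet 2 s₀ m' ∈ O → MoebiusEquivalentAt s₀ m m' := by
  refine ⟨_, isOpen_normalizedJet (finite_normalizedJet hU hg hs₀ hK) (jet 2 s₀ m),
    fun h => h.2 rfl, fun m' hm' h => ?_⟩
  refine (normalizedJet_eq_iff hU hg hs₀ hm hm').1 ?_
  by_contra hne
  exact h ⟨⟨_, ⟨m', hm', rfl⟩, rfl⟩, fun h' => hne h'.symm⟩

/-- The chart of `SL₂(ℝ)` on the open set where the upper left entry is positive. -/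
noncomputable def specialLinearChart (w : EuclideanSpace ℝ (Fin 3)) : Matrix (Fin 2) (Fin 2) ℝ :=
  !![w 0, w 1; w 2, (1 + w 1 * w 2) / w 0]

theorem det_specialLinearChart {w : EuclideanSpace ℝ (Fin 3)} (hw : 0 < w 0) :
    (specialLinearChart w).det = 1 := by
  rw [specialLinearChart, Matrix.det_fin_two_of]
  field_simp
  ring

/-- A set of jets with value in `SL₂(ℝ)` that is a finite union of `SL₂(ℝ)`-orbits is a
three-dimensional submanifold: each orbit is a copy of `SL₂(ℝ)`, and the orbits are separated by
the normalization of jets. -/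
theorem isSmoothSubmanifold_of_finite_orbits {J : Set (JetSpace k)}
    (hdet : ∀ z ∈ J, (jetValue z).det = 1)
    (hmul : ∀ h : Matrix (Fin 2) (Fin 2) ℝ, h.det = 1 → ∀ z ∈ J, jetMul h z ∈ J)
    (hfin : (normalizedJet '' J).Finite) : IsSmoothSubmanifold 3 J := by
  intro z hz
  have hzd := hdet z hz
  have cX : ∀ i j, ContDiff ℝ ∞ fun z' : JetSpace k =>
      (jetValue z' * (jetValue z).adjugate) i j := fun i j => by
    simp only [Matrix.mul_apply, Fin.sum_univ_two, jetValue, Matrix.of_apply]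
    fun_prop
  have hφX : ∀ h : Matrix (Fin 2) (Fin 2) ℝ,
      jetValue (jetMul h z) * (jetValue z).adjugate = h := fun h => by
    rw [jetValue_jetMul, Matrix.mul_assoc, Matrix.mul_adjugate, hzd, one_smul, Matrix.mul_one]
  refine ⟨{z' | normalizedJet z' ∉ normalizedJet '' J \ {normalizedJet z}} ∩
    {z' | 0 < (jetValue z' * (jetValue z).adjugate) 0 0}, {w | 0 < w 0},
    fun w => jetMul (specialLinearChart w) z,
    -- the inverse of the chart, applied to the element of `SL₂(ℝ)` that carries `z` to `z'`
    fun z' => !₂[(jetValue z' * (jetValue z).adjugate) 0 0,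
      (jetValue z' * (jetValue z).adjugate) 0 1, (jetValue z' * (jetValue z).adjugate) 1 0],
    (isOpen_normalizedJet hfin z).inter (isOpen_lt continuous_const (cX 0 0).continuous),
    ⟨fun h => h.2 rfl, ?_⟩, isOpen_lt continuous_const (by fun_prop), ?_, ?_, ?_, ?_⟩
  · rw [Set.mem_ofPred_eq, Matrix.mul_adjugate, hzd]
    simp
  · refine contDiffOn_pi.2 fun a => contDiffOn_pi.2 fun i => contDiffOn_pi.2 fun j => ?_
    have c : ∀ l, ContDiffOn ℝ ∞ (fun w : EuclideanSpace ℝ (Fin 3) => w l) {w | 0 < w 0} :=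
      fun l => by fun_prop
    have c3 : ContDiffOn ℝ ∞ (fun w : EuclideanSpace ℝ (Fin 3) => (1 + w 1 * w 2) / w 0)
      {w | 0 < w 0} := (contDiffOn_const.add ((c 1).mul (c 2))).div (c 0) fun w hw => ne_of_gt hw
    fin_cases i
    · exact ((c 0).mul contDiffOn_const).add ((c 1).mul contDiffOn_const)
    · exact ((c 2).mul contDiffOn_const).add (c3.mul contDiffOn_const)
  · refine ContDiff.contDiffOn (contDiff_euclidean.2 fun i => ?_)
    fin_cases i
    exacts [cX 0 0, cX 0 1, cX 1 0]
  · ext z'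
    constructor
    · rintro ⟨w, hw, rfl⟩
      refine ⟨hmul _ (det_specialLinearChart hw) z hz, fun h => h.2 ?_, ?_⟩
      · exact normalizedJet_jetMul (det_specialLinearChart hw) z
      · rw [Set.mem_ofPred_eq, hφX]
        exact hw
    · rintro ⟨hz', hN, hpos⟩
      have hNz : normalizedJet z' = normalizedJet z := by
        by_contra hne
        exact hN ⟨⟨z', hz', rfl⟩, hne⟩
      have hX : specialLinearChart !₂[(jetValue z' * (jetValue z).adjugate) 0 0,
          (jetValue z' * (jetValue z).adjugate) 0 1,
          (jetValue z' * (jetValue z).adjugate) 1 0] =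
          jetValue z' * (jetValue z).adjugate := by
        have hd : (jetValue z' * (jetValue z).adjugate).det = 1 := by
          rw [Matrix.det_mul, Matrix.det_adjugate, hdet z' hz', hzd]
          simp
        rw [Set.mem_ofPred_eq] at hpos
        generalize jetValue z' * (jetValue z).adjugate = X at hd hpos
        rw [Matrix.det_fin_two] at hd
        ext i j
        fin_cases i <;> fin_cases j <;> simp [specialLinearChart]
        field_simp
        linarith
      refine ⟨!₂[(jetValue z' * (jetValue z).adjugate) 0 0,
        (jetValue z' * (jetValue z).adjugate) 0 1,
        (jetValue z' * (jetValue z).adjugate) 1 0], hpos, ?_⟩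
      beta_reduce
      rw [hX, ← jetMul_jetMul]
      change jetMul _ (normalizedJet z) = z'
      rw [← hNz, jetMul_normalizedJet (hdet z' hz')]
  · intro w hw
    beta_reduce
    rw [hφX]
    ext i
    fin_cases i <;> simp [specialLinearChart]

theorem hasLocalDimension_three (hU : IsOpen U) (hg : IsRiemannianMetricOn g U) (hs₀ : s₀ ∈ U)
    (hint : AdmitsFractionalLinearIntegralAt g s₀)
    (hK : ¬ IsConstantNear (gaussianCurvature g) s₀) :
    HasLocalDimension s₀ (localIntegrals g s₀) 3 := by
  refine ⟨2, fun m hm m' hm' => eventuallyEq_of_jet_eq hU hg hs₀ hm hm',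
    (localIntegrals_nonempty hint).image _, isSmoothSubmanifold_of_finite_orbits ?_ ?_
      (finite_normalizedJet hU hg hs₀ hK)⟩
  · rintro _ ⟨m, hm, rfl⟩
    rw [jetValue_jet, det_of_mem_localIntegrals hm]
  · rintro h hh _ ⟨m, hm, rfl⟩
    exact ⟨_, localIntegrals_mul hU hg hs₀ ⟨h, hh⟩ hm,
      jet_mul (contDiffAt_of_mem_localIntegrals hm) h⟩

end NonconstantCurvature

/-! ### Potentials, slices and dimension -/

section Potential

open TopologicalSpace

variable {W : Opens (Fin 2 → ℝ)}

/-- The Poincaré lemma: a closed `1`-form on a convex open set has a potential. -/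
theorem SmoothFun.exists_potential (hW : Convex ℝ (W : Set (Fin 2 → ℝ))) (S : W)
    {p : Fin 2 → SmoothFun W} (hp : smoothPartial W 0 (p 1) = smoothPartial W 1 (p 0)) :
    ∃ f : SmoothFun W, (∀ i, smoothPartial W i f = p i) ∧ f S = 0 := by
  let θ : (Fin 2 → ℝ) → (Fin 2 → ℝ) →L[ℝ] ℝ := fun a =>
    zeroExt (p 0) a • ContinuousLinearMap.proj 0 + zeroExt (p 1) a • ContinuousLinearMap.proj 1
  have cθ : ContDiffOn ℝ ∞ θ W := by
    have c := fun i => contDiffOn_zeroExt (p i)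
    exact ContDiffOn.add (ContDiffOn.smul (c 0) contDiffOn_const)
      (ContDiffOn.smul (c 1) contDiffOn_const)
  have hθ : ∀ a ∈ W, ∀ x y, fderiv ℝ θ a x y = fderiv ℝ θ a y x := fun a ha x y => by
    have d := fun i => (contDiffOn_zeroExt (p i)).differentiableAt_of_isOpen W.isOpen ha
    have e : ∀ x y, fderiv ℝ θ a x y =
        fderiv ℝ (zeroExt (p 0)) a x * y 0 + fderiv ℝ (zeroExt (p 1)) a x * y 1 := fun x y => by
      have h0 := (d 0).hasFDerivAt.smul_const
        (ContinuousLinearMap.proj (R := ℝ) (φ := fun _ : Fin 2 => ℝ) 0)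
      have h1 := (d 1).hasFDerivAt.smul_const
        (ContinuousLinearMap.proj (R := ℝ) (φ := fun _ : Fin 2 => ℝ) 1)
      have h : HasFDerivAt θ _ a := h0.add h1
      rw [h.fderiv]
      simp
    have hpa := DFunLike.congr_fun hp ⟨a, ha⟩
    rw [smoothPartial_apply, smoothPartial_apply] at hpa
    simp only [e, fderiv_eq_sum_pderiv]
    linear_combination (x 0 * y 1 - x 1 * y 0) * hpa
  obtain ⟨f, hf⟩ := hW.exists_forall_hasFDerivAt_of_fderiv_symmetric W.isOpen
    (cθ.differentiableOn (by simp)) hθ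
  have cf : ContDiffOn ℝ ∞ (fun s => f s - f S) W := by
    refine ContDiffOn.sub ((contDiffOn_infty_iff_fderiv_of_isOpen W.isOpen).2 ⟨fun a ha =>
      (hf a ha).differentiableAt.differentiableWithinAt, cθ.congr fun a ha => (hf a ha).fderiv⟩)
      contDiffOn_const
  refine ⟨smoothRestrict _ cf, fun i => DFunLike.ext _ _ fun s => ?_, sub_self _⟩
  rw [smoothPartial_restrict, smoothRestrict_apply, pderiv, ((hf s s.2).sub_const _).fderiv]
  fin_cases i <;> simp [θ, zeroExt_apply]

theorem SmoothFun.exists_exp (f : SmoothFun W) :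
    ∃ φ : SmoothFun W, (∀ s, 0 < φ s) ∧
      ∀ i, smoothPartial W i φ = φ * smoothPartial W i f := by
  have c : ContDiffOn ℝ ∞ (fun s => Real.exp (zeroExt f s)) W := (contDiffOn_zeroExt f).exp
  refine ⟨smoothRestrict _ c, fun s => Real.exp_pos _, fun i => DFunLike.ext _ _ fun s => ?_⟩
  have d := (contDiffOn_zeroExt f).differentiableAt_of_isOpen W.isOpen s.2
  rw [smoothPartial_restrict, SmoothFun.mul_apply, smoothRestrict_apply, smoothRestrict_apply,
    smoothPartial_apply, pderiv, fderiv_exp d]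
  rfl

end Potential

section ConstantCurvature

variable {s₀ : Fin 2 → ℝ} {m : (Fin 2 → ℝ) → Matrix (Fin 2) (Fin 2) ℝ}
  {g : (Fin 2 → ℝ) → Matrix (Fin 2) (Fin 2) ℝ}

open TopologicalSpace in
/-- In constant curvature the coframe of an integral becomes closed after rescaling, because the
curvature `w` of the `1`-form `b` vanishes. -/
theorem exists_coframe_potential {W : Opens (Fin 2 → ℝ)} (hW : Convex ℝ (W : Set (Fin 2 → ℝ)))
    (hg : IsRiemannianMetricOn g W) (hm : IsFractionalLinearIntegralOn g W m)
    (hdet : ∀ s ∈ W, (m s).det = 1) (hK : ∀ i, smoothPartial W i (smoothCurvature hg) = 0)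
    (S : W) :
    ∃ φ : SmoothFun W, (∀ s, 0 < φ s) ∧ ∀ c, ∃ P : SmoothFun W,
      (∀ i, smoothPartial W i P = φ * smoothCoframe hg hm c i) ∧ P S = 0 := by
  obtain ⟨b, w, hb, hbw⟩ := exists_integralForm hg hm hdet
  have hL := isLeviCivita_smooth hg
  have hw : w = 0 := by
    have h := hbw.constraint hL
    refine DFunLike.ext _ _ fun s => ?_
    have hs := DFunLike.congr_fun h s
    simpa [coLap, coGrad, hK] using hs
  have hbc : smoothPartial W 0 (b 1) = smoothPartial W 1 (b 0) := by
    rw [hbw.d01, hbw.d10, hw]; ring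
  -- a logarithm of the factor by which the coframe is rescaled
  obtain ⟨f, hf, -⟩ := SmoothFun.exists_potential hW S
    (p := fun i => (1 / 2 : ℝ) • (3 * b i - christoffelTrace (smoothChristoffel hg) i)) (by
      simp only [Derivation.map_smul, map_sub, hL.closed_trace, Derivation.leibniz, smul_eq_mul, hbc]
      rw [show (3 : SmoothFun W) = algebraMap ℝ _ 3 from (map_ofNat _ 3).symm,
        Derivation.map_algebraMap, Derivation.map_algebraMap, mul_zero, mul_zero])
  obtain ⟨φ, hφ, hφd⟩ := f.exists_exp
  refine ⟨φ, hφ, fun c => SmoothFun.exists_potential hW S ?_⟩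
  simp only [Derivation.leibniz, smul_eq_mul, hφd, hf, hb]
  refine DFunLike.ext _ _ fun s => ?_
  have hs : ∀ k, smoothChristoffel hg k 1 0 s = smoothChristoffel hg k 0 1 s := fun k => by
    rw [hL.symmΓ]
  simp only [SmoothFun.add_apply, SmoothFun.mul_apply, SmoothFun.smul_apply, SmoothFun.sub_apply,
    SmoothFun.ofNat_apply, hs]
  ring

end ConstantCurvature

section Slices

variable {E F : Type*} [NormedAddCommGroup E] [NormedSpace ℝ E] [NormedAddCommGroup F]
  [NormedSpace ℝ F]

/-- Iterated derivatives of a slice of a smooth function are partial derivatives of the function. -/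
theorem iteratedFDeriv_slice {Φ : ℝ × E → F} {Ω : Set (ℝ × E)} (hΩ : IsOpen Ω)
    (hΦ : ContDiffOn ℝ ∞ Φ Ω) {t : ℝ} {x : E} (hx : (t, x) ∈ Ω) (n : ℕ) :
    iteratedFDeriv ℝ n (fun y => Φ (t, y)) x =
      (iteratedFDeriv ℝ n Φ (t, x)).compContinuousLinearMap
        fun _ => ContinuousLinearMap.inr ℝ ℝ E := by
  let τ : ℝ × E → ℝ × E := fun z => (t, 0) + z
  have hΩ' : IsOpen (τ ⁻¹' Ω) := hΩ.preimage (by fun_prop)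
  have hΩ'' : IsOpen (ContinuousLinearMap.inr ℝ ℝ E ⁻¹' (τ ⁻¹' Ω)) :=
    hΩ'.preimage (ContinuousLinearMap.continuous _)
  have hτ : τ (0, x) = (t, x) := by simp [τ]
  have hx' : (0, x) ∈ τ ⁻¹' Ω := by rw [Set.mem_preimage, hτ]; exact hx
  have h1 := (ContinuousLinearMap.inr ℝ ℝ E).iteratedFDerivWithin_comp_right (f := Φ ∘ τ)
    (s := τ ⁻¹' Ω) (x := x) (i := n) (n := ∞)
    (hΦ.comp (contDiff_const.add contDiff_id).contDiffOn fun z hz => hz)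
    hΩ'.uniqueDiffOn hΩ''.uniqueDiffOn hx'
    (WithTop.coe_le_coe.2 le_top)
  rw [iteratedFDerivWithin_of_isOpen n hΩ'' hx',
    iteratedFDerivWithin_of_isOpen n hΩ'
    (show ContinuousLinearMap.inr ℝ ℝ E x ∈ τ ⁻¹' Ω from hx')] at h1
  have h2 : iteratedFDeriv ℝ n (Φ ∘ τ) (ContinuousLinearMap.inr ℝ ℝ E x) =
      iteratedFDeriv ℝ n Φ (t, x) := by
    have := iteratedFDeriv_comp_add_left (𝕜 := ℝ) (f := Φ) n (t, (0 : E)) (0, x)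
    rw [← hτ]
    exact this
  rw [h2] at h1
  rw [← h1]
  congr 1
  funext y
  simp [τ]

theorem differentiableAt_iteratedFDeriv_slice {Φ : ℝ × E → F} {Ω : Set (ℝ × E)} (hΩ : IsOpen Ω)
    (hΦ : ContDiffOn ℝ ∞ Φ Ω) {t : ℝ} {x : E} (hx : (t, x) ∈ Ω) (n : ℕ) (v : Fin n → E) :
    DifferentiableAt ℝ (fun r => iteratedFDeriv ℝ n (fun y => Φ (r, y)) x v) t := by
  have h1 : DifferentiableAt ℝ (iteratedFDeriv ℝ n Φ) (t, x) :=
    ((hΦ.contDiffAt (hΩ.mem_nhds hx)).iteratedFDeriv_right (m := 1)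
      (by exact_mod_cast le_top)).differentiableAt (by simp)
  have h2 : DifferentiableAt ℝ (fun r => iteratedFDeriv ℝ n Φ (r, x)
      fun i => ContinuousLinearMap.inr ℝ ℝ E (v i)) t := by
    have h3 : DifferentiableAt ℝ (fun r : ℝ => (r, x)) t := by fun_prop
    exact (ContinuousMultilinearMap.apply ℝ (fun _ : Fin n => ℝ × E) F
      fun i => ContinuousLinearMap.inr ℝ ℝ E (v i)).differentiableAt.comp t
        (DifferentiableAt.comp t h1 h3)
  refine h2.congr_of_eventuallyEq ?_
  have : ∀ᶠ r in 𝓝 t, (r, x) ∈ Ω :=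
    (Continuous.prodMk_left x).continuousAt.eventually (hΩ.mem_nhds hx)
  filter_upwards [this] with r hr
  rw [iteratedFDeriv_slice hΩ hΦ hr]
  rfl

open Module in
/-- A submanifold contains no immersed piece of a space of larger dimension. -/
theorem IsSmoothSubmanifold.finrank_le {d : ℕ} {J : Set F} (hJ : IsSmoothSubmanifold d J)
    {f : E → F} {f' : E →L[ℝ] F} {x : E} (hf : HasFDerivAt f f' x) (hfJ : ∀ᶠ y in 𝓝 x, f y ∈ J)
    (hinj : Function.Injective f') : finrank ℝ E ≤ d := by
  obtain ⟨O, W, φ, ψ, hO, hzO, hW, hφ, hψ, him, hinv⟩ := hJ _ hfJ.self_of_nhds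
  -- near `x` the map `f` factors through the chart as `φ ∘ ψ ∘ f`
  have key : ∀ z ∈ J ∩ O, ψ z ∈ W ∧ φ (ψ z) = z := fun z hz => by
    rw [← him] at hz
    obtain ⟨w, hw, rfl⟩ := hz
    rw [hinv w hw]
    exact ⟨hw, rfl⟩
  have hx := key _ ⟨hfJ.self_of_nhds, hzO⟩
  have dψ : HasFDerivAt ψ (fderiv ℝ ψ (f x)) (f x) :=
    ((hψ.contDiffAt (hO.mem_nhds hzO)).differentiableAt (by simp)).hasFDerivAt
  have dφ : HasFDerivAt φ (fderiv ℝ φ (ψ (f x))) (ψ (f x)) :=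
    ((hφ.contDiffAt (hW.mem_nhds hx.1)).differentiableAt (by simp)).hasFDerivAt
  have h1 := dψ.comp x hf
  have h2 : HasFDerivAt f _ x := (dφ.comp x h1).congr_of_eventuallyEq (by
    filter_upwards [hfJ, hf.continuousAt.eventually (hO.mem_nhds hzO)] with y hy hyO
    exact (key _ ⟨hy, hyO⟩).2.symm)
  have h3 := hf.unique h2
  have hinj' : Function.Injective ((fderiv ℝ ψ (f x)).comp f' : E →L[ℝ] _) := fun u v huv =>
    hinj (by rw [h3]; exact congrArg (fderiv ℝ φ (ψ (f x))) huv)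
  have := LinearMap.finrank_le_finrank_of_injective
    (f := ((fderiv ℝ ψ (f x)).comp f' : E →L[ℝ] _).toLinearMap) hinj'
  simpa using this

end Slices

/-! ### Affine changes of an integral -/

section AffineFamily

variable {s₀ : Fin 2 → ℝ} {m : (Fin 2 → ℝ) → Matrix (Fin 2) (Fin 2) ℝ}
  {g : (Fin 2 → ℝ) → Matrix (Fin 2) (Fin 2) ℝ} {P Q : (Fin 2 → ℝ) → ℝ}

theorem contDiffOn_slice {Φ : ℝ × (Fin 2 → ℝ) → ℝ} {Ω : Set (ℝ × (Fin 2 → ℝ))}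
    (hΦ : ContDiffOn ℝ ∞ Φ Ω) (t : ℝ) {V : Set (Fin 2 → ℝ)} (h : ∀ s ∈ V, (t, s) ∈ Ω) :
    ContDiffOn ℝ ∞ (fun s => Φ (t, s)) V :=
  hΦ.comp (contDiff_prodMk_right t).contDiffOn h

/-- The normalized coefficients of the fractional-linear function `(1 + t P) I + t Q`, where `I`
has the coefficients `m`. -/
noncomputable def affineFamily (m : (Fin 2 → ℝ) → Matrix (Fin 2) (Fin 2) ℝ)
    (P Q : (Fin 2 → ℝ) → ℝ) (t : ℝ) (s : Fin 2 → ℝ) : Matrix (Fin 2) (Fin 2) ℝ :=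
  !![√(1 + t * P s), t * Q s / √(1 + t * P s); 0, 1 / √(1 + t * P s)] * m s

theorem contDiffOn_affineFamily {V : Set (Fin 2 → ℝ)} (hm : ∀ i j, ContDiffOn ℝ ∞ (fun s => m s i j) V)
    (hP : ContDiffOn ℝ ∞ P V) (hQ : ContDiffOn ℝ ∞ Q V) (i j : Fin 2) :
    ContDiffOn ℝ ∞ (fun z : ℝ × (Fin 2 → ℝ) => affineFamily m P Q z.1 z.2 i j)
      {z | z.2 ∈ V ∧ 0 < 1 + z.1 * P z.2} := by
  have sub : ∀ {f : (Fin 2 → ℝ) → ℝ}, ContDiffOn ℝ ∞ f V → ContDiffOn ℝ ∞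
      (fun z : ℝ × (Fin 2 → ℝ) => f z.2) {z | z.2 ∈ V ∧ 0 < 1 + z.1 * P z.2} := fun hf =>
    hf.comp contDiff_snd.contDiffOn fun z hz => hz.1
  have c1 : ContDiffOn ℝ ∞ (fun z : ℝ × (Fin 2 → ℝ) => z.1)
    {z | z.2 ∈ V ∧ 0 < 1 + z.1 * P z.2} := contDiff_fst.contDiffOn
  have c2 : ContDiffOn ℝ ∞ (fun z : ℝ × (Fin 2 → ℝ) => √(1 + z.1 * P z.2))
      {z | z.2 ∈ V ∧ 0 < 1 + z.1 * P z.2} :=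
    (contDiffOn_const.add (c1.mul (sub hP))).sqrt fun z hz => hz.2.ne'
  have h0 : ∀ z ∈ {z : ℝ × (Fin 2 → ℝ) | z.2 ∈ V ∧ 0 < 1 + z.1 * P z.2},
    √(1 + z.1 * P z.2) ≠ 0 := fun z hz => (Real.sqrt_pos.2 hz.2).ne'
  simp only [affineFamily, Matrix.mul_apply, Fin.sum_univ_two]
  fin_cases i
  · exact (c2.mul (sub (hm 0 j))).add (((c1.mul (sub hQ)).div c2 h0).mul (sub (hm 1 j)))
  · exact (contDiffOn_const.mul (sub (hm 0 j))).add
      ((contDiffOn_const.div c2 h0).mul (sub (hm 1 j)))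

/-- If `dP = φ ξ₁` and `dQ = -φ ξ₀` for the coframe `ξ` of an integral `I`, then the affine family
consists of integrals: on the velocity `v` one has `I = ξ₀(v) / ξ₁(v)`, so that
`dP(v) I + dQ(v) = 0`. -/
theorem affineFamily_mem_localIntegrals {W : Set (Fin 2 → ℝ)} (hW : IsOpen W) (hs₀ : s₀ ∈ W)
    (hg : IsRiemannianMetricOn g W) (hm : IsFractionalLinearIntegralOn g W m)
    (hdet : ∀ s ∈ W, (m s).det = 1) (hP : ContDiffOn ℝ ∞ P W) (hQ : ContDiffOn ℝ ∞ Q W)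
    {φ : (Fin 2 → ℝ) → ℝ} (dP : ∀ s ∈ W, ∀ i, pderiv i P s = φ s * coframe g m 1 i s)
    (dQ : ∀ s ∈ W, ∀ i, pderiv i Q s = -(φ s * coframe g m 0 i s)) (hP0 : P s₀ = 0) (t : ℝ) :
    affineFamily m P Q t ∈ localIntegrals g s₀ := by
  let V : Set (Fin 2 → ℝ) := {s | s ∈ W ∧ 0 < 1 + t * P s}
  have hVo : IsOpen V :=
    (continuousOn_const.add (continuousOn_const.mul hP.continuousOn)).isOpen_inter_preimage hW
      isOpen_Ioi (t := Set.Ioi 0)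
  have hVW : V ⊆ W := fun s hs => hs.1
  have hVpos : ∀ s ∈ V, 0 < 1 + t * P s := fun s hs => hs.2
  have hdet' : ∀ s ∈ V, (affineFamily m P Q t s).det = 1 := fun s hs => by
    have := (Real.sqrt_pos.2 hs.2).ne'
    rw [affineFamily, Matrix.det_mul, hdet s hs.1, Matrix.det_fin_two_of]
    field_simp
    ring
  have e : ∀ (m : (Fin 2 → ℝ) → Matrix (Fin 2) (Fin 2) ℝ) t r c,
      (m t *ᵥ r) c = m t c 0 * r 0 + m t c 1 * r 1 := fun m t r c => by
    simp [Matrix.mulVec, dotProduct, Fin.sum_univ_two]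
  have e0 : ∀ s r, (affineFamily m P Q t s *ᵥ r) 0 =
      √(1 + t * P s) * (m s *ᵥ r) 0 + t * Q s / √(1 + t * P s) * (m s *ᵥ r) 1 := fun s r => by
    rw [affineFamily, ← Matrix.mulVec_mulVec]
    simp [Matrix.mulVec, dotProduct, Fin.sum_univ_two]
  have e1 : ∀ s r, (affineFamily m P Q t s *ᵥ r) 1 = (m s *ᵥ r) 1 / √(1 + t * P s) :=
    fun s r => by
      rw [affineFamily, ← Matrix.mulVec_mulVec]
      simp [Matrix.mulVec, dotProduct, Fin.sum_univ_two]
      ring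
  have hcP : ContDiffOn ℝ ∞ (fun s => t * P s) V := contDiffOn_const.mul (hP.mono hVW)
  have hcQ : ContDiffOn ℝ ∞ (fun s => t * Q s) V := contDiffOn_const.mul (hQ.mono hVW)
  refine ⟨V, hVo, ⟨hs₀, by simp [hP0]⟩, ⟨fun i j => ?_, fun s hs => ?_, fun s hs p hp => ?_⟩, hdet'⟩
  · exact contDiffOn_slice (contDiffOn_affineFamily hm.1 hP hQ i j) t
      fun s hs => ⟨hVW hs, hVpos s hs⟩
  · rw [hdet' s hs]; exact one_ne_zero
  · have hp' : (m s *ᵥ p) 1 ≠ 0 := fun h0 => hp (by rw [e1, h0, zero_div])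
    rw [poissonBracket_affine (α := fun s => 1 + t * P s) (β := fun s => t * Q s) hVo
      (fun i j => (hm.1 i j).mono hVW) (contDiffOn_const.add hcP) hcQ (fun s hs r hr => ?_) _ hs hp',
      hm.2.2 s hs.1 p hp']
    · have dPs := hP.differentiableAt_of_isOpen hW hs.1
      have dQs := hQ.differentiableAt_of_isOpen hW hs.1
      have e2 : ∀ i, pderiv i (fun s => 1 + t * P s) s = t * pderiv i P s := fun i => by
        rw [pderiv_add (differentiableAt_const _) (dPs.const_mul t), pderiv_const,
          pderiv_const_mul dPs, zero_add]
      have hpv : p = g s *ᵥ ((g s)⁻¹ *ᵥ p) := by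
        rw [Matrix.mulVec_mulVec, Matrix.mul_nonsing_inv _ (hg.det_pos hs.1).ne'.isUnit,
          Matrix.one_mulVec]
      simp only [e2, pderiv_const_mul dQs, pderiv_geodesicHamiltonian_momentum hg hs.1,
        dP s hs.1, dQ s hs.1]
      -- pairing the coframe with the velocity `g⁻¹ p` gives the linear forms of the integral
      have hc : ∀ c, (m s *ᵥ p) c = coframe g m c 0 s * ((g s)⁻¹ *ᵥ p) 0
          + coframe g m c 1 s * ((g s)⁻¹ *ᵥ p) 1 := fun c => by
        conv_lhs => rw [hpv]
        rw [e, e g, e g]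
        simp only [coframe]
        ring
      rw [fractionalLinear]
      have h0 := hc 0
      have h1 := hc 1
      generalize (m s *ᵥ p) 0 = N at *
      generalize (m s *ᵥ p) 1 = D at *
      have hI : N / D * D = N := div_mul_cancel₀ _ hp'
      linear_combination t * φ s * hI + t * φ s * h0 - t * φ s * (N / D) * h1
    · have hpos := Real.sqrt_pos.2 hs.2
      have hsq := Real.mul_self_sqrt hs.2.le
      simp only [fractionalLinear, e0, e1]
      generalize √(1 + t * P s) = σ at *
      rw [← hsq]
      have := hpos.ne'
      field_simp

end AffineFamily

/-! ### Local integrals in constant curvature -/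

section DimensionFour

variable {k : ℕ} {s₀ : Fin 2 → ℝ} {m : (Fin 2 → ℝ) → Matrix (Fin 2) (Fin 2) ℝ}
  {g : (Fin 2 → ℝ) → Matrix (Fin 2) (Fin 2) ℝ} {P Q : (Fin 2 → ℝ) → ℝ} {U : Set (Fin 2 → ℝ)}

/-- In constant curvature there is an affine family of local integrals with value `1` at `s₀`, whose
`1`-jets vary with the parameter. -/
theorem exists_affineFamily (hU : IsOpen U) (hg : IsRiemannianMetricOn g U) (hs₀ : s₀ ∈ U)
    (hint : AdmitsFractionalLinearIntegralAt g s₀)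
    (hK : IsConstantNear (gaussianCurvature g) s₀) :
    ∃ (m : (Fin 2 → ℝ) → Matrix (Fin 2) (Fin 2) ℝ) (P Q : (Fin 2 → ℝ) → ℝ) (W : Set (Fin 2 → ℝ)),
      IsOpen W ∧ s₀ ∈ W ∧ (∀ i j, ContDiffOn ℝ ∞ (fun s => m s i j) W) ∧ ContDiffOn ℝ ∞ P W ∧
      ContDiffOn ℝ ∞ Q W ∧ m s₀ = 1 ∧ P s₀ = 0 ∧ Q s₀ = 0 ∧ pderiv 0 Q s₀ ≠ 0 ∧
      ∀ t, affineFamily m P Q t ∈ localIntegrals g s₀ := by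
  obtain ⟨m', hm'⟩ := localIntegrals_nonempty hint
  have hd' := det_of_mem_localIntegrals hm'
  obtain ⟨m, hm, hm1⟩ : ∃ m ∈ localIntegrals g s₀, m s₀ = 1 :=
    ⟨_, localIntegrals_mul hU hg hs₀ ⟨(m' s₀).adjugate, by
      rw [Matrix.det_adjugate, hd']; simp⟩ hm', by
      change (m' s₀).adjugate * m' s₀ = 1
      rw [Matrix.adjugate_mul, hd', one_smul]⟩
  obtain ⟨c, hc⟩ := hK
  obtain ⟨V, hVc, hV, hsV⟩ := mem_nhds_iff.1 hc
  obtain ⟨W, hsW, hWc, hWU, hI, hdet⟩ := exists_common_ball (m := fun _ : Fin 1 => m) (hU.inter hV)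
    ⟨hs₀, hsV⟩ fun _ => hm
  have hgW := hg.mono (hWU.trans Set.inter_subset_left)
  have hKW : ∀ i, smoothPartial W i (smoothCurvature hgW) = 0 := fun i =>
    DFunLike.ext _ _ fun s => by
      rw [smoothCurvature, smoothPartial_restrict, smoothRestrict_apply,
        pderiv_congr_on W.isOpen s.2 (fun t ht => hVc (hWU ht).2) i, pderiv_const]
      rfl
  obtain ⟨φ, hφ, h⟩ := exists_coframe_potential hWc hgW (hI 0) (hdet 0) hKW ⟨s₀, hsW⟩
  obtain ⟨P, hP, hP0⟩ := h 1
  obtain ⟨R, hR, hR0⟩ := h 0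
  have hPz : zeroExt P s₀ = 0 := by rw [← hP0]; exact zeroExt_apply P ⟨s₀, hsW⟩
  have dP : ∀ s ∈ W, ∀ i, pderiv i (zeroExt P) s = zeroExt φ s * coframe g m 1 i s :=
    fun s hs i => by
      rw [zeroExt_apply φ ⟨s, hs⟩]
      exact DFunLike.congr_fun (hP i) ⟨s, hs⟩
  have dQ : ∀ s ∈ W, ∀ i, pderiv i (zeroExt (-R)) s = -(zeroExt φ s * coframe g m 0 i s) :=
    fun s hs i => by
      rw [zeroExt_apply φ ⟨s, hs⟩]
      have e : smoothPartial W i (-R) = -(φ * smoothCoframe hgW (hI 0) 0 i) := by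
        rw [map_neg, hR]
      exact DFunLike.congr_fun e ⟨s, hs⟩
  refine ⟨m, zeroExt P, zeroExt (-R), W, W.isOpen, hsW, (hI 0).1, contDiffOn_zeroExt P,
    contDiffOn_zeroExt (-R), hm1, hPz, ?_, ?_, affineFamily_mem_localIntegrals W.isOpen hsW hgW
      (hI 0) (hdet 0) (contDiffOn_zeroExt P) (contDiffOn_zeroExt (-R)) dP dQ hPz⟩
  · rw [zeroExt_apply (-R) ⟨s₀, hsW⟩, SmoothFun.neg_apply, hR0, neg_zero]
  · rw [dQ s₀ hsW, zeroExt_apply φ ⟨s₀, hsW⟩, coframe, hm1]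
    have h1 := (hgW.2 s₀ hsW).diag_pos (i := 0)
    have h2 := hφ ⟨s₀, hsW⟩
    simpa using ⟨h2.ne', h1.ne'⟩

theorem affineFamily_eq_one (hm1 : m s₀ = 1) (hP0 : P s₀ = 0) (hQ0 : Q s₀ = 0) (t : ℝ) :
    affineFamily m P Q t s₀ = 1 := by
  rw [affineFamily, hm1, hP0, hQ0]
  simp [← Matrix.one_fin_two]

theorem pderiv_affineFamily (hm : ∀ i j, DifferentiableAt ℝ (fun s => m s i j) s₀)
    (hP : DifferentiableAt ℝ P s₀) (hQ : DifferentiableAt ℝ Q s₀) (hm1 : m s₀ = 1)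
    (hP0 : P s₀ = 0) (hQ0 : Q s₀ = 0) (t : ℝ) (i : Fin 2) :
    pderiv i (fun s => affineFamily m P Q t s 0 1) s₀ =
      pderiv i (fun s => m s 0 1) s₀ + t * pderiv i Q s₀ := by
  have dσ : DifferentiableAt ℝ (fun s => √(1 + t * P s)) s₀ :=
    ((hP.const_mul t).const_add 1).sqrt (by simp [hP0])
  have hσ : √(1 + t * P s₀) = 1 := by simp [hP0]
  have e : (fun s => affineFamily m P Q t s 0 1) =
      fun s => √(1 + t * P s) * m s 0 1 + t * Q s / √(1 + t * P s) * m s 1 1 := by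
    funext s
    simp [affineFamily, Matrix.mul_apply, Fin.sum_univ_two]
  have hσ0 : √(1 + t * P s₀) ≠ 0 := by rw [hσ]; exact one_ne_zero
  have dq : DifferentiableAt ℝ (fun s => t * Q s / √(1 + t * P s)) s₀ := by
    simp only [div_eq_mul_inv]
    exact (hQ.const_mul t).fun_mul (dσ.fun_inv hσ0)
  rw [e, pderiv_add (dσ.fun_mul (hm 0 1)) (dq.fun_mul (hm 1 1)), pderiv_mul dσ (hm 0 1),
    pderiv_mul dq (hm 1 1), pderiv_div (hQ.const_mul t) dσ hσ0, pderiv_const_mul hQ, hσ, hm1, hQ0]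
  simp

/-- In constant curvature the local integrals depend on at least four parameters: three of
`SL₂(ℝ)` and the parameter of the affine family. -/
theorem not_hasLocalDimension_three (hU : IsOpen U) (hg : IsRiemannianMetricOn g U) (hs₀ : s₀ ∈ U)
    (hint : AdmitsFractionalLinearIntegralAt g s₀)
    (hK : IsConstantNear (gaussianCurvature g) s₀) :
    ¬ HasLocalDimension s₀ (localIntegrals g s₀) 3 := by
  obtain ⟨m, P, Q, W, hW, hsW, hm, hP, hQ, hm1, hP0, hQ0, hQ1, hmem⟩ :=
    exists_affineFamily hU hg hs₀ hint hK
  have hval := affineFamily_eq_one hm1 hP0 hQ0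
  have hpd := pderiv_affineFamily (fun i j => (hm i j).differentiableAt_of_isOpen hW hsW)
    (hP.differentiableAt_of_isOpen hW hsW) (hQ.differentiableAt_of_isOpen hW hsW) hm1 hP0 hQ0
  rintro ⟨k, hinj, -, hJ⟩
  -- all members of the family have the same value at `s₀`, so `0`-jets do not separate germs
  rcases k with _ | k
  · have h0 : jet 0 s₀ (affineFamily m P Q 0) = jet 0 s₀ (affineFamily m P Q 1) := by
      funext ⟨n, v⟩ i j
      obtain rfl : n = 0 := Fin.fin_one_eq_zero n
      exact congrFun (congrFun ((hval 0).trans (hval 1).symm) i) j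
    have h1 := pderiv_congr ((hinj _ (hmem 0) _ (hmem 1) h0).mono fun s hs =>
      congrFun (congrFun hs 0) 1) 0
    rw [hpd, hpd] at h1
    exact hQ1 (by linarith)
  have dchart : ∀ i j (w : EuclideanSpace ℝ (Fin 3)), w 0 ≠ 0 →
      DifferentiableAt ℝ (fun w => specialLinearChart w i j) w := fun i j w hw => by
    have d : ∀ l, DifferentiableAt ℝ (fun w : EuclideanSpace ℝ (Fin 3) => w l) w :=
      fun l => by fun_prop
    have d3 : DifferentiableAt ℝ (fun w : EuclideanSpace ℝ (Fin 3) => (1 + w 1 * w 2) / w 0) w := by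
      simp only [div_eq_mul_inv]
      exact (((d 1).fun_mul (d 2)).const_add 1).fun_mul ((d 0).fun_inv hw)
    fin_cases i <;> fin_cases j
    exacts [d 0, d 1, d 2, d3]
  have djet : ∀ a i j, DifferentiableAt ℝ
      (fun t => jet (k + 1) s₀ (affineFamily m P Q t) a i j) 0 := fun a i j =>
    differentiableAt_iteratedFDeriv_slice (Φ := fun z => affineFamily m P Q z.1 z.2 i j)
      ((continuousOn_const.add (continuousOn_fst.mul (hP.continuousOn.comp continuousOn_snd
        fun z (hz : z ∈ Prod.snd ⁻¹' W) => hz))).isOpen_inter_preimage (hW.preimage continuous_snd)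
        isOpen_Ioi (t := Set.Ioi 0))
      (contDiffOn_affineFamily hm hP hQ i j) ⟨hsW, by simp⟩ _ _
  let f : EuclideanSpace ℝ (Fin 3) × ℝ → JetSpace (k + 1) := fun z =>
    jetMul (specialLinearChart z.1) (jet (k + 1) s₀ (affineFamily m P Q z.2))
  let w₀ : EuclideanSpace ℝ (Fin 3) := !₂[1, 0, 0]
  have hw₀ : w₀ 0 = 1 := rfl
  have df : DifferentiableAt ℝ f (w₀, 0) := by
    refine differentiableAt_pi.2 fun a => differentiableAt_pi.2 fun i =>
      differentiableAt_pi.2 fun j => ?_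
    have c : ∀ l, DifferentiableAt ℝ
        (fun z : EuclideanSpace ℝ (Fin 3) × ℝ => specialLinearChart z.1 i l) (w₀, 0) := fun l =>
      DifferentiableAt.comp (g := fun w => specialLinearChart w i l) (w₀, (0 : ℝ))
        (dchart i l w₀ (by rw [hw₀]; exact one_ne_zero)) differentiableAt_fst
    have q : ∀ l, DifferentiableAt ℝ (fun z : EuclideanSpace ℝ (Fin 3) × ℝ =>
        jet (k + 1) s₀ (affineFamily m P Q z.2) a l j) (w₀, 0) := fun l =>
      DifferentiableAt.comp (g := fun t => jet (k + 1) s₀ (affineFamily m P Q t) a l j)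
        (w₀, (0 : ℝ)) (djet a l j) differentiableAt_snd
    exact ((c 0).fun_mul (q 0)).fun_add ((c 1).fun_mul (q 1))
  have hfJ : ∀ᶠ z in 𝓝 (w₀, (0 : ℝ)), f z ∈ jet (k + 1) s₀ '' localIntegrals g s₀ := by
    have h : ∀ᶠ z : EuclideanSpace ℝ (Fin 3) × ℝ in 𝓝 (w₀, (0 : ℝ)), 0 < z.1 0 :=
      (isOpen_lt continuous_const (by fun_prop)).mem_nhds (by simp [w₀])
    filter_upwards [h] with z hz
    exact ⟨_, localIntegrals_mul hU hg hs₀ ⟨_, det_specialLinearChart hz⟩ (hmem z.2),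
      jet_mul (contDiffAt_of_mem_localIntegrals (hmem z.2)) _⟩
  have hfv : ∀ z i j, f z (jetBase (k + 1)) i j = specialLinearChart z.1 i j := fun z i j => by
    have : jetValue (f z) = specialLinearChart z.1 := by
      rw [jetValue_jetMul, jetValue_jet, hval, Matrix.mul_one]
    exact congrFun (congrFun this i) j
  have hinj' : Function.Injective (fderiv ℝ f (w₀, 0)) := by
    refine (injective_iff_map_eq_zero _).2 fun ⟨v, τ⟩ hv => ?_
    have hl : HasDerivAt (fun r : ℝ => f ((w₀, 0) + r • (v, τ))) 0 0 := by
      have := df.hasFDerivAt.hasLineDerivAt (v, τ)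
      rwa [hv] at this
    have hc : ∀ a i j, HasDerivAt (fun r : ℝ => f ((w₀, 0) + r • (v, τ)) a i j) 0 0 :=
      fun a i j => hasDerivAt_pi.1 (hasDerivAt_pi.1 (hasDerivAt_pi.1 hl a) i) j
    have hlin : ∀ {u : ℝ → ℝ} {α β : ℝ}, HasDerivAt u 0 0 → (∀ r, u r = α + r * β) → β = 0 := by
      intro u α β hu he
      obtain rfl : u = fun r => α + r * β := funext he
      have h := ((hasDerivAt_id (0 : ℝ)).mul_const β).const_add α
      rw [one_mul] at h
      exact h.unique hu
    -- the values of the jets recover the `SL₂(ℝ)` coordinates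
    have hv0 : v 0 = 0 := hlin (α := 1) (hc (jetBase (k + 1)) 0 0) fun r => by
      rw [hfv]; simp [specialLinearChart, w₀]
    have hv1 : v 1 = 0 := hlin (α := 0) (hc (jetBase (k + 1)) 0 1) fun r => by
      rw [hfv]; simp [specialLinearChart, w₀]
    have hv2 : v 2 = 0 := hlin (α := 0) (hc (jetBase (k + 1)) 1 0) fun r => by
      rw [hfv]; simp [specialLinearChart, w₀]
    obtain rfl : v = 0 := by
      ext l
      fin_cases l
      exacts [hv0, hv1, hv2]
    have hf1 : ∀ a r, f ((w₀, 0) + r • (0, τ)) a 0 1 =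
        jet (k + 1) s₀ (affineFamily m P Q (r * τ)) a 0 1 := fun a r => by
      simp [f, jetMul, specialLinearChart, w₀]
    -- a first derivative recovers the parameter of the affine family
    have hτ : τ * pderiv 0 Q s₀ = 0 :=
      hlin (α := pderiv 0 (fun s => m s 0 1) s₀)
        (hc ⟨⟨1, by omega⟩, fun _ => 0⟩ 0 1) fun r => by
          have h1 : jet (k + 1) s₀ (affineFamily m P Q (r * τ)) ⟨⟨1, by omega⟩, fun _ => 0⟩ 0 1 =
              pderiv 0 (fun s => affineFamily m P Q (r * τ) s 0 1) s₀ := by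
            simp only [jet]
            exact iteratedFDeriv_one_apply _
          rw [hf1, h1, hpd, mul_assoc]
    rw [(mul_eq_zero.1 hτ).resolve_right hQ1]
    rfl
  have := hJ.finrank_le df.hasFDerivAt hfJ hinj'
  simp at this

end DimensionFour

theorem mainTheorem1 (U : Set (Fin 2 → ℝ)) (hU : IsOpen U)
    (g : (Fin 2 → ℝ) → Matrix (Fin 2) (Fin 2) ℝ) (hg : IsRiemannianMetricOn g U)
    (s₀ : Fin 2 → ℝ) (hs₀ : s₀ ∈ U) (hint : AdmitsFractionalLinearIntegralAt g s₀) :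
    (HasLocalDimension s₀ (localIntegrals g s₀) 3 ↔
      ¬ IsConstantNear (gaussianCurvature g) s₀) ∧
    (¬ IsConstantNear (gaussianCurvature g) s₀ →
      -- there are only finitely many orbits
      (∃ T : Set ((Fin 2 → ℝ) → Matrix (Fin 2) (Fin 2) ℝ), T.Finite ∧ T ⊆ localIntegrals g s₀ ∧
        ∀ m ∈ localIntegrals g s₀, ∃ t ∈ T, MoebiusEquivalentAt s₀ t m) ∧
      -- near each integral there is only its own orbit
      (∃ k : ℕ, ∀ m ∈ localIntegrals g s₀, ∃ O : Set (JetSpace k), IsOpen O ∧ jet k s₀ m ∈ O ∧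
        ∀ m' ∈ localIntegrals g s₀, jet k s₀ m' ∈ O → MoebiusEquivalentAt s₀ m m')) :=
  ⟨⟨fun h hK => not_hasLocalDimension_three hU hg hs₀ hint hK h,
    hasLocalDimension_three hU hg hs₀ hint⟩,
    fun hK => ⟨finite_orbits hU hg hs₀ hK, 2, fun _ hm => locally_one_orbit hU hg hs₀ hK hm⟩⟩
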